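/- Let $G$ be a real Lie group whose Lie algebra $\mathfrak g$ is isomorphic to the Lie algebra of one of the following non-compact simple groups: $SO^*(2k)$ ($k\ge 3$), $Sp(k,\mathbb R)$ (real symplectic $2k\times 2k$ matrices, $k\ge 2$), $SO_0(2,k)$ ($k\ge 3$), $SU(1,k)$ ($k\ge 3$), $SU(k_1,k_2)$ ($k_1,k_2\ge 2$), or to one of the real forms $\mathfrak e_6^{-14}$, $\mathfrak e_7^{-25}$ of the exceptional simple Lie algebras $\mathfrak e_6$, $\mathfrak e_7$ (the ones with maximal compact subalgebra $\mathfrak{so}(10)\oplus\mathbb R$, respectively $\mathfrak e_6\oplus\mathbb R$). Then for every real number $m>0$ there are infinitely many left-invariant Lorentzian metrics on $G$, no two of them constant multiples of each other, that are non-trivial $m$-quasi-Einstein metrics. Here a pseudo-Riemannian metric $g$ is called $m$-quasi-Einstein if there are a vector field $X$ on $G$ and a constant $\lambda\in\mathbb R$ with $$\mathrm{Ric}+\tfrac12\,\mathfrak L_X g-\tfrac1m\,X^*\otimes X^*=\lambda g,\qquad X^*=g(X,\cdot),$$ where $\mathrm{Ric}$ is the Ricci tensor of $g$ and $\mathfrak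 L_X g$ is the Lie derivative of $g$. Non-trivial means that for each of these metrics the equation holds with some left-invariant vector field $X\ne 0$ and that the metric is not Einstein. A metric is Lorentzian if it has signature $(-,+,\dots,+)$. -/

import Mathlib

open scoped Manifold ContDiff Matrix
open Bundle

attribute [local instance 100] LieRing.ofAssociativeRing

noncomputable section

/-! ### Pseudo-Riemannian geometry on a smooth manifold -/

section Geometry

variable {E : Type*} [NormedAddCommGroup E] [NormedSpace ℝ E]
  {H : Type*} [TopologicalSpace H] (I : ModelWithCorners ℝ E H)
  (M : Type*) [TopologicalSpace M] [ChartedSpace H M]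

/-- A smooth pseudo-Riemannian metric: a smooth field of nondegenerate symmetric bilinear forms on
the tangent spaces. -/
structure PseudoRiemannianMetric [IsManifold I 1 M] where
  /-- The bilinear form on each tangent space. -/
  val (x : M) : TangentSpace I x →L[ℝ] TangentSpace I x →L[ℝ] ℝ
  symm (x : M) (v w : TangentSpace I x) : val x v w = val x w v
  nondegenerate (x : M) (v : TangentSpace I x) (hv : ∀ w : TangentSpace I x, val x v w = 0) : v = 0
  contMDiff : ContMDiff I (I.prod 𝓘(ℝ, E →L[ℝ] E →L[ℝ] ℝ)) ∞
    (fun x ↦ TotalSpace.mk' (E →L[ℝ] E →L[ℝ] ℝ) x (val x))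

variable {I M}

/-- The vector field `X` is smooth. -/
def IsSmoothVectorField [IsManifold I 1 M] (X : Π x : M, TangentSpace I x) : Prop :=
  ContMDiff I I.tangent ∞ (fun x ↦ (⟨x, X x⟩ : TangentBundle I M))

/-- The derivative `(X f)(x)` of a function `f` at `x` in the direction of the vector field `X`. -/
def dirDeriv (X : Π x : M, TangentSpace I x) (f : M → ℝ) (x : M) : ℝ :=
  mfderiv I 𝓘(ℝ, ℝ) f x (X x)

namespace PseudoRiemannianMetric

variable [IsManifold I 1 M]

/-- The metric has signature `(-, +, …, +)`: at every point there is a timelike vector, and the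
metric is positive definite on its orthogonal complement. -/
def IsLorentzian (g : PseudoRiemannianMetric I M) : Prop :=
  ∀ x : M, ∃ v : TangentSpace I x, g.val x v v < 0 ∧
    ∀ w : TangentSpace I x, g.val x v w = 0 → w ≠ 0 → 0 < g.val x w w

/-- The Lie derivative of the metric,
`(𝓛_X g)(Y, Z) = X (g(Y, Z)) - g([X, Y], Z) - g(Y, [X, Z])`. -/
def lieDeriv (g : PseudoRiemannianMetric I M) (X Y Z : Π x : M, TangentSpace I x) (x : M) : ℝ :=
  dirDeriv X (fun y ↦ g.val y (Y y) (Z y)) x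
    - g.val x (VectorField.mlieBracket I X Y x) (Z x)
    - g.val x (Y x) (VectorField.mlieBracket I X Z x)

end PseudoRiemannianMetric

variable [IsManifold I 1 M]

/-- `cov` is the Levi-Civita connection of `g`: it is torsion-free and compatible with `g`. Here
`cov Y x (X x)` is `(∇_X Y)(x)`. -/
def IsLeviCivita (g : PseudoRiemannianMetric I M)
    (cov : CovariantDerivative I E (TangentSpace I : M → Type _)) : Prop :=
  (∀ X Y : Π x : M, TangentSpace I x, IsSmoothVectorField X → IsSmoothVectorField Y → ∀ x : M,
    cov Y x (X x) - cov X x (Y x) = VectorField.mlieBracket I X Y x) ∧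
  (∀ X Y Z : Π x : M, TangentSpace I x, IsSmoothVectorField X → IsSmoothVectorField Y →
    IsSmoothVectorField Z → ∀ x : M,
    dirDeriv X (fun y ↦ g.val y (Y y) (Z y)) x =
      g.val x (cov Y x (X x)) (Z x) + g.val x (Y x) (cov Z x (X x)))

/-- `R` is the curvature tensor of `cov`:
`R(U, V) W = ∇_U ∇_V W - ∇_V ∇_U W - ∇_[U, V] W`. -/
def IsCurvatureTensor (cov : CovariantDerivative I E (TangentSpace I : M → Type _))
    (R : Π x : M, TangentSpace I x →ₗ[ℝ] TangentSpace I x →ₗ[ℝ] TangentSpace I x →ₗ[ℝ]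
      TangentSpace I x) : Prop :=
  ∀ U V W : Π x : M, TangentSpace I x, IsSmoothVectorField U → IsSmoothVectorField V →
    IsSmoothVectorField W → ∀ x : M,
    R x (U x) (V x) (W x) =
      cov (fun y ↦ cov W y (V y)) x (U x) - cov (fun y ↦ cov W y (U y)) x (V x)
        - cov W x (VectorField.mlieBracket I U V x)

/-- `Ric` is the Ricci tensor of `g`: `Ric(v, w)` is the trace of `u ↦ R(u, v) w`, where `R` is the
curvature tensor of the Levi-Civita connection of `g`. -/
def IsRicciTensor (g : PseudoRiemannianMetric I M)
    (Ric : Π x : M, TangentSpace I x → TangentSpace I x → ℝ) : Prop :=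
  ∃ cov : CovariantDerivative I E (TangentSpace I : M → Type _), IsLeviCivita g cov ∧
  ∃ R : Π x : M, TangentSpace I x →ₗ[ℝ] TangentSpace I x →ₗ[ℝ] TangentSpace I x →ₗ[ℝ]
      TangentSpace I x, IsCurvatureTensor cov R ∧
    ∀ (x : M) (v w : TangentSpace I x),
      Ric x v w = LinearMap.trace ℝ (TangentSpace I x) (((R x).flip v).flip w)

/-- The `m`-quasi-Einstein equation with smooth vector field `X` and constant `c`:
`Ric + (1/2) 𝓛_X g - (1/m) X^* ⊗ X^* = c g`, where `X^* = g(X, ·)`. -/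
def IsQuasiEinstein (m : ℝ) (g : PseudoRiemannianMetric I M) (X : Π x : M, TangentSpace I x)
    (c : ℝ) : Prop :=
  IsSmoothVectorField X ∧
  ∃ Ric : Π x : M, TangentSpace I x → TangentSpace I x → ℝ, IsRicciTensor g Ric ∧
    ∀ Y Z : Π x : M, TangentSpace I x, IsSmoothVectorField Y → IsSmoothVectorField Z → ∀ x : M,
      Ric x (Y x) (Z x) + 1 / 2 * g.lieDeriv X Y Z x
          - 1 / m * (g.val x (X x) (Y x) * g.val x (X x) (Z x)) =
        c * g.val x (Y x) (Z x)

/-- `g` is an Einstein metric: its Ricci tensor is a constant multiple of `g`. -/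
def IsEinstein (g : PseudoRiemannianMetric I M) : Prop :=
  ∃ Ric : Π x : M, TangentSpace I x → TangentSpace I x → ℝ, IsRicciTensor g Ric ∧
    ∃ c : ℝ, ∀ (x : M) (v w : TangentSpace I x), Ric x v w = c * g.val x v w

/-- A metric on a Lie group is left-invariant if all left translations are isometries. -/
def IsLeftInvariantMetric {G : Type*} [TopologicalSpace G] [ChartedSpace H G] [Group G]
    [IsManifold I 1 G] (g : PseudoRiemannianMetric I G) : Prop :=
  ∀ (a x : G) (v w : TangentSpace I x),
    g.val (a * x) (mfderiv I I (fun y ↦ a * y) x v) (mfderiv I I (fun y ↦ a * y) x w) = g.val x v w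

/-- The Lie algebra of the Lie group `G` (the tangent space at `1` with the bracket of
left-invariant vector fields) is isomorphic to the real Lie algebra `L`. -/
def HasLieAlgebra (I : ModelWithCorners ℝ E H) (G : Type*) [TopologicalSpace G] [ChartedSpace H G]
    [Group G] (L : Type*) [LieRing L] [LieAlgebra ℝ L] : Prop :=
  ∃ e : GroupLieAlgebra I G ≃ₗ[ℝ] L, ∀ v w : GroupLieAlgebra I G, e ⁅v, w⁆ = ⁅e v, e w⁆

end Geometry

/-! ### The real simple Lie algebras

`𝔰𝔭(k, ℝ)` and `𝔰𝔬(2, k)` are Mathlib's `LieAlgebra.Symplectic.sp (Fin k) ℝ` (real matrices of size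
`2k`) and `LieAlgebra.Orthogonal.so' (Fin 2) (Fin k) ℝ`. -/

/-- The real Lie algebra of complex matrices `A` with `A^* S + S A = 0`. -/
def sesqSkew {n : Type*} [Fintype n] [DecidableEq n] (S : Matrix n n ℂ) :
    LieSubalgebra ℝ (Matrix n n ℂ) where
  carrier := {A | Aᴴ * S + S * A = 0}
  zero_mem' := by simp
  add_mem' {A B} hA hB := by
    simp only [Set.mem_ofPred_eq, Matrix.conjTranspose_add] at *
    calc (Aᴴ + Bᴴ) * S + S * (A + B) = (Aᴴ * S + S * A) + (Bᴴ * S + S * B) := by noncomm_ring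
      _ = 0 := by rw [hA, hB, add_zero]
  smul_mem' c A hA := by
    simp only [Set.mem_ofPred_eq, Matrix.conjTranspose_smul, star_trivial] at *
    rw [Matrix.smul_mul, Matrix.mul_smul, ← smul_add, hA, smul_zero]
  lie_mem' {A B} hA hB := by
    simp only [Set.mem_ofPred_eq, LieRing.of_associative_ring_bracket, Matrix.conjTranspose_sub,
      Matrix.conjTranspose_mul] at *
    calc (Bᴴ * Aᴴ - Aᴴ * Bᴴ) * S + S * (A * B - B * A)
        = Bᴴ * (Aᴴ * S + S * A) - Aᴴ * (Bᴴ * S + S * B) + (Aᴴ * S + S * A) * B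
          - (Bᴴ * S + S * B) * A := by noncomm_ring
      _ = 0 := by rw [hA, hB]; simp

/-- A complex Lie algebra of matrices, regarded as a real one. -/
def realRestrict {n : Type*} [Fintype n] [DecidableEq n] (K : LieSubalgebra ℂ (Matrix n n ℂ)) :
    LieSubalgebra ℝ (Matrix n n ℂ) where
  carrier := {A | A ∈ K}
  zero_mem' := K.zero_mem
  add_mem' hA hB := K.add_mem hA hB
  smul_mem' c A hA := by
    have h := K.smul_mem (c : ℂ) hA
    rwa [Complex.coe_smul] at h
  lie_mem' hA hB := K.lie_mem hA hB

/-- `𝔰𝔲(p, q)`: trace zero matrices that are skew for the Hermitian form `diag(1_p, -1_q)`. -/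
def suPQ (p q : ℕ) : LieSubalgebra ℝ (Matrix (Fin p ⊕ Fin q) (Fin p ⊕ Fin q) ℂ) :=
  realRestrict (LieAlgebra.SpecialLinear.sl (Fin p ⊕ Fin q) ℂ) ⊓
    sesqSkew (LieAlgebra.Orthogonal.indefiniteDiagonal (Fin p) (Fin q) ℂ)

/-- `𝔰𝔬^*(2k)`: the matrices `A ∈ 𝔰𝔬(2k, ℂ)` with `A^* J + J A = 0`, where
`J = [[0, -1], [1, 0]]`. -/
def soStar (k : ℕ) : LieSubalgebra ℝ (Matrix (Fin k ⊕ Fin k) (Fin k ⊕ Fin k) ℂ) :=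
  realRestrict (LieAlgebra.Orthogonal.so (Fin k ⊕ Fin k) ℂ) ⊓ sesqSkew (Matrix.J (Fin k) ℂ)

/-- The weights of the minuscule representation of type `E_n` (`n = 6`: 27 weights, `n = 7`: 56
weights), realized as the exceptional classes `v = d H - m₁ E₁ - … - m_n E_n` of a del Pezzo
surface, i.e. the `v = (d, m₁, …, m_n) ∈ ℤ^(1,n)` with `d² - ∑ mᵢ² = -1` and `3 d - ∑ mᵢ = 1`.
For `n ≤ 7` these equations force all coordinates to lie in `{-1, …, 3}`. -/
def minusculeWeights (n : ℕ) : Finset (Fin (n + 1) → ℤ) :=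
  (Fintype.piFinset fun _ ↦ Finset.Icc (-1) 3).filter fun v ↦
    v 0 ^ 2 - ∑ i : Fin n, v i.succ ^ 2 = -1 ∧ 3 * v 0 - ∑ i : Fin n, v i.succ = 1

/-- The simple roots of type `E_n` in the same coordinates: `H - E₁ - E₂ - E₃` and
`E_i - E_(i+1)` for `1 ≤ i < n`. -/
def simpleRoots (n : ℕ) : Set (Fin (n + 1) → ℤ) :=
  {fun j ↦ if j.val ≤ 3 then 1 else 0} ∪
    {α | ∃ i j : Fin (n + 1), 1 ≤ i.val ∧ j.val = i.val + 1 ∧ α = Pi.single j 1 - Pi.single i 1}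

/-- The operator on the space with basis `(e_v)` indexed by the weights that maps `e_v` to
`e_(v+α)` if `v + α` is a weight, and to `0` otherwise. -/
def weightShift (n : ℕ) (α : Fin (n + 1) → ℤ) :
    Matrix (minusculeWeights n) (minusculeWeights n) ℂ :=
  Matrix.of fun u v ↦ if u.val = v.val + α then 1 else 0

/-- The complex simple Lie algebra of type `E_n` (`n = 6, 7`), acting on its minuscule
representation. In a minuscule representation of a simply laced Lie algebra, all weights have
multiplicity one and the Chevalley generators for the simple roots `α` and their negatives are the
operators `weightShift n α`, `weightShift n (-α)`; they generate the Lie algebra. -/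
def complexE (n : ℕ) : LieSubalgebra ℂ (Matrix (minusculeWeights n) (minusculeWeights n) ℂ) :=
  LieSubalgebra.lieSpan ℂ _
    {A | ∃ α ∈ simpleRoots n, A = weightShift n α ∨ A = weightShift n (-α)}

/-- The diagonal Hermitian form with sign `(-1)^(m_n)` at the weight `(d, m₁, …, m_n)`. The sign is
unchanged under all simple roots except `E_(n-1) - E_n`. -/
def weightSign (n : ℕ) : Matrix (minusculeWeights n) (minusculeWeights n) ℂ :=
  Matrix.diagonal fun v ↦ if Even (v.val (Fin.last n)) then 1 else -1

/-- The real form of Hermitian type of the complex Lie algebra of type `E_n`, `n = 6, 7`: the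
elements that are skew for `weightSign n`. For the identity matrix in place of `weightSign n` one
would get the compact real form; here the generators for `E_(n-1) - E_n`, a simple root with
coefficient one in the highest root, become noncompact. The maximal compact subalgebra is
`𝔰𝔬(10) ⊕ ℝ` for `n = 6` and `𝔢₆ ⊕ ℝ` for `n = 7`, so the Killing form has signature (positive minus
negative) `32 - 46 = -14` and `54 - 79 = -25`, respectively. -/
def hermitianE (n : ℕ) : LieSubalgebra ℝ (Matrix (minusculeWeights n) (minusculeWeights n) ℂ) :=
  realRestrict (complexE n) ⊓ sesqSkew (weightSign n)

/-- The real form `𝔢₆^(-14)` of `𝔢₆`. -/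
abbrev e6m14 := hermitianE 6

/-- The real form `𝔢₇^(-25)` of `𝔢₇`. -/
abbrev e7m25 := hermitianE 7

end

section SpectralTheory

set_option linter.unusedSectionVars false

variable {V : Type*} [AddCommGroup V] [Module ℝ V] [FiniteDimensional ℝ V]

/-- A positive definite symmetric bilinear form. -/
structure IsPosDefForm (β : V →ₗ[ℝ] V →ₗ[ℝ] ℝ) : Prop where
  symm : ∀ x y, β x y = β y x
  pos : ∀ x, x ≠ 0 → 0 < β x x

namespace IsPosDefForm

variable {β : V →ₗ[ℝ] V →ₗ[ℝ] ℝ}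

lemma nonneg (hβ : IsPosDefForm β) (x : V) : 0 ≤ β x x := by
  rcases eq_or_ne x 0 with rfl | h
  · simp
  · exact (hβ.pos x h).le

lemma eq_zero (hβ : IsPosDefForm β) {x : V} (h : β x x = 0) : x = 0 := by
  by_contra hx
  exact (hβ.pos x hx).ne' h

lemma ext_left (hβ : IsPosDefForm β) {x y : V} (h : ∀ z, β x z = β y z) : x = y := by
  have : β (x - y) (x - y) = 0 := by rw [map_sub β, LinearMap.sub_apply, h, sub_self]
  exact sub_eq_zero.1 (hβ.eq_zero this)

/-- The spectral theorem for an operator which is symmetric for a positive definite form. -/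
lemma exists_eigenbasis (hβ : IsPosDefForm β) (C : V →ₗ[ℝ] V)
    (hC : ∀ x y, β (C x) y = β x (C y)) :
    ∃ (n : ℕ) (b : Module.Basis (Fin n) ℝ V) (μ : Fin n → ℝ),
      (∀ i j, β (b i) (b j) = if i = j then 1 else 0) ∧ ∀ i, C (b i) = μ i • b i := by
  let core : InnerProductSpace.Core ℝ V :=
    { inner := fun x y ↦ β x y
      conj_inner_symm := fun x y ↦ by simpa using hβ.symm y x
      re_inner_nonneg := fun x ↦ by simpa using hβ.nonneg x
      add_left := fun x y z ↦ by simp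
      smul_left := fun x y r ↦ by simp
      definite := fun x hx ↦ hβ.eq_zero hx }
  let := core.toNormedAddCommGroup
  let : InnerProductSpace ℝ V := InnerProductSpace.ofCore core.toCore
  have hs : C.IsSymmetric := fun x y ↦ hC x y
  refine ⟨Module.finrank ℝ V, (hs.eigenvectorBasis rfl).toBasis, hs.eigenvalues rfl, ?_, ?_⟩
  · intro i j
    simpa using! orthonormal_iff_ite.1 (hs.eigenvectorBasis rfl).orthonormal i j
  · intro i
    simp

lemma exists_basis (hβ : IsPosDefForm β) : ∃ (n : ℕ) (b : Module.Basis (Fin n) ℝ V),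
    ∀ i j, β (b i) (b j) = if i = j then 1 else 0 := by
  obtain ⟨n, b, -, h, -⟩ := hβ.exists_eigenbasis 0 (by simp)
  exact ⟨n, b, h⟩

lemma repr_eq {n : ℕ} {b : Module.Basis (Fin n) ℝ V}
    (hb : ∀ i j, β (b i) (b j) = if i = j then 1 else 0) (x : V) (i : Fin n) :
    b.repr x i = β x (b i) := by
  have h : β (∑ j, b.repr x j • b j) (b i) = b.repr x i := by
    simp only [map_sum, map_smul, LinearMap.sum_apply, LinearMap.smul_apply, hb]
    simp
  rw [← h, b.sum_repr]

lemma trace_eq_sum {n : ℕ} {b : Module.Basis (Fin n) ℝ V}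
    (hb : ∀ i j, β (b i) (b j) = if i = j then 1 else 0) (A : V →ₗ[ℝ] V) :
    LinearMap.trace ℝ V A = ∑ i, β (A (b i)) (b i) := by
  rw [LinearMap.trace_eq_matrix_trace ℝ b, Matrix.trace]
  refine Finset.sum_congr rfl fun i _ ↦ ?_
  rw [Matrix.diag_apply, LinearMap.toMatrix_apply, repr_eq hb]

lemma trace_nonneg (hβ : IsPosDefForm β) {A B F : V →ₗ[ℝ] V} (hAB : ∀ x y, β (B x) y = β x (A y))
    (hF : ∀ x, 0 ≤ β (F x) x) : 0 ≤ LinearMap.trace ℝ V (B ∘ₗ F ∘ₗ A) := by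
  obtain ⟨n, b, hb⟩ := hβ.exists_basis
  rw [trace_eq_sum hb]
  refine Finset.sum_nonneg fun i _ ↦ ?_
  simpa [hAB] using hF (A (b i))

lemma trace_pos (hβ : IsPosDefForm β) {A B : V →ₗ[ℝ] V} (hAB : ∀ x y, β (B x) y = β x (A y))
    (hA : A ≠ 0) : 0 < LinearMap.trace ℝ V (B ∘ₗ A) := by
  obtain ⟨n, b, hb⟩ := hβ.exists_basis
  rw [trace_eq_sum hb]
  obtain ⟨i, hi⟩ : ∃ i, A (b i) ≠ 0 := by
    by_contra! h
    exact hA (b.ext (by simpa using h))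
  refine Finset.sum_pos' (fun i _ ↦ ?_) ⟨i, Finset.mem_univ _, ?_⟩
  · simpa [hAB] using hβ.nonneg (A (b i))
  · simpa [hAB] using hβ.pos (A (b i)) hi

/-- Every bilinear form is represented by an operator. -/
lemma exists_represent (hβ : IsPosDefForm β) (τ : V →ₗ[ℝ] V →ₗ[ℝ] ℝ) :
    ∃ T : V →ₗ[ℝ] V, ∀ x y, β (T x) y = τ x y := by
  obtain ⟨n, b, hb⟩ := hβ.exists_basis
  refine ⟨∑ i, (τ.flip (b i)).smulRight (b i), fun x y ↦ ?_⟩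
  conv_rhs => rw [← b.sum_repr y]
  simp [LinearMap.sum_apply, repr_eq hb, hβ.symm y, mul_comm]

/-- Functional calculus for the quadratic equation `(1 - c) x ^ 2 - 4 t x + c = 0`. -/
lemma exists_quadratic_root {c t : ℝ} (h0 : 0 ≤ c) (h1 : c ≤ 1) (ht : 1 ≤ t) :
    ∃ x : ℝ, 0 < x ∧ c + (1 - c) * x ^ 2 = 4 * t * x := by
  rcases eq_or_lt_of_le h1 with rfl | h1
  · exact ⟨1 / (4 * t), by positivity, by field_simp; ring⟩
  · have hd : 0 ≤ 4 * t ^ 2 - c * (1 - c) := by nlinarith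
    refine ⟨(2 * t + √(4 * t ^ 2 - c * (1 - c))) / (1 - c),
      div_pos (by positivity) (by linarith), ?_⟩
    have h2 : (1 - c) ≠ 0 := by linarith
    have h3 := Real.sq_sqrt hd
    generalize √(4 * t ^ 2 - c * (1 - c)) = s at h3 ⊢
    field_simp
    linear_combination h3

lemma exists_root_operator (hβ : IsPosDefForm β) {C : V →ₗ[ℝ] V}
    (hC : ∀ x y, β (C x) y = β x (C y)) (h0 : ∀ x, 0 ≤ β (C x) x) (h1 : ∀ x, β (C x) x ≤ β x x)
    {t : ℝ} (ht : 1 ≤ t) :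
    ∃ F : V →ₗ[ℝ] V, (∀ x y, β (F x) y = β x (F y)) ∧ (∀ x, x ≠ 0 → 0 < β (F x) x) ∧
      (∀ A : V →ₗ[ℝ] V, A ∘ₗ C = C ∘ₗ A → A ∘ₗ F = F ∘ₗ A) ∧
      (∀ x, C x + F (F x) - C (F (F x)) = (4 * t) • F x) ∧
      ∀ x, C x = 0 → F x = (4 * t) • x := by
  obtain ⟨n, b, μ, hb, hμ⟩ := hβ.exists_eigenbasis C hC
  have hμ0 (i) : 0 ≤ μ i := by simpa [hμ, hb] using h0 (b i)
  have hμ1 (i) : μ i ≤ 1 := by simpa [hμ, hb] using h1 (b i)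
  have hroot (c : ℝ) : ∃ x : ℝ, 0 ≤ c → c ≤ 1 → 0 < x ∧ c + (1 - c) * x ^ 2 = 4 * t * x := by
    by_cases h : 0 ≤ c ∧ c ≤ 1
    · obtain ⟨x, hx⟩ := exists_quadratic_root h.1 h.2 ht
      exact ⟨x, fun _ _ ↦ hx⟩
    · exact ⟨0, fun h0 h1 ↦ (h ⟨h0, h1⟩).elim⟩
  choose f hf using hroot
  let F : V →ₗ[ℝ] V := b.constr ℝ fun i ↦ f (μ i) • b i
  have hF (i) : F (b i) = f (μ i) • b i := b.constr_basis ℝ _ i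
  have hcoord {x y : V} (h : ∀ i, β x (b i) = β y (b i)) : x = y :=
    b.ext_elem fun i ↦ by rw [repr_eq hb, repr_eq hb, h]
  have hFs (x y : V) : β (F x) y = β x (F y) := by
    have : β.comp F = β.compl₂ F := b.ext fun i ↦ b.ext fun j ↦ by
      rcases eq_or_ne i j with rfl | h
      · simp [hF]
      · simp [hF, hb, h]
    simpa using LinearMap.congr_fun₂ this x y
  have hFi (x : V) (i) : β (F x) (b i) = f (μ i) * β x (b i) := by simp [hFs, hF]
  have hCi (x : V) (i) : β (C x) (b i) = μ i * β x (b i) := by simp [hC, hμ]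
  refine ⟨F, hFs, fun x hx ↦ ?_, fun A hA ↦ ?_, fun x ↦ ?_, fun x hx ↦ ?_⟩
  · have hexp : β (F x) x = ∑ i, f (μ i) * (b.repr x i) ^ 2 := by
      have : β (F x) (∑ i, b.repr x i • b i) = ∑ i, f (μ i) * (b.repr x i) ^ 2 := by
        simp only [map_sum, map_smul, hFi, ← repr_eq hb x, smul_eq_mul]
        exact Finset.sum_congr rfl fun i _ ↦ by ring
      rwa [b.sum_repr] at this
    obtain ⟨i, hi⟩ : ∃ i, b.repr x i ≠ 0 := by
      by_contra! h
      exact hx (b.ext_elem fun i ↦ by simpa using h i)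
    rw [hexp]
    exact Finset.sum_pos' (fun i _ ↦ mul_nonneg (hf _ (hμ0 i) (hμ1 i)).1.le (sq_nonneg _))
      ⟨i, Finset.mem_univ _, mul_pos (hf _ (hμ0 i) (hμ1 i)).1 (by positivity)⟩
  · refine b.ext fun j ↦ hcoord fun i ↦ ?_
    have h1 : β (A (C (b j))) (b i) = β (C (A (b j))) (b i) := by
      rw [show A (C (b j)) = C (A (b j)) from LinearMap.congr_fun hA (b j)]
    rw [hCi, hμ, map_smul, map_smul, LinearMap.smul_apply, smul_eq_mul] at h1
    simp only [LinearMap.comp_apply, hFi, hF, map_smul, LinearMap.smul_apply, smul_eq_mul]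
    rcases mul_eq_mul_right_iff.1 h1 with h | h <;> simp [h]
  · refine hcoord fun i ↦ ?_
    simp only [map_add, map_sub, map_smul, LinearMap.add_apply, LinearMap.sub_apply,
      LinearMap.smul_apply, hFi, hCi, smul_eq_mul]
    linear_combination β x (b i) * (hf _ (hμ0 i) (hμ1 i)).2
  · refine hcoord fun i ↦ ?_
    have h := hCi x i
    rw [hx, map_zero, LinearMap.zero_apply] at h
    rw [hFi, map_smul, LinearMap.smul_apply, smul_eq_mul]
    rcases mul_eq_zero.1 h.symm with h | h
    · obtain ⟨h2, h3⟩ := hf _ (hμ0 i) (hμ1 i)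
      rw [h] at h2 h3 ⊢
      have : f 0 = 4 * t := mul_right_cancel₀ h2.ne' (by linear_combination h3)
      rw [this]
    · simp [h]

end IsPosDefForm
end SpectralTheory

section AlgebraicRicci

variable {𝔤 : Type*} [LieRing 𝔤] [LieAlgebra ℝ 𝔤]

/-- The product `N x y = ∇_x y` on left-invariant fields which defines the Levi-Civita connection of
the left-invariant metric `b`. -/
structure IsLeviCivitaProduct (b : 𝔤 →ₗ[ℝ] 𝔤 →ₗ[ℝ] ℝ) (N : 𝔤 →ₗ[ℝ] 𝔤 →ₗ[ℝ] 𝔤) : Prop where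
  torsion : ∀ x y, N x y - N y x = ⁅x, y⁆
  compat : ∀ x y z, b (N x y) z + b y (N x z) = 0

/-- The curvature `R(x, y) z` of the product `N`, as a linear function of `x`. -/
def curvatureEnd (N : 𝔤 →ₗ[ℝ] 𝔤 →ₗ[ℝ] 𝔤) (y z : 𝔤) : 𝔤 →ₗ[ℝ] 𝔤 :=
  N.flip (N y z) - N y ∘ₗ N.flip z + N.flip z ∘ₗ LieAlgebra.ad ℝ 𝔤 y

lemma curvatureEnd_apply (N : 𝔤 →ₗ[ℝ] 𝔤 →ₗ[ℝ] 𝔤) (x y z : 𝔤) :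
    curvatureEnd N y z x = N x (N y z) - N y (N x z) - N ⁅x, y⁆ z := by
  rw [← lie_skew x y, map_neg, LinearMap.neg_apply, sub_neg_eq_add]
  simp [curvatureEnd]

/-- The Ricci form of the product `N`. -/
noncomputable def ricciForm (N : 𝔤 →ₗ[ℝ] 𝔤 →ₗ[ℝ] 𝔤) (y z : 𝔤) : ℝ :=
  LinearMap.trace ℝ 𝔤 (curvatureEnd N y z)

lemma IsLeviCivitaProduct.unique {b : 𝔤 →ₗ[ℝ] 𝔤 →ₗ[ℝ] ℝ} {N N' : 𝔤 →ₗ[ℝ] 𝔤 →ₗ[ℝ] 𝔤}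
    (hsymm : ∀ x y, b x y = b y x) (hnd : ∀ x, (∀ y, b x y = 0) → x = 0)
    (h : IsLeviCivitaProduct b N) (h' : IsLeviCivitaProduct b N') : N = N' := by
  have hS (x y : 𝔤) : N x y - N' x y = N y x - N' y x := by
    have := (h.torsion x y).trans (h'.torsion x y).symm
    rw [sub_eq_sub_iff_add_eq_add] at this ⊢
    rw [this, add_comm]
  have hc (x y z : 𝔤) : b (N x y - N' x y) z = - b (N x z - N' x z) y := by
    have := h.compat x y z
    have := h'.compat x y z
    simp only [map_sub, LinearMap.sub_apply]
    linarith [hsymm y (N x z), hsymm y (N' x z)]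
  refine LinearMap.ext₂ fun x y ↦ sub_eq_zero.1 (hnd _ fun z ↦ ?_)
  have h1 := hc x y z
  have h2 := hc z x y
  have h3 := hc y z x
  rw [hS x z] at h1
  rw [hS z y] at h2
  rw [hS y x] at h3
  linarith

lemma trace_eq_zero_of_skew {V : Type*} [AddCommGroup V] [Module ℝ V] [FiniteDimensional ℝ V]
    {b : V →ₗ[ℝ] V →ₗ[ℝ] ℝ} (hnd : ∀ x, (∀ y, b x y = 0) → x = 0) {A : V →ₗ[ℝ] V}
    (hA : ∀ y z, b (A y) z + b y (A z) = 0) : LinearMap.trace ℝ V A = 0 := by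
  have hinj : Function.Injective b :=
    (injective_iff_map_eq_zero b).2 fun x hx ↦ hnd x fun y ↦ by simp [hx]
  let e : V ≃ₗ[ℝ] Module.Dual ℝ V :=
    LinearEquiv.ofInjectiveOfFinrankEq b hinj (Subspace.dual_finrank_eq).symm
  have he (x : V) : e x = b x := rfl
  have h1 : Module.Dual.transpose (R := ℝ) A + e.conj A = 0 := by
    refine LinearMap.ext fun f ↦ LinearMap.ext fun y ↦ ?_
    obtain ⟨x, rfl⟩ := e.surjective f
    have := hA x y
    rw [LinearMap.add_apply, LinearEquiv.conj_apply_apply, LinearEquiv.symm_apply_apply, he, he]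
    simp only [Module.Dual.transpose_apply, LinearMap.comp_apply, LinearMap.add_apply,
      LinearMap.zero_apply]
    linarith
  have h2 := congrArg (LinearMap.trace ℝ (Module.Dual ℝ V)) h1
  rw [map_add, LinearMap.trace_transpose', LinearMap.trace_conj', map_zero] at h2
  linarith

/-- The Ricci form of a unimodular Lie algebra. -/
lemma ricciForm_eq [FiniteDimensional ℝ 𝔤] {b : 𝔤 →ₗ[ℝ] 𝔤 →ₗ[ℝ] ℝ} {N : 𝔤 →ₗ[ℝ] 𝔤 →ₗ[ℝ] 𝔤}
    (hnd : ∀ x, (∀ y, b x y = 0) → x = 0) (h : IsLeviCivitaProduct b N)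
    (had : ∀ x : 𝔤, LinearMap.trace ℝ 𝔤 (LieAlgebra.ad ℝ 𝔤 x) = 0) (y z : 𝔤) :
    ricciForm N y z = - LinearMap.trace ℝ 𝔤 (N.flip y * N.flip z) := by
  have hflip (w : 𝔤) : N.flip w = N w - LieAlgebra.ad ℝ 𝔤 w := LinearMap.ext fun x ↦ by
    have := h.torsion w x
    simp [← this]
  have h0 : LinearMap.trace ℝ 𝔤 (N.flip (N y z)) = 0 := by
    rw [hflip, map_sub, had, trace_eq_zero_of_skew hnd (h.compat _), sub_zero]
  have h1 : curvatureEnd N y z = N.flip (N y z) - N y * N.flip z + N.flip z * (N y - N.flip y) := by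
    rw [hflip y, sub_sub_cancel]
    rfl
  rw [ricciForm, h1, map_add, map_sub, h0, mul_sub, map_sub, LinearMap.trace_mul_comm ℝ (N y),
    LinearMap.trace_mul_comm ℝ (N.flip z) (N.flip y)]
  ring

/-- Left-invariant data of a Lorentzian `m`-quasi-Einstein metric which is not Einstein, with
nonzero Killing field `v` and constant `c`. -/
structure IsQuasiEinsteinData (m : ℝ) (b : 𝔤 →ₗ[ℝ] 𝔤 →ₗ[ℝ] ℝ) (v : 𝔤) (c : ℝ) : Prop where
  symm : ∀ x y, b x y = b y x
  nondegenerate : ∀ x, (∀ y, b x y = 0) → x = 0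
  lorentzian : ∃ x, b x x < 0 ∧ ∀ w, b x w = 0 → w ≠ 0 → 0 < b w w
  ne_zero : v ≠ 0
  killing : ∀ y z, b ⁅v, y⁆ z + b y ⁅v, z⁆ = 0
  exists_product : ∃ N, IsLeviCivitaProduct b N ∧
    (∀ y z, ricciForm N y z - 1 / m * (b v y * b v z) = c * b y z) ∧
    ∀ c' : ℝ, ∃ y z, ricciForm N y z ≠ c' * b y z

variable (𝔤) in
/-- There is a sequence of pairwise non-proportional quasi-Einstein data. -/
def AdmitsQuasiEinsteinData (m : ℝ) : Prop :=
  ∃ b : ℕ → 𝔤 →ₗ[ℝ] 𝔤 →ₗ[ℝ] ℝ, (∀ i j, i ≠ j → ∀ c : ℝ, b j ≠ c • b i) ∧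
    ∀ i, ∃ v c, IsQuasiEinsteinData m (b i) v c

end AlgebraicRicci

section HermitianPair

variable {𝔤 : Type*} [LieRing 𝔤] [LieAlgebra ℝ 𝔤]

/-- A Hermitian structure on a Lie algebra: an element `Z` such that `ad Z` vanishes on a compactly
embedded subalgebra `𝔨` and is a complex structure on the complement `𝔭`, where `𝔭` is irreducible
under `𝔨` in the sense that all `𝔨`-equivariant operators act on it by complex scalars. -/
structure IsHermitianPair (Z : 𝔤) (Q : 𝔤 →ₗ[ℝ] 𝔤 →ₗ[ℝ] ℝ) : Prop where
  cube : ∀ x : 𝔤, ⁅Z, ⁅Z, ⁅Z, x⁆⁆⁆ = -⁅Z, x⁆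
  exists_ne : ∃ x : 𝔤, ⁅Z, x⁆ ≠ 0
  symm : ∀ x y, Q x y = Q y x
  invariant : ∀ x y z : 𝔤, Q ⁅x, y⁆ z = - Q y ⁅x, z⁆
  pos : ∀ x : 𝔤, ⁅Z, x⁆ = 0 → x ≠ 0 → 0 < Q x x
  neg : ∀ x : 𝔤, ⁅Z, ⁅Z, x⁆⁆ = -x → x ≠ 0 → Q x x < 0
  center : ∀ x : 𝔤, (∀ y : 𝔤, ⁅x, y⁆ = 0) → x = 0
  irreducible : ∀ T : 𝔤 →ₗ[ℝ] 𝔤, (∀ u : 𝔤, ⁅Z, u⁆ = 0 → ∀ x : 𝔤, T ⁅u, x⁆ = ⁅u, T x⁆) →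
    ∃ a b : ℝ, ∀ x : 𝔤, ⁅Z, ⁅Z, x⁆⁆ = -x → T x = a • x + b • ⁅Z, x⁆

section Cube

variable {Z : 𝔤}

/-- The bracket of two elements of `𝔭` lies in `𝔨`. -/
lemma lie_eq_zero_of_cube (cube : ∀ x : 𝔤, ⁅Z, ⁅Z, ⁅Z, x⁆⁆⁆ = -⁅Z, x⁆) {x y : 𝔤}
    (hx : ⁅Z, ⁅Z, x⁆⁆ = -x) (hy : ⁅Z, ⁅Z, y⁆⁆ = -y) : ⁅Z, ⁅x, y⁆⁆ = 0 := by
  have h := cube ⁅x, y⁆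
  rw [leibniz_lie Z x y] at h ⊢
  generalize hx' : ⁅Z, x⁆ = x' at *
  generalize hy' : ⁅Z, y⁆ = y' at *
  simp only [leibniz_lie Z x y, leibniz_lie Z x' y, leibniz_lie Z x y', leibniz_lie Z x' y',
    lie_add, hx, hy, hx', hy', lie_neg, neg_lie] at h
  have h4 : (3 : ℝ) • (⁅x', y⁆ + ⁅x, y'⁆) = 0 := by
    linear_combination (norm := module) (-1 : ℝ) • h
  exact (smul_eq_zero.1 h4).resolve_left (by norm_num)

end Cube

namespace IsHermitianPair

variable (Z : 𝔤)

/-- The projection to `𝔭`. -/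
def projP : Module.End ℝ 𝔤 := -(LieAlgebra.ad ℝ 𝔤 Z * LieAlgebra.ad ℝ 𝔤 Z)

/-- The projection to `𝔨`. -/
def projK : Module.End ℝ 𝔤 := 1 + LieAlgebra.ad ℝ 𝔤 Z * LieAlgebra.ad ℝ 𝔤 Z

lemma projP_apply (x : 𝔤) : projP Z x = -⁅Z, ⁅Z, x⁆⁆ := rfl

lemma projK_apply (x : 𝔤) : projK Z x = x + ⁅Z, ⁅Z, x⁆⁆ := rfl

lemma projK_add_projP : projK Z + projP Z = 1 := by
  simp [-lie_skew, projK, projP]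

lemma projK_add_projP_apply (x : 𝔤) : projK Z x + projP Z x = x := by
  simp [-lie_skew, projK_apply, projP_apply]

variable {Z} {Q : 𝔤 →ₗ[ℝ] 𝔤 →ₗ[ℝ] ℝ}

section

variable (h : IsHermitianPair Z Q)
include h

lemma lie_projK (x : 𝔤) : ⁅Z, projK Z x⁆ = 0 := by simp [-lie_skew, projK_apply, h.cube]

lemma lie_projP (x : 𝔤) : ⁅Z, projP Z x⁆ = ⁅Z, x⁆ := by simp [-lie_skew, projP_apply, h.cube]

lemma lie_lie_projP (x : 𝔤) : ⁅Z, ⁅Z, projP Z x⁆⁆ = -projP Z x := by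
  rw [h.lie_projP, projP_apply, neg_neg]

omit h in
lemma projK_of_mem {x : 𝔤} (hx : ⁅Z, x⁆ = 0) : projK Z x = x := by simp [-lie_skew, projK_apply, hx]

omit h in
lemma projP_of_mem_k {x : 𝔤} (hx : ⁅Z, x⁆ = 0) : projP Z x = 0 := by simp [-lie_skew, projP_apply, hx]

omit h in
lemma projP_of_mem {x : 𝔤} (hx : ⁅Z, ⁅Z, x⁆⁆ = -x) : projP Z x = x := by simp [-lie_skew, projP_apply, hx]

omit h in
lemma projK_of_mem_p {x : 𝔤} (hx : ⁅Z, ⁅Z, x⁆⁆ = -x) : projK Z x = 0 := by simp [-lie_skew, projK_apply, hx]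

lemma orthogonal {x y : 𝔤} (hx : ⁅Z, x⁆ = 0) (hy : ⁅Z, ⁅Z, y⁆⁆ = -y) : Q x y = 0 := by
  have h1 := h.invariant Z x ⁅Z, y⁆
  rw [hx, map_zero, LinearMap.zero_apply, hy, map_neg, neg_neg] at h1
  exact h1.symm

lemma orthogonal' {x y : 𝔤} (hx : ⁅Z, ⁅Z, x⁆⁆ = -x) (hy : ⁅Z, y⁆ = 0) : Q x y = 0 := by
  rw [h.symm, h.orthogonal hy hx]

lemma projK_symm (x y : 𝔤) : Q (projK Z x) y = Q x (projK Z y) := by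
  conv_lhs => rw [← projK_add_projP_apply Z y]
  conv_rhs => rw [← projK_add_projP_apply Z x]
  rw [map_add, map_add, LinearMap.add_apply, h.orthogonal (h.lie_projK _) (h.lie_lie_projP _),
    h.orthogonal' (h.lie_lie_projP _) (h.lie_projK _)]

lemma projP_symm (x y : 𝔤) : Q (projP Z x) y = Q x (projP Z y) := by
  have h1 := h.projK_symm x y
  rw [← add_right_inj (Q (projK Z x) y), ← LinearMap.add_apply, ← map_add,
    projK_add_projP_apply, h1, ← map_add, projK_add_projP_apply]

end

/-- The form `Q(x, θ y)`, where `θ` is the Cartan involution. -/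
def cartanForm (Z : 𝔤) (Q : 𝔤 →ₗ[ℝ] 𝔤 →ₗ[ℝ] ℝ) : 𝔤 →ₗ[ℝ] 𝔤 →ₗ[ℝ] ℝ :=
  Q.compl₂ (projK Z - projP Z)

lemma cartanForm_apply (x y : 𝔤) : cartanForm Z Q x y = Q x (projK Z y) - Q x (projP Z y) := by
  simp [cartanForm]

section

variable (h : IsHermitianPair Z Q)
include h

lemma cartanForm_of_mem_k {x : 𝔤} (hx : ⁅Z, x⁆ = 0) (y : 𝔤) : cartanForm Z Q x y = Q x y := by
  rw [cartanForm_apply, h.orthogonal hx (h.lie_lie_projP y), ← h.projK_symm, projK_of_mem hx,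
    sub_zero]

lemma cartanForm_of_mem_p {x : 𝔤} (hx : ⁅Z, ⁅Z, x⁆⁆ = -x) (y : 𝔤) :
    cartanForm Z Q x y = -Q x y := by
  rw [cartanForm_apply, h.orthogonal' hx (h.lie_projK y), ← h.projP_symm, projP_of_mem hx,
    zero_sub]

lemma isPosDefForm_cartanForm : IsPosDefForm (cartanForm Z Q) where
  symm x y := by
    rw [cartanForm_apply, cartanForm_apply, h.symm, h.projK_symm, h.symm x, h.projP_symm]
  pos x hx := by
    have h1 : cartanForm Z Q x x = Q (projK Z x) (projK Z x) - Q (projP Z x) (projP Z x) := by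
      conv_lhs => rw [← projK_add_projP_apply Z x, map_add, map_add, LinearMap.add_apply,
        LinearMap.add_apply, h.cartanForm_of_mem_k (h.lie_projK x), h.cartanForm_of_mem_p (h.lie_lie_projP x),
        h.cartanForm_of_mem_k (h.lie_projK x), h.cartanForm_of_mem_p (h.lie_lie_projP x),
        h.orthogonal (h.lie_projK _) (h.lie_lie_projP _),
        h.orthogonal' (h.lie_lie_projP _) (h.lie_projK _)]
      ring
    rw [h1]
    have hk := h.pos _ (h.lie_projK x)
    have hp := h.neg _ (h.lie_lie_projP x)
    by_cases hkx : projK Z x = 0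
    · have hpx : projP Z x ≠ 0 := fun hpx ↦ hx (by rw [← projK_add_projP_apply Z x, hkx, hpx, add_zero])
      simpa [hkx] using hp hpx
    · by_cases hpx : projP Z x = 0
      · simpa [hpx] using hk hkx
      · linarith [hk hkx, hp hpx]

lemma cartanForm_ad_of_mem_k {u : 𝔤} (hu : ⁅Z, u⁆ = 0) (x y : 𝔤) :
    cartanForm Z Q ⁅u, x⁆ y = - cartanForm Z Q x ⁅u, y⁆ := by
  have hc (x : 𝔤) : ⁅Z, ⁅u, x⁆⁆ = ⁅u, ⁅Z, x⁆⁆ := by rw [leibniz_lie, hu, zero_lie, zero_add]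
  simp only [cartanForm_apply, projK_apply, projP_apply, h.invariant u, lie_add, lie_neg, hc,
    map_add, map_neg]
  ring

omit [LieAlgebra ℝ 𝔤] h in
lemma lie_of_mem_k_p {u x : 𝔤} (hu : ⁅Z, u⁆ = 0) (hx : ⁅Z, ⁅Z, x⁆⁆ = -x) :
    ⁅Z, ⁅Z, ⁅u, x⁆⁆⁆ = -⁅u, x⁆ := by
  have hc (x : 𝔤) : ⁅Z, ⁅u, x⁆⁆ = ⁅u, ⁅Z, x⁆⁆ := by rw [leibniz_lie, hu, zero_lie, zero_add]
  rw [hc, hc, hx, lie_neg]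

omit [LieAlgebra ℝ 𝔤] h in
lemma lie_of_mem_k_k {u x : 𝔤} (hu : ⁅Z, u⁆ = 0) (hx : ⁅Z, x⁆ = 0) : ⁅Z, ⁅u, x⁆⁆ = 0 := by
  rw [leibniz_lie, hu, hx, zero_lie, lie_zero, add_zero]

lemma projK_lie_of_mem_p {u : 𝔤} (hu : ⁅Z, ⁅Z, u⁆⁆ = -u) (x : 𝔤) :
    projK Z ⁅u, x⁆ = ⁅u, projP Z x⁆ := by
  conv_lhs => rw [← projK_add_projP_apply Z x, lie_add, map_add,
    projK_of_mem (lie_eq_zero_of_cube h.cube hu (h.lie_lie_projP x)), ← lie_skew, map_neg,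
    projK_of_mem_p (lie_of_mem_k_p (h.lie_projK x) hu), neg_zero, zero_add]

lemma projP_lie_of_mem_p {u : 𝔤} (hu : ⁅Z, ⁅Z, u⁆⁆ = -u) (x : 𝔤) :
    projP Z ⁅u, x⁆ = ⁅u, projK Z x⁆ := by
  have h1 := projK_add_projP_apply Z ⁅u, x⁆
  rw [h.projK_lie_of_mem_p hu] at h1
  have h2 := congrArg (fun y ↦ ⁅u, y⁆) (projK_add_projP_apply Z x)
  simp only [lie_add] at h2
  rw [add_comm] at h1
  exact add_right_cancel (h1.trans h2.symm)

lemma cartanForm_ad_of_mem_p {u : 𝔤} (hu : ⁅Z, ⁅Z, u⁆⁆ = -u) (x y : 𝔤) :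
    cartanForm Z Q ⁅u, x⁆ y = cartanForm Z Q x ⁅u, y⁆ := by
  rw [cartanForm_apply, cartanForm_apply, h.invariant, h.invariant, h.projK_lie_of_mem_p hu,
    h.projP_lie_of_mem_p hu]
  ring

/-- The negative of the Killing form has the same properties as `Q`. -/
lemma neg_killingForm [FiniteDimensional ℝ 𝔤] : IsHermitianPair Z (-killingForm ℝ 𝔤) where
  cube := h.cube
  exists_ne := h.exists_ne
  symm x y := by
    simp only [LinearMap.neg_apply]
    rw [LieModule.traceForm_comm]
  invariant x y z := by
    have := LieModule.traceForm_apply_lie_apply' ℝ 𝔤 𝔤 x y z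
    simp only [LinearMap.neg_apply]
    rw [killingForm, this]
  pos x hx h0 := by
    have hb := h.isPosDefForm_cartanForm
    have hne : LieAlgebra.ad ℝ 𝔤 x ≠ 0 := fun h1 ↦ h0 (h.center x fun y ↦ LinearMap.congr_fun h1 y)
    have := hb.trace_pos (A := LieAlgebra.ad ℝ 𝔤 x) (B := - LieAlgebra.ad ℝ 𝔤 x)
      (fun y z ↦ by
        simp [-lie_skew, h.cartanForm_ad_of_mem_k hx]) hne
    rw [LinearMap.neg_comp, map_neg] at this
    exact this
  neg x hx h0 := by
    have hb := h.isPosDefForm_cartanForm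
    have hne : LieAlgebra.ad ℝ 𝔤 x ≠ 0 := fun h1 ↦ h0 (h.center x fun y ↦ LinearMap.congr_fun h1 y)
    have := hb.trace_pos (A := LieAlgebra.ad ℝ 𝔤 x) (B := LieAlgebra.ad ℝ 𝔤 x)
      (fun y z ↦ by simp [h.cartanForm_ad_of_mem_p hx]) hne
    exact neg_neg_of_pos this
  center := h.center
  irreducible := h.irreducible

end
end IsHermitianPair
end HermitianPair

section EquivariantMetric

namespace IsHermitianPair

variable {𝔤 : Type*} [LieRing 𝔤] [LieAlgebra ℝ 𝔤] {Z : 𝔤} {Q : 𝔤 →ₗ[ℝ] 𝔤 →ₗ[ℝ] ℝ}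
  (h : IsHermitianPair Z Q)

open LieAlgebra LinearMap

lemma ad_commute_projK {u : 𝔤} (hu : ⁅Z, u⁆ = 0) : ad ℝ 𝔤 u * projK Z = projK Z * ad ℝ 𝔤 u := by
  have hc (x : 𝔤) : ⁅Z, ⁅u, x⁆⁆ = ⁅u, ⁅Z, x⁆⁆ := by rw [leibniz_lie, hu, zero_lie, zero_add]
  exact LinearMap.ext fun x ↦ by simp [-lie_skew, projK_apply, hc]

lemma ad_commute_projP {u : 𝔤} (hu : ⁅Z, u⁆ = 0) : ad ℝ 𝔤 u * projP Z = projP Z * ad ℝ 𝔤 u := by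
  have hc (x : 𝔤) : ⁅Z, ⁅u, x⁆⁆ = ⁅u, ⁅Z, x⁆⁆ := by rw [leibniz_lie, hu, zero_lie, zero_add]
  exact LinearMap.ext fun x ↦ by simp [-lie_skew, projP_apply, hc]

include h

lemma projK_mul_projK : projK Z * projK Z = projK Z :=
  LinearMap.ext fun x ↦ projK_of_mem (h.lie_projK x)

lemma projP_mul_projP : projP Z * projP Z = projP Z :=
  LinearMap.ext fun x ↦ projP_of_mem (h.lie_lie_projP x)

lemma projK_mul_projP : projK Z * projP Z = 0 :=
  LinearMap.ext fun x ↦ projK_of_mem_p (h.lie_lie_projP x)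

lemma projP_mul_projK : projP Z * projK Z = 0 :=
  LinearMap.ext fun x ↦ projP_of_mem_k (h.lie_projK x)

lemma projK_mul_ad {u : 𝔤} (hu : ⁅Z, ⁅Z, u⁆⁆ = -u) : projK Z * ad ℝ 𝔤 u = ad ℝ 𝔤 u * projP Z :=
  LinearMap.ext fun x ↦ h.projK_lie_of_mem_p hu x

lemma projP_mul_ad {u : 𝔤} (hu : ⁅Z, ⁅Z, u⁆⁆ = -u) : projP Z * ad ℝ 𝔤 u = ad ℝ 𝔤 u * projK Z :=
  LinearMap.ext fun x ↦ h.projP_lie_of_mem_p hu x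

end IsHermitianPair

open LieAlgebra LinearMap IsHermitianPair

variable {𝔤 : Type*} [LieRing 𝔤] [LieAlgebra ℝ 𝔤]

/-- A `𝔨`-equivariant self-adjoint operator `Φ` on `𝔨`, extended by zero to `𝔭`. It defines the
metric which is `Q(Φ ·, ·)` on `𝔨` and `-Q` on `𝔭`. -/
structure IsEquivariantSymm (Z : 𝔤) (Q : 𝔤 →ₗ[ℝ] 𝔤 →ₗ[ℝ] ℝ) (Φ : Module.End ℝ 𝔤) : Prop where
  symm : ∀ x y, Q (Φ x) y = Q x (Φ y)
  map_p : Φ * projP Z = 0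
  p_map : projP Z * Φ = 0
  commute : ∀ u : 𝔤, ⁅Z, u⁆ = 0 → ad ℝ 𝔤 u * Φ = Φ * ad ℝ 𝔤 u

namespace IsEquivariantSymm

variable {Z : 𝔤} {Q : 𝔤 →ₗ[ℝ] 𝔤 →ₗ[ℝ] ℝ} {Φ : Module.End ℝ 𝔤}

/-- The metric defined by `Φ`. -/
def metric (Z : 𝔤) (Q : 𝔤 →ₗ[ℝ] 𝔤 →ₗ[ℝ] ℝ) (Φ : Module.End ℝ 𝔤) : 𝔤 →ₗ[ℝ] 𝔤 →ₗ[ℝ] ℝ :=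
  Q ∘ₗ (Φ - projP Z)

lemma metric_apply (x y : 𝔤) : metric Z Q Φ x y = Q (Φ x) y - Q (projP Z x) y := by
  simp [metric]

/-- The Levi-Civita product of the metric defined by `Φ`. -/
noncomputable def product (Z : 𝔤) (Φ : Module.End ℝ 𝔤) : 𝔤 →ₗ[ℝ] 𝔤 →ₗ[ℝ] 𝔤 :=
  LinearMap.mk₂ ℝ (fun x y ↦ (1 / 2 : ℝ) • (⁅projK Z x, projK Z y⁆ + ⁅projP Z x, projP Z y⁆)
      + ⁅projK Z x + (1 / 2 : ℝ) • Φ x, projP Z y⁆ + (1 / 2 : ℝ) • ⁅Φ y, projP Z x⁆)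
    (fun x x' y ↦ by simp only [map_add, add_lie, lie_add, smul_add]; abel)
    (fun c x y ↦ by
      simp only [map_smul, smul_lie, lie_smul, smul_add, add_lie, smul_comm c (1 / 2 : ℝ)])
    (fun x y y' ↦ by simp only [map_add, add_lie, lie_add, smul_add]; abel)
    (fun c x y ↦ by
      simp only [map_smul, smul_lie, lie_smul, smul_add, add_lie, smul_comm c (1 / 2 : ℝ)])

lemma product_apply (x y : 𝔤) : product Z Φ x y =
    (1 / 2 : ℝ) • (⁅projK Z x, projK Z y⁆ + ⁅projP Z x, projP Z y⁆)
      + ⁅projK Z x + (1 / 2 : ℝ) • Φ x, projP Z y⁆ + (1 / 2 : ℝ) • ⁅Φ y, projP Z x⁆ := rfl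

variable (h : IsHermitianPair Z Q) (hΦ : IsEquivariantSymm Z Q Φ)
include hΦ

lemma map_projP (x : 𝔤) : Φ (projP Z x) = 0 := LinearMap.congr_fun hΦ.map_p x

lemma map_projK (x : 𝔤) : Φ (projK Z x) = Φ x := by
  conv_rhs => rw [← projK_add_projP_apply Z x, map_add, hΦ.map_projP, add_zero]

lemma projK_map (x : 𝔤) : projK Z (Φ x) = Φ x := by
  conv_rhs => rw [← projK_add_projP_apply Z (Φ x),
    show projP Z (Φ x) = 0 from LinearMap.congr_fun hΦ.p_map x, add_zero]

include h

lemma lie_map (x : 𝔤) : ⁅Z, Φ x⁆ = 0 := by rw [← hΦ.projK_map, h.lie_projK]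

omit h in
lemma map_lie {u : 𝔤} (hu : ⁅Z, u⁆ = 0) (x : 𝔤) : Φ ⁅u, x⁆ = ⁅u, Φ x⁆ :=
  (LinearMap.congr_fun (hΦ.commute u hu) x).symm

lemma metric_symm (x y : 𝔤) : metric Z Q Φ x y = metric Z Q Φ y x := by
  rw [metric_apply, metric_apply, hΦ.symm, h.projP_symm, h.symm, h.symm x]

lemma isLeviCivitaProduct : IsLeviCivitaProduct (metric Z Q Φ) (product Z Φ) where
  torsion x y := by
    conv_rhs => rw [← projK_add_projP_apply Z x, ← projK_add_projP_apply Z y]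
    simp only [product_apply, lie_add, add_lie, smul_lie]
    rw [← lie_skew (projK Z y) (projK Z x), ← lie_skew (projP Z y) (projP Z x),
      ← lie_skew (projK Z y) (projP Z x)]
    module
  compat x y z := by
    have key (y z : 𝔤) : metric Z Q Φ (product Z Φ x y) z =
        (1 / 2) * Q ⁅projK Z x, Φ y⁆ (projK Z z) + (1 / 2) * Q ⁅projP Z x, projP Z y⁆ (Φ z)
        - Q ⁅projK Z x + (1 / 2 : ℝ) • Φ x, projP Z y⁆ (projP Z z)
        - (1 / 2) * Q ⁅Φ y, projP Z x⁆ (projP Z z) := by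
      have hk : ⁅Z, projK Z x + (1 / 2 : ℝ) • Φ x⁆ = 0 := by
        rw [lie_add, lie_smul, h.lie_projK, hΦ.lie_map h, smul_zero, add_zero]
      have h1 : ⁅Z, ⁅projK Z x, projK Z y⁆⁆ = 0 := lie_of_mem_k_k (h.lie_projK x) (h.lie_projK y)
      have h2 : ⁅Z, ⁅projP Z x, projP Z y⁆⁆ = 0 :=
        lie_eq_zero_of_cube h.cube (h.lie_lie_projP x) (h.lie_lie_projP y)
      have h3 := lie_of_mem_k_p hk (h.lie_lie_projP y)
      have h4 := lie_of_mem_k_p (hΦ.lie_map h y) (h.lie_lie_projP x)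
      have hp {w : 𝔤} (hw : ⁅Z, ⁅Z, w⁆⁆ = -w) : Φ w = 0 := by
        rw [← projP_of_mem hw, hΦ.map_projP]
      have h5 : Q ⁅projK Z x, Φ y⁆ (projK Z z) = Q ⁅projK Z x, Φ y⁆ z := by
        rw [← h.projK_symm, projK_of_mem (lie_of_mem_k_k (h.lie_projK x) (hΦ.lie_map h y))]
      simp only [metric_apply, product_apply, map_add, map_smul, hp h3, hp h4, projP_of_mem h3,
        projP_of_mem h4, projP_of_mem_k h1, projP_of_mem_k h2, hΦ.map_lie (h.lie_projK x),
        hΦ.map_projK, LinearMap.add_apply, LinearMap.smul_apply, map_zero, LinearMap.zero_apply,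
        smul_eq_mul, h5, hΦ.symm _ z, ← h.projP_symm _ z]
      ring
    rw [metric_symm h hΦ y, key y z, key z y]
    have e1 := h.invariant (projK Z x) (Φ y) (projK Z z)
    have e2 := h.invariant (projK Z x + (1 / 2 : ℝ) • Φ x) (projP Z y) (projP Z z)
    have e3 (y z : 𝔤) : Q ⁅Φ z, projP Z x⁆ (projP Z y) = Q ⁅projP Z x, projP Z y⁆ (Φ z) := by
      rw [← lie_skew, map_neg, LinearMap.neg_apply, h.invariant, neg_neg, h.symm]
    have e5 : Q (Φ y) ⁅projK Z x, projK Z z⁆ = Q ⁅projK Z x, Φ z⁆ (projK Z y) := by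
      rw [hΦ.symm, hΦ.map_lie (h.lie_projK x), hΦ.map_projK, h.symm, ← h.projK_symm,
        projK_of_mem (lie_of_mem_k_k (h.lie_projK x) (hΦ.lie_map h z))]
    rw [h.symm (projP Z y)] at e2
    linear_combination (1 / 2) * e1 - e2 - (1 / 2) * e3 y z - (1 / 2) * e3 z y - (1 / 2) * e5

variable [FiniteDimensional ℝ 𝔤] (hQ : ∀ x y : 𝔤, trace ℝ 𝔤 (ad ℝ 𝔤 x * ad ℝ 𝔤 y) = -Q x y)

omit hΦ in
lemma nondegenerate_of_isHermitianPair (x : 𝔤) (hx : ∀ y, Q x y = 0) : x = 0 :=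
  h.isPosDefForm_cartanForm.eq_zero (by rw [cartanForm_apply, hx, hx, sub_zero])

omit hΦ in
lemma trace_ad (x : 𝔤) : trace ℝ 𝔤 (ad ℝ 𝔤 x) = 0 :=
  trace_eq_zero_of_skew (nondegenerate_of_isHermitianPair h) fun y z ↦ by
    rw [ad_apply, ad_apply, h.invariant, neg_add_cancel]

omit h hΦ [FiniteDimensional ℝ 𝔤] in
lemma flip_product_of_mem_k {y : 𝔤} (hy : ⁅Z, y⁆ = 0) : (product Z Φ).flip y =
    (1 / 2 : ℝ) • (ad ℝ 𝔤 (Φ y) * projP Z - ad ℝ 𝔤 y * projK Z) := by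
  refine LinearMap.ext fun x ↦ ?_
  simp only [LinearMap.flip_apply, product_apply, projK_of_mem hy, projP_of_mem_k hy,
    LinearMap.smul_apply, LinearMap.sub_apply, Module.End.mul_apply, ad_apply, lie_zero, add_zero]
  rw [← lie_skew y]
  module

omit h [FiniteDimensional ℝ 𝔤] in
lemma flip_product_of_mem_p {y : 𝔤} (hy : ⁅Z, ⁅Z, y⁆⁆ = -y) : (product Z Φ).flip y =
    -(ad ℝ 𝔤 y * ((1 / 2 : ℝ) • projP Z + (projK Z + (1 / 2 : ℝ) • Φ))) := by
  refine LinearMap.ext fun x ↦ ?_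
  have h0 : Φ y = 0 := by rw [← projP_of_mem hy, hΦ.map_projP]
  simp only [LinearMap.flip_apply, product_apply, projK_of_mem_p hy, projP_of_mem hy,
    LinearMap.smul_apply, LinearMap.neg_apply, LinearMap.add_apply, Module.End.mul_apply, ad_apply,
    lie_zero, zero_add, h0, zero_lie, smul_zero, add_zero, add_lie, lie_add, smul_lie, lie_smul]
  rw [← lie_skew y, ← lie_skew y, ← lie_skew y]
  module

variable (hnd : ∀ x, (∀ y, metric Z Q Φ x y = 0) → x = 0)
include hnd

lemma ricciForm_mixed {y z : 𝔤} (hy : ⁅Z, y⁆ = 0) (hz : ⁅Z, ⁅Z, z⁆⁆ = -z) :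
    ricciForm (product Z Φ) y z = 0 ∧ ricciForm (product Z Φ) z y = 0 := by
  have key : trace ℝ 𝔤 ((product Z Φ).flip y * (product Z Φ).flip z) = 0 := by
    set B := (product Z Φ).flip y with hB
    set M := (product Z Φ).flip z with hM
    have e1 : B * projK Z = projK Z * B := by
      rw [hB, flip_product_of_mem_k hy, smul_mul_assoc, mul_smul_comm, sub_mul, mul_sub,
        mul_assoc, mul_assoc, h.projP_mul_projK, h.projK_mul_projK, ← mul_assoc, ← mul_assoc,
        ← ad_commute_projK (hΦ.lie_map h y), ← ad_commute_projK hy, mul_assoc, mul_assoc,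
        h.projK_mul_projP, h.projK_mul_projK]
    have e2 : projK Z * M = M * projP Z := by
      have e3 : projP Z * projK Z = 0 := h.projP_mul_projK
      have e4 : projK Z * projP Z = 0 := h.projK_mul_projP
      rw [hM, hΦ.flip_product_of_mem_p hz, mul_neg, neg_mul, ← mul_assoc, h.projK_mul_ad hz,
        mul_assoc, mul_assoc]
      simp only [mul_add, add_mul, mul_smul_comm, smul_mul_assoc, e3, e4, hΦ.map_p, hΦ.p_map]
    have e5 : projP Z * M = M * projK Z := by
      have : (projK Z + projP Z) * M = M * (projK Z + projP Z) := by simp [projK_add_projP]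
      rw [add_mul, mul_add, e2, add_comm] at this
      exact add_right_cancel this
    have e6 : B * projP Z = projP Z * B := by
      have : (projK Z + projP Z) * B = B * (projK Z + projP Z) := by simp [projK_add_projP]
      rw [add_mul, mul_add, e1] at this
      exact (add_left_cancel this).symm
    have f1 : projK Z * (B * M) = B * M * projP Z := by
      rw [← mul_assoc, ← e1, mul_assoc, e2, mul_assoc]
    have f2 : projP Z * (B * M) = B * M * projK Z := by
      rw [← mul_assoc, ← e6, mul_assoc, e5, mul_assoc]
    have g1 : trace ℝ 𝔤 (B * M * projK Z) = 0 := by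
      rw [← h.projK_mul_projK, ← mul_assoc, ← f2, trace_mul_comm, ← mul_assoc, h.projK_mul_projP]
      simp
    have g2 : trace ℝ 𝔤 (B * M * projP Z) = 0 := by
      rw [← h.projP_mul_projP, ← mul_assoc, ← f1, trace_mul_comm, ← mul_assoc, h.projP_mul_projK]
      simp
    rw [← mul_one (B * M), ← projK_add_projP Z, mul_add, map_add, g1, g2, add_zero]
  have hr := ricciForm_eq hnd (hΦ.isLeviCivitaProduct h) (trace_ad h)
  rw [hr, hr, trace_mul_comm ℝ _ ((product Z Φ).flip y), key]
  simp

/-- The Ricci form on `𝔨`. -/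
lemma ricciForm_of_mem_k {y z : 𝔤} (hy : ⁅Z, y⁆ = 0) (hz : ⁅Z, z⁆ = 0) :
    ricciForm (product Z Φ) y z = -(1 / 4) * (trace ℝ 𝔤 (projK Z * ad ℝ 𝔤 y * ad ℝ 𝔤 z)
      + trace ℝ 𝔤 (projP Z * ad ℝ 𝔤 (Φ y) * ad ℝ 𝔤 (Φ z))) := by
  have e1 := ad_commute_projK hz
  have e2 := ad_commute_projP (hΦ.lie_map h z)
  have e3 := ad_commute_projK hy
  have e4 := ad_commute_projP (hΦ.lie_map h y)
  rw [ricciForm_eq hnd (hΦ.isLeviCivitaProduct h) (trace_ad h), flip_product_of_mem_k hy,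
    flip_product_of_mem_k hz, e1, e2, e3, e4]
  simp only [smul_mul_assoc, mul_smul_comm, mul_sub, sub_mul, smul_sub, map_sub, map_smul]
  have s1 (A B : Module.End ℝ 𝔤) (hA : A * projP Z = projP Z * A) :
      trace ℝ 𝔤 (projP Z * A * (projP Z * B)) = trace ℝ 𝔤 (projP Z * A * B) := by
    rw [← hA, mul_assoc, ← mul_assoc (projP Z), h.projP_mul_projP, ← mul_assoc]
  have s2 (A B : Module.End ℝ 𝔤) (hA : A * projK Z = projK Z * A) :
      trace ℝ 𝔤 (projK Z * A * (projK Z * B)) = trace ℝ 𝔤 (projK Z * A * B) := by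
    rw [← hA, mul_assoc, ← mul_assoc (projK Z), h.projK_mul_projK, ← mul_assoc]
  have s3 (A B : Module.End ℝ 𝔤) (hA : A * projP Z = projP Z * A) :
      trace ℝ 𝔤 (projP Z * A * (projK Z * B)) = 0 := by
    rw [← hA, mul_assoc, ← mul_assoc (projP Z), h.projP_mul_projK, zero_mul, mul_zero, map_zero]
  have s4 (A B : Module.End ℝ 𝔤) (hA : A * projK Z = projK Z * A) :
      trace ℝ 𝔤 (projK Z * A * (projP Z * B)) = 0 := by
    rw [← hA, mul_assoc, ← mul_assoc (projK Z), h.projK_mul_projP, zero_mul, mul_zero, map_zero]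
  rw [s1 _ _ e4, s2 _ _ e3, s3 _ _ e4, s4 _ _ e3]
  simp only [smul_eq_mul]
  ring

include hQ in
/-- The Ricci form on `𝔭`. -/
lemma ricciForm_of_mem_p {y z : 𝔤} (hy : ⁅Z, ⁅Z, y⁆⁆ = -y) (hz : ⁅Z, ⁅Z, z⁆⁆ = -z) :
    ricciForm (product Z Φ) y z = (1 / 2) * Q y z
      - (1 / 4) * (trace ℝ 𝔤 (ad ℝ 𝔤 z * ad ℝ 𝔤 y * Φ) + trace ℝ 𝔤 (ad ℝ 𝔤 y * ad ℝ 𝔤 z * Φ)) := by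
  rw [ricciForm_eq hnd (hΦ.isLeviCivitaProduct h) (trace_ad h), hΦ.flip_product_of_mem_p hy,
    hΦ.flip_product_of_mem_p hz, neg_mul_neg]
  have hS1 : projK Z * (projK Z + (1 / 2 : ℝ) • Φ) = projK Z + (1 / 2 : ℝ) • Φ := by
    rw [mul_add, h.projK_mul_projK, mul_smul_comm,
      show projK Z * Φ = Φ from LinearMap.ext fun x ↦ hΦ.projK_map x]
  have hS2 : (projK Z + (1 / 2 : ℝ) • Φ) * projK Z = projK Z + (1 / 2 : ℝ) • Φ := by
    rw [add_mul, h.projK_mul_projK, smul_mul_assoc,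
      show Φ * projK Z = Φ from LinearMap.ext fun x ↦ hΦ.map_projK x]
  have hS3 : trace ℝ 𝔤 (ad ℝ 𝔤 y * ad ℝ 𝔤 z * (projK Z + (1 / 2 : ℝ) • Φ)) +
      trace ℝ 𝔤 (ad ℝ 𝔤 z * ad ℝ 𝔤 y * (projK Z + (1 / 2 : ℝ) • Φ)) = - Q y z +
      (1 / 2) * (trace ℝ 𝔤 (ad ℝ 𝔤 z * ad ℝ 𝔤 y * Φ) + trace ℝ 𝔤 (ad ℝ 𝔤 y * ad ℝ 𝔤 z * Φ)) := by
    have e1 : trace ℝ 𝔤 (ad ℝ 𝔤 z * ad ℝ 𝔤 y * projK Z) =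
        trace ℝ 𝔤 (ad ℝ 𝔤 y * ad ℝ 𝔤 z * projP Z) := by
      rw [mul_assoc, ← h.projP_mul_ad hy, ← mul_assoc, trace_mul_comm, ← mul_assoc]
    have e2 : trace ℝ 𝔤 (ad ℝ 𝔤 y * ad ℝ 𝔤 z * projK Z) +
        trace ℝ 𝔤 (ad ℝ 𝔤 y * ad ℝ 𝔤 z * projP Z) = - Q y z := by
      rw [← map_add, ← mul_add, projK_add_projP, mul_one, hQ]
    rw [← e1] at e2
    simp only [mul_add, map_add, mul_smul_comm, map_smul, smul_eq_mul]
    linear_combination e2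
  generalize projK Z + (1 / 2 : ℝ) • Φ = S at *
  have e1 : trace ℝ 𝔤 (ad ℝ 𝔤 y * projP Z * (ad ℝ 𝔤 z * projP Z)) = 0 := by
    rw [mul_assoc, ← mul_assoc (projP Z), h.projP_mul_ad hz, mul_assoc, h.projK_mul_projP]
    simp
  have e2 : trace ℝ 𝔤 (ad ℝ 𝔤 y * S * (ad ℝ 𝔤 z * S)) = 0 := by
    nth_rewrite 1 [← hS2]
    nth_rewrite 2 [← hS1]
    rw [← mul_assoc (ad ℝ 𝔤 z), ← h.projP_mul_ad hz]
    simp only [mul_assoc]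
    rw [← mul_assoc (projK Z), h.projK_mul_projP]
    simp
  have e3 : ad ℝ 𝔤 y * projP Z * (ad ℝ 𝔤 z * S) = ad ℝ 𝔤 y * ad ℝ 𝔤 z * S := by
    rw [mul_assoc, ← mul_assoc (projP Z), h.projP_mul_ad hz, mul_assoc, hS1, mul_assoc]
  have e4 : trace ℝ 𝔤 (ad ℝ 𝔤 y * S * (ad ℝ 𝔤 z * projP Z)) =
      trace ℝ 𝔤 (ad ℝ 𝔤 z * ad ℝ 𝔤 y * S) := by
    rw [← h.projK_mul_ad hz, mul_assoc, ← mul_assoc S, hS2, ← mul_assoc, trace_mul_comm,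
      ← mul_assoc]
  simp only [mul_add, add_mul, map_add, mul_smul_comm, smul_mul_assoc, map_smul, smul_eq_mul, e1,
    e2, e3, e4, smul_add]
  linear_combination (-1 / 2) * hS3

end IsEquivariantSymm

end EquivariantMetric

section QuasiEinsteinEquation

open LieAlgebra LinearMap IsHermitianPair

namespace IsHermitianPair

variable {𝔤 : Type*} [LieRing 𝔤] [LieAlgebra ℝ 𝔤] {Z : 𝔤} {Q : 𝔤 →ₗ[ℝ] 𝔤 →ₗ[ℝ] ℝ}

/-- The form `-tr_𝔨 (ad x ad y)` on `𝔨`, extended by zero. -/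
noncomputable def isotropyForm (Z : 𝔤) : 𝔤 →ₗ[ℝ] 𝔤 →ₗ[ℝ] ℝ :=
  LinearMap.mk₂ ℝ
    (fun x y ↦ -trace ℝ 𝔤 (projK Z * ad ℝ 𝔤 (projK Z x) * ad ℝ 𝔤 (projK Z y)))
    (fun x x' y ↦ by simp only [map_add, mul_add, add_mul]; ring)
    (fun c x y ↦ by simp only [map_smul, mul_smul_comm, smul_mul_assoc, smul_eq_mul]; ring)
    (fun x y y' ↦ by simp only [map_add, mul_add]; ring)
    (fun c x y ↦ by simp only [map_smul, mul_smul_comm, smul_eq_mul]; ring)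

lemma isotropyForm_apply (x y : 𝔤) : isotropyForm Z x y =
    -trace ℝ 𝔤 (projK Z * ad ℝ 𝔤 (projK Z x) * ad ℝ 𝔤 (projK Z y)) := rfl

/-- The orthogonal projection to the line spanned by `Z`. -/
noncomputable def projZ (Z : 𝔤) (Q : 𝔤 →ₗ[ℝ] 𝔤 →ₗ[ℝ] ℝ) : Module.End ℝ 𝔤 :=
  ((Q Z Z)⁻¹ • Q Z).smulRight Z

lemma projZ_apply (x : 𝔤) : projZ Z Q x = ((Q Z Z)⁻¹ * Q Z x) • Z := rfl

variable (h : IsHermitianPair Z Q)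
include h

lemma Q_Z_pos : 0 < Q Z Z := h.pos Z (lie_self Z) fun h0 ↦ by
  obtain ⟨x, hx⟩ := h.exists_ne
  exact hx (by rw [h0, zero_lie])

lemma isEquivariantSymm_projZ : IsEquivariantSymm Z Q (projZ Z Q) where
  symm x y := by
    simp only [projZ_apply, map_smul, LinearMap.smul_apply, smul_eq_mul, h.symm x Z]
    ring
  map_p := LinearMap.ext fun x ↦ by
    simp [projZ_apply, h.orthogonal (lie_self Z) (h.lie_lie_projP x)]
  p_map := LinearMap.ext fun x ↦ by
    simp [projZ_apply, projP_of_mem_k (lie_self Z)]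
  commute u hu := LinearMap.ext fun x ↦ by
    have h1 : ⁅u, Z⁆ = 0 := by rw [← lie_skew, hu, neg_zero]
    have h2 : Q Z ⁅u, x⁆ = 0 := by rw [← neg_eq_zero, ← h.invariant, h1]; simp
    simp [projZ_apply, h1, h2]

lemma isotropyForm_symm (x y : 𝔤) : isotropyForm Z x y = isotropyForm Z y x := by
  rw [isotropyForm_apply, isotropyForm_apply, ← ad_commute_projK (h.lie_projK x), mul_assoc,
    trace_mul_comm]

variable [FiniteDimensional ℝ 𝔤]

lemma projK_nonneg (x : 𝔤) : 0 ≤ cartanForm Z Q (projK Z x) x := by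
  have hb := h.isPosDefForm_cartanForm
  have h1 : cartanForm Z Q (projK Z x) x = cartanForm Z Q (projK Z x) (projK Z x) := by
    rw [h.cartanForm_of_mem_k (h.lie_projK x), h.cartanForm_of_mem_k (h.lie_projK x),
      ← h.projK_symm, projK_of_mem (h.lie_projK x)]
  rw [h1]
  exact hb.nonneg _

lemma projP_nonneg (x : 𝔤) : 0 ≤ cartanForm Z Q (projP Z x) x := by
  have hb := h.isPosDefForm_cartanForm
  have h1 : cartanForm Z Q (projP Z x) x = cartanForm Z Q (projP Z x) (projP Z x) := by
    rw [h.cartanForm_of_mem_p (h.lie_lie_projP x), h.cartanForm_of_mem_p (h.lie_lie_projP x),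
      ← h.projP_symm, projP_of_mem (h.lie_lie_projP x)]
  rw [h1]
  exact hb.nonneg _

lemma trace_projK_nonpos {u : 𝔤} (hu : ⁅Z, u⁆ = 0) :
    trace ℝ 𝔤 (projK Z * ad ℝ 𝔤 u * ad ℝ 𝔤 u) ≤ 0 := by
  have := h.isPosDefForm_cartanForm.trace_nonneg (A := ad ℝ 𝔤 u) (B := -ad ℝ 𝔤 u)
    (F := projK Z) (fun x y ↦ by simp [-lie_skew, h.cartanForm_ad_of_mem_k hu]) h.projK_nonneg
  rw [LinearMap.neg_comp, map_neg] at this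
  rw [← ad_commute_projK hu, mul_assoc]
  exact neg_nonneg.1 this

lemma trace_projP_nonpos {u : 𝔤} (hu : ⁅Z, u⁆ = 0) :
    trace ℝ 𝔤 (projP Z * ad ℝ 𝔤 u * ad ℝ 𝔤 u) ≤ 0 := by
  have := h.isPosDefForm_cartanForm.trace_nonneg (A := ad ℝ 𝔤 u) (B := -ad ℝ 𝔤 u)
    (F := projP Z) (fun x y ↦ by simp [-lie_skew, h.cartanForm_ad_of_mem_k hu]) h.projP_nonneg
  rw [LinearMap.neg_comp, map_neg] at this
  rw [← ad_commute_projP hu, mul_assoc]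
  exact neg_nonneg.1 this

lemma isotropyForm_nonneg (x : 𝔤) : 0 ≤ isotropyForm Z x x :=
  neg_nonneg.2 (h.trace_projK_nonpos (h.lie_projK x))

variable (hQ : ∀ x y : 𝔤, trace ℝ 𝔤 (ad ℝ 𝔤 x * ad ℝ 𝔤 y) = -Q x y)

omit h [FiniteDimensional ℝ 𝔤] in
include hQ in
lemma trace_projP_eq {x y : 𝔤} (hx : ⁅Z, x⁆ = 0) (hy : ⁅Z, y⁆ = 0) :
    -trace ℝ 𝔤 (projP Z * ad ℝ 𝔤 x * ad ℝ 𝔤 y) = Q x y - isotropyForm Z x y := by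
  rw [isotropyForm_apply, projK_of_mem hx, projK_of_mem hy, ← neg_eq_iff_eq_neg.2 (hQ x y),
    ← one_mul (ad ℝ 𝔤 x * _), ← projK_add_projP Z, add_mul, map_add, mul_assoc, mul_assoc]
  ring

include hQ in
lemma isotropyForm_le (x : 𝔤) : isotropyForm Z x x ≤ cartanForm Z Q x x := by
  have h1 := trace_projP_eq hQ (h.lie_projK x) (h.lie_projK x)
  have h2 := h.trace_projP_nonpos (h.lie_projK x)
  have h3 : isotropyForm Z (projK Z x) (projK Z x) = isotropyForm Z x x := by
    rw [isotropyForm_apply, isotropyForm_apply, projK_of_mem (h.lie_projK x)]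
  have h4 : cartanForm Z Q x x = cartanForm Z Q (projK Z x) x + cartanForm Z Q (projP Z x) x := by
    rw [← LinearMap.add_apply, ← map_add, projK_add_projP_apply]
  have h5 := h.projP_nonneg x
  rw [h.cartanForm_of_mem_k (h.lie_projK x)] at h4
  have h6 : Q (projK Z x) (projK Z x) = Q (projK Z x) x := by
    rw [← h.projK_symm, projK_of_mem (h.lie_projK x)]
  linarith

omit h [FiniteDimensional ℝ 𝔤] in
lemma isotropyForm_invariant {u : 𝔤} (hu : ⁅Z, u⁆ = 0) (x y : 𝔤) :
    isotropyForm Z ⁅u, x⁆ y = -isotropyForm Z x ⁅u, y⁆ := by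
  have e := ad_commute_projK hu
  have e1 (x : 𝔤) : projK Z ⁅u, x⁆ = ⁅u, projK Z x⁆ := (LinearMap.congr_fun e x).symm
  rw [isotropyForm_apply, isotropyForm_apply, e1, e1, LieHom.map_lie, LieHom.map_lie,
    LieRing.of_associative_ring_bracket, LieRing.of_associative_ring_bracket]
  generalize ad ℝ 𝔤 (projK Z x) = A
  generalize ad ℝ 𝔤 (projK Z y) = B
  have e2 : trace ℝ 𝔤 (projK Z * (A * (B * ad ℝ 𝔤 u))) =
      trace ℝ 𝔤 (projK Z * (ad ℝ 𝔤 u * (A * B))) := by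
    rw [← mul_assoc A, ← mul_assoc, trace_mul_comm, ← mul_assoc, e, mul_assoc]
  simp only [mul_sub, sub_mul, map_sub, mul_assoc, e2]
  ring

include hQ in
/-- The `𝔨'`-part of the metric. -/
lemma exists_semisimple_part {t : ℝ} (ht : 1 ≤ t) : ∃ F : Module.End ℝ 𝔤,
    IsEquivariantSymm Z Q F ∧ F Z = 0 ∧
    (∀ x, ⁅Z, x⁆ = 0 → Q Z x = 0 → x ≠ 0 → 0 < Q (F x) x) ∧
    ∀ x y, ⁅Z, x⁆ = 0 → ⁅Z, y⁆ = 0 → -trace ℝ 𝔤 (projK Z * ad ℝ 𝔤 x * ad ℝ 𝔤 y)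
      - trace ℝ 𝔤 (projP Z * ad ℝ 𝔤 (F x) * ad ℝ 𝔤 (F y)) = 4 * t * Q (F x) y := by
  have hb := h.isPosDefForm_cartanForm
  have hE := h.isEquivariantSymm_projZ
  obtain ⟨C, hC⟩ := hb.exists_represent (isotropyForm Z)
  have hCs (x y : 𝔤) : cartanForm Z Q (C x) y = cartanForm Z Q x (C y) := by
    rw [hC, hb.symm x, hC, h.isotropyForm_symm]
  obtain ⟨F, hFs, hFpos, hFcomm, hFeq, hF0⟩ := hb.exists_root_operator hCs
    (fun x ↦ (hC x x).symm ▸ h.isotropyForm_nonneg x)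
    (fun x ↦ (hC x x).symm ▸ h.isotropyForm_le hQ x) ht
  have hCu {u : 𝔤} (hu : ⁅Z, u⁆ = 0) : ad ℝ 𝔤 u ∘ₗ C = C ∘ₗ ad ℝ 𝔤 u := by
    refine LinearMap.ext fun x ↦ hb.ext_left fun y ↦ ?_
    simp only [LinearMap.comp_apply, ad_apply]
    rw [h.cartanForm_ad_of_mem_k hu, hC, hC, isotropyForm_invariant hu]
  have hFu {u : 𝔤} (hu : ⁅Z, u⁆ = 0) (x : 𝔤) : F ⁅u, x⁆ = ⁅u, F x⁆ :=
    (LinearMap.congr_fun (hFcomm _ (hCu hu)) x).symm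
  have hFk {x : 𝔤} (hx : ⁅Z, x⁆ = 0) : ⁅Z, F x⁆ = 0 := by rw [← hFu (lie_self Z), hx, map_zero]
  have hCk {x : 𝔤} (hx : ⁅Z, x⁆ = 0) : ⁅Z, C x⁆ = 0 := by
    rw [show ⁅Z, C x⁆ = C ⁅Z, x⁆ from LinearMap.congr_fun (hCu (lie_self Z)) x, hx, map_zero]
  have hCZ : C Z = 0 := hb.ext_left fun y ↦ by
    have : projK Z * ad ℝ 𝔤 Z = 0 :=
      LinearMap.ext fun x ↦ by simp [-lie_skew, projK_apply, h.cube]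
    rw [hC, isotropyForm_apply, projK_of_mem (lie_self Z), this]
    simp
  have hFZ : F Z = (4 * t) • Z := hF0 Z hCZ
  have hFK (x : 𝔤) : F (projK Z x) = projK Z (F x) := by
    rw [projK_apply, projK_apply, map_add, hFu (lie_self Z), hFu (lie_self Z)]
  have hQF {x : 𝔤} (hx : ⁅Z, x⁆ = 0) (y : 𝔤) : Q (F x) y = Q x (F y) := by
    rw [← h.cartanForm_of_mem_k hx, ← hFs, h.cartanForm_of_mem_k (hFk hx)]
  have hZ0 := h.Q_Z_pos
  have hEF (x : 𝔤) (hx : Q Z x = 0) : Q Z (F x) = 0 := by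
    rw [← hQF (lie_self Z), hFZ]
    simp [hx]
  let F' : Module.End ℝ 𝔤 := F * projK Z - (4 * t) • projZ Z Q
  have hF' (x : 𝔤) : F' x = F (projK Z x) - (4 * t) • projZ Z Q x := rfl
  have hF'w (x : 𝔤) : F' x = F (projK Z x - projZ Z Q x) := by
    rw [hF', map_sub, projZ_apply, map_smul, hFZ, smul_comm]
  have hF'0 {x : 𝔤} (hx : ⁅Z, x⁆ = 0) (hx' : Q Z x = 0) : F' x = F x := by
    rw [hF', projK_of_mem hx, projZ_apply, hx', mul_zero, zero_smul, smul_zero, sub_zero]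
  have hequiv : IsEquivariantSymm Z Q F' :=
    { symm := fun x y ↦ by
        simp only [hF', map_sub, map_smul, LinearMap.sub_apply, LinearMap.smul_apply, hE.symm,
          hQF (h.lie_projK x)]
        rw [h.projK_symm, ← hFK]
      map_p := by
        rw [sub_mul, mul_assoc, h.projK_mul_projP, smul_mul_assoc, hE.map_p, mul_zero, smul_zero,
          sub_zero]
      p_map := by
        rw [mul_sub, mul_smul_comm, hE.p_map, smul_zero, sub_zero]
        exact LinearMap.ext fun x ↦ projP_of_mem_k (hFk (h.lie_projK x))
      commute := fun u hu ↦ by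
        rw [mul_sub, sub_mul, mul_smul_comm, hE.commute u hu, smul_mul_assoc, mul_assoc F,
          ← ad_commute_projK hu, ← mul_assoc, ← mul_assoc]
        congr 2
        exact hFcomm _ (hCu hu) }
  refine ⟨F', hequiv, ?_, fun x hx hx' hx0 ↦ ?_, fun x y hx hy ↦ ?_⟩
  · rw [hF'w, projK_of_mem (lie_self Z), projZ_apply, inv_mul_cancel₀ hZ0.ne', one_smul, sub_self,
      map_zero]
  · rw [hF'0 hx hx', ← h.cartanForm_of_mem_k (hFk hx)]
    exact hFpos x hx0
  · have hk : -trace ℝ 𝔤 (projK Z * ad ℝ 𝔤 x * ad ℝ 𝔤 y) = Q (C x) y := by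
      rw [← h.cartanForm_of_mem_k (hCk hx), hC, isotropyForm_apply, projK_of_mem hx,
        projK_of_mem hy]
    have hF'k (x : 𝔤) : ⁅Z, F' x⁆ = 0 := hequiv.lie_map h x
    have hp := trace_projP_eq hQ (hF'k x) (hF'k y)
    rw [← hC, h.cartanForm_of_mem_k (hCk (hF'k x)), ← hequiv.symm, ← hequiv.symm] at hp
    rw [hk, sub_eq_add_neg, hp]
    set w := x - projZ Z Q x with hw
    have hwk : ⁅Z, w⁆ = 0 := by
      rw [hw, lie_sub, hx, projZ_apply, lie_smul, lie_self, smul_zero, sub_zero]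
    have hwZ : Q Z w = 0 := by
      rw [hw, map_sub, projZ_apply, map_smul, smul_eq_mul]
      field_simp
      ring
    have e1 : F' x = F w := by rw [hF'w, projK_of_mem hx]
    have e2 : C x = C w := by rw [hw, map_sub, projZ_apply, map_smul, hCZ, smul_zero, sub_zero]
    have e3 : Q Z (C (F w)) = 0 := by
      rw [h.symm, ← h.cartanForm_of_mem_k (hCk (hFk hwk)), hCs, hCZ, map_zero]
    have e4 : F (C (F w)) = C (F (F w)) := (LinearMap.congr_fun (hFcomm C rfl) (F w)).symm
    rw [e1, e2, hF'0 (hFk hwk) (hEF w hwZ), hF'0 (hCk (hFk hwk)) e3, e4]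
    have := congrArg (fun v ↦ Q v y) (hFeq w)
    simp only [map_add, map_sub, map_smul, LinearMap.add_apply, LinearMap.sub_apply,
      LinearMap.smul_apply, smul_eq_mul] at this
    linarith

/-- An equivariant operator defines a form on `𝔭` which is a multiple of `Q`. -/
lemma exists_casimir_scalar {Φ : Module.End ℝ 𝔤} (hΦ : IsEquivariantSymm Z Q Φ) :
    ∃ a : ℝ, ∀ y z, ⁅Z, ⁅Z, y⁆⁆ = -y → ⁅Z, ⁅Z, z⁆⁆ = -z →
      trace ℝ 𝔤 (ad ℝ 𝔤 z * ad ℝ 𝔤 y * Φ) + trace ℝ 𝔤 (ad ℝ 𝔤 y * ad ℝ 𝔤 z * Φ)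
        = -(2 * a) * Q y z := by
  have hb := h.isPosDefForm_cartanForm
  let τ : 𝔤 →ₗ[ℝ] 𝔤 →ₗ[ℝ] ℝ := LinearMap.mk₂ ℝ
    (fun y z ↦ trace ℝ 𝔤 (ad ℝ 𝔤 z * ad ℝ 𝔤 y * Φ))
    (fun x x' y ↦ by simp only [map_add, mul_add, add_mul])
    (fun c x y ↦ by simp only [map_smul, mul_smul_comm, smul_mul_assoc])
    (fun x y y' ↦ by simp only [map_add, add_mul])
    (fun c x y ↦ by simp only [map_smul, smul_mul_assoc])
  have hτ (y z) : τ y z = trace ℝ 𝔤 (ad ℝ 𝔤 z * ad ℝ 𝔤 y * Φ) := rfl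
  obtain ⟨T, hT⟩ := hb.exists_represent τ
  have hinv {u : 𝔤} (hu : ⁅Z, u⁆ = 0) (x y : 𝔤) : τ ⁅u, x⁆ y = -τ x ⁅u, y⁆ := by
    rw [hτ, hτ, LieHom.map_lie, LieHom.map_lie, LieRing.of_associative_ring_bracket,
      LieRing.of_associative_ring_bracket]
    generalize ad ℝ 𝔤 x = A
    generalize ad ℝ 𝔤 y = B
    have e2 : trace ℝ 𝔤 (B * (A * (ad ℝ 𝔤 u * Φ))) = trace ℝ 𝔤 (ad ℝ 𝔤 u * (B * (A * Φ))) := by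
      rw [hΦ.commute u hu, trace_mul_comm ℝ (ad ℝ 𝔤 u), ← mul_assoc A, ← mul_assoc B]
    simp only [mul_sub, sub_mul, map_sub, mul_assoc, e2]
    ring
  obtain ⟨a, b, hab⟩ := h.irreducible T fun u hu x ↦ hb.ext_left fun y ↦ by
    rw [hT, hinv hu, h.cartanForm_ad_of_mem_k hu, hT]
  refine ⟨a, fun y z hy hz ↦ ?_⟩
  have e1 : ⁅Z, ⁅Z, ⁅Z, y⁆⁆⁆ = -⁅Z, y⁆ := h.cube y
  have e2 : ⁅Z, ⁅Z, ⁅Z, z⁆⁆⁆ = -⁅Z, z⁆ := h.cube z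
  rw [← hτ, ← hτ, ← hT, ← hT, hab y hy, hab z hz]
  simp only [map_add, map_smul, LinearMap.add_apply, LinearMap.smul_apply, smul_eq_mul,
    h.cartanForm_of_mem_p hy, h.cartanForm_of_mem_p hz, h.cartanForm_of_mem_p e1,
    h.cartanForm_of_mem_p e2, h.invariant, h.symm z y]
  rw [h.symm z, h.invariant]
  ring

lemma casimir_scalar_nonneg {F : Module.End ℝ 𝔤} (hF : IsEquivariantSymm Z Q F)
    (hF0 : ∀ x, 0 ≤ Q (F x) x) {y : 𝔤} (hy : ⁅Z, ⁅Z, y⁆⁆ = -y) :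
    0 ≤ trace ℝ 𝔤 (ad ℝ 𝔤 y * ad ℝ 𝔤 y * F) := by
  have := h.isPosDefForm_cartanForm.trace_nonneg (A := ad ℝ 𝔤 y) (B := ad ℝ 𝔤 y)
    (F := F) (fun x z ↦ by simp [-lie_skew, h.cartanForm_ad_of_mem_p hy])
    (fun x ↦ (h.cartanForm_of_mem_k (hF.lie_map h x) x).symm ▸ hF0 x)
  rw [mul_assoc, trace_mul_comm, mul_assoc]
  exact this

lemma trace_projZ {y : 𝔤} (hy : ⁅Z, ⁅Z, y⁆⁆ = -y) :
    trace ℝ 𝔤 (ad ℝ 𝔤 y * ad ℝ 𝔤 y * projZ Z Q) = -((Q Z Z)⁻¹ * Q y y) := by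
  have h1 : ad ℝ 𝔤 y * ad ℝ 𝔤 y * projZ Z Q =
      ((Q Z Z)⁻¹ • Q Z).smulRight ⁅y, ⁅y, Z⁆⁆ := LinearMap.ext fun x ↦ by
    simp [-lie_skew, projZ_apply, -map_smul, -lie_lie]
  have h2 : Q Z ⁅y, ⁅y, Z⁆⁆ = -Q y y := by
    rw [← neg_inj, ← h.invariant, ← lie_skew y Z]
    simp only [map_neg, LinearMap.neg_apply, neg_neg, h.invariant, hy]
  rw [h1, LinearMap.trace_smulRight]
  simp [h2]

include hQ in
/-- The quasi-Einstein metric with constant `t`. -/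
lemma exists_isQuasiEinsteinData {m t : ℝ} (hm : 0 < m) (ht : 1 ≤ t) :
    ∃ (b : 𝔤 →ₗ[ℝ] 𝔤 →ₗ[ℝ] ℝ) (v : 𝔤), IsQuasiEinsteinData m b v t ∧
      (∀ y, ⁅Z, ⁅Z, y⁆⁆ = -y → ∀ z, b y z = -Q y z) ∧
      ∀ y, ⁅Z, ⁅Z, y⁆⁆ = -y → b v y = 0 := by
  obtain ⟨F, hF, hFZ, hFpos, hFeq⟩ := h.exists_semisimple_part hQ ht
  have hE := h.isEquivariantSymm_projZ
  have hq := h.Q_Z_pos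
  set q := Q Z Z with hqdef
  have hQZF (x : 𝔤) : Q Z (F x) = 0 := by rw [← hF.symm, hFZ, map_zero, LinearMap.zero_apply]
  have hQZP {x : 𝔤} (hx : ⁅Z, ⁅Z, x⁆⁆ = -x) : Q Z x = 0 := h.orthogonal (lie_self Z) hx
  have hFnonneg (x : 𝔤) : 0 ≤ Q (F x) x := by
    set w := projK Z x - projZ Z Q x with hw
    have hwk : ⁅Z, w⁆ = 0 := by
      rw [hw, lie_sub, h.lie_projK, projZ_apply, lie_smul, lie_self, smul_zero, sub_zero]
    have hwZ : Q Z w = 0 := by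
      rw [hw, map_sub, projZ_apply, map_smul, smul_eq_mul, ← h.projK_symm,
        projK_of_mem (lie_self Z), ← hqdef]
      field_simp
      ring
    have hFw : F x = F w := by
      rw [hw, map_sub, projZ_apply, map_smul, hFZ, smul_zero, sub_zero, hF.map_projK]
    have : Q (F x) x = Q (F w) w := by rw [hFw, hF.symm, hFw, ← hF.symm]
    rw [this]
    rcases eq_or_ne w 0 with h0 | h0
    · simp [h0]
    · exact (hFpos w hwk hwZ h0).le
  obtain ⟨x₁, hx₁⟩ := h.exists_ne
  set y₀ := ⁅Z, x₁⁆
  have hy₀ : ⁅Z, ⁅Z, y₀⁆⁆ = -y₀ := h.cube x₁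
  have hQ₀ : Q y₀ y₀ < 0 := h.neg y₀ hy₀ hx₁
  obtain ⟨a, ha⟩ := h.exists_casimir_scalar hF
  obtain ⟨e, he⟩ := h.exists_casimir_scalar hE
  have ha0 : 0 ≤ a := by
    have h1 := ha y₀ y₀ hy₀ hy₀
    have h2 := h.casimir_scalar_nonneg hF hFnonneg hy₀
    nlinarith
  have heq : e = q⁻¹ := by
    have h1 := he y₀ y₀ hy₀ hy₀
    rw [h.trace_projZ hy₀] at h1
    exact mul_right_cancel₀ hQ₀.ne (by linarith)
  obtain ⟨x₀, hx₀neg, hx₀⟩ : ∃ x₀ : ℝ, x₀ < 0 ∧ a + x₀ * q⁻¹ = -(1 + 2 * t) :=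
    ⟨-(1 + 2 * t + a) * q, mul_neg_of_neg_of_pos (by linarith) hq, by field_simp; ring⟩
  let Φ : Module.End ℝ 𝔤 := F + x₀ • projZ Z Q
  have hΦapp (x : 𝔤) : Φ x = F x + (x₀ * (q⁻¹ * Q Z x)) • Z := by
    simp [Φ, projZ_apply, smul_smul, hqdef]
  have hΦ : IsEquivariantSymm Z Q Φ :=
    { symm := fun x y ↦ by
        simp only [hΦapp, map_add, map_smul, LinearMap.add_apply, LinearMap.smul_apply, hF.symm,
          smul_eq_mul, h.symm x Z]
        ring
      map_p := by rw [add_mul, hF.map_p, smul_mul_assoc, hE.map_p, smul_zero, add_zero]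
      p_map := by rw [mul_add, hF.p_map, mul_smul_comm, hE.p_map, smul_zero, add_zero]
      commute := fun u hu ↦ by
        rw [mul_add, add_mul, mul_smul_comm, smul_mul_assoc, hE.commute u hu, hF.commute u hu] }
  have hb (x y : 𝔤) : IsEquivariantSymm.metric Z Q Φ x y =
      Q (F x) y + x₀ * (q⁻¹ * Q Z x) * Q Z y - Q (projP Z x) y := by
    simp [IsEquivariantSymm.metric_apply, hΦapp]
  have hpQ (x : 𝔤) : Q (projP Z x) x = Q (projP Z x) (projP Z x) := by
    rw [← h.projP_symm, projP_of_mem (h.lie_lie_projP x)]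
  have hbZ (y : 𝔤) : IsEquivariantSymm.metric Z Q Φ Z y = x₀ * Q Z y := by
    rw [hb, hFZ, projP_of_mem_k (lie_self Z), ← hqdef]
    field_simp
    simp
  have hbpos (w : 𝔤) (hw : Q Z w = 0) (hw0 : w ≠ 0) : 0 < IsEquivariantSymm.metric Z Q Φ w w := by
    have h1 : Q (F w) w = Q (F (projK Z w)) (projK Z w) := by
      rw [hF.map_projK, hF.symm, hF.symm, hF.map_projK]
    rw [hb, hw, mul_zero, add_zero, hpQ, h1]
    have hwZ : Q Z (projK Z w) = 0 := by rw [← h.projK_symm, projK_of_mem (lie_self Z), hw]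
    have hk := hFpos _ (h.lie_projK w) hwZ
    have hp := h.neg _ (h.lie_lie_projP w)
    by_cases hkx : projK Z w = 0
    · have hpx : projP Z w ≠ 0 := fun hpx ↦
        hw0 (by rw [← projK_add_projP_apply Z w, hkx, hpx, add_zero])
      simpa [hkx] using hp hpx
    · by_cases hpx : projP Z w = 0
      · simpa [hpx] using hk hkx
      · linarith [hk hkx, hp hpx]
  have hbp {y : 𝔤} (hy : ⁅Z, ⁅Z, y⁆⁆ = -y) (z : 𝔤) :
      IsEquivariantSymm.metric Z Q Φ y z = -Q y z := by
    have h0 : Φ y = 0 := by rw [← projP_of_mem hy, hΦ.map_projP]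
    rw [IsEquivariantSymm.metric_apply, h0, projP_of_mem hy]
    simp
  have hsymm := hΦ.metric_symm h
  have hnd (x : 𝔤) (hx : ∀ y, IsEquivariantSymm.metric Z Q Φ x y = 0) : x = 0 := by
    by_contra h0
    have h1 := hx Z
    rw [hsymm, hbZ] at h1
    exact (hbpos x ((mul_eq_zero.1 h1).resolve_left hx₀neg.ne) h0).ne' (hx x)
  have hbk {y z : 𝔤} (hy : ⁅Z, y⁆ = 0) (hz : ⁅Z, ⁅Z, z⁆⁆ = -z) :
      IsEquivariantSymm.metric Z Q Φ y z = 0 := by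
    rw [hsymm, hbp hz, h.orthogonal' hz hy, neg_zero]
  obtain ⟨ξ, hξpos, hξ⟩ : ∃ ξ : ℝ, 0 < ξ ∧ 1 / m * ξ ^ 2 * x₀ ^ 2 = (x₀ ^ 2 / 4 - t * x₀) * q⁻¹ := by
    have h1 : 0 < m * (1 / 4 - t / x₀) * q⁻¹ := by
      have : t / x₀ < 0 := div_neg_of_pos_of_neg (by linarith) hx₀neg
      have : 0 < 1 / 4 - t / x₀ := by linarith
      positivity
    refine ⟨√(m * (1 / 4 - t / x₀) * q⁻¹), Real.sqrt_pos.2 h1, ?_⟩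
    rw [Real.sq_sqrt h1.le]
    have := hx₀neg.ne
    field_simp
  have hbv (y : 𝔤) : IsEquivariantSymm.metric Z Q Φ (ξ • Z) y = ξ * (x₀ * Q Z y) := by
    rw [map_smul, LinearMap.smul_apply, hbZ, smul_eq_mul]
  have hLC := hΦ.isLeviCivitaProduct h
  have hric := ricciForm_eq hnd hLC (IsEquivariantSymm.trace_ad h)
  have hpp {y z : 𝔤} (hy : ⁅Z, ⁅Z, y⁆⁆ = -y) (hz : ⁅Z, ⁅Z, z⁆⁆ = -z) :
      ricciForm (IsEquivariantSymm.product Z Φ) y z =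
        t * IsEquivariantSymm.metric Z Q Φ y z := by
    rw [hΦ.ricciForm_of_mem_p h hQ hnd hy hz, hbp hy]
    have h1 := ha y z hy hz
    have h2 := he y z hy hz
    simp only [Φ, mul_add, map_add, mul_smul_comm, map_smul, smul_eq_mul]
    rw [heq] at h2
    linear_combination (-1 / 4) * h1 - (x₀ / 4) * h2 + (1 / 2) * Q y z * hx₀
  have hkk {y z : 𝔤} (hy : ⁅Z, y⁆ = 0) (hz : ⁅Z, z⁆ = 0) :
      ricciForm (IsEquivariantSymm.product Z Φ) y z =
        t * IsEquivariantSymm.metric Z Q Φ y z + 1 / m * ((ξ * (x₀ * Q Z y)) * (ξ * (x₀ * Q Z z))) := by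
    have e1 := hFeq y z hy hz
    have e2 (u : 𝔤) : trace ℝ 𝔤 (projP Z * ad ℝ 𝔤 Z * ad ℝ 𝔤 u) = -Q Z u := by
      have : projP Z * ad ℝ 𝔤 Z = ad ℝ 𝔤 Z :=
        LinearMap.ext fun x ↦ by simp [-lie_skew, projP_apply, h.cube]
      rw [this, hQ]
    have e3 (u : 𝔤) (hu : ⁅Z, u⁆ = 0) : trace ℝ 𝔤 (projP Z * ad ℝ 𝔤 u * ad ℝ 𝔤 Z) = -Q Z u := by
      rw [← e2, ← ad_commute_projP hu, ← ad_commute_projP (lie_self Z), mul_assoc, trace_mul_comm,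
        mul_assoc, mul_assoc, trace_mul_comm, mul_assoc, ad_commute_projP hu]
    rw [hΦ.ricciForm_of_mem_k h hnd hy hz, hb, projP_of_mem_k hy, hΦapp, hΦapp]
    simp only [map_add, map_smul, mul_add, add_mul, mul_smul_comm, smul_mul_assoc, smul_eq_mul,
      e2, e3 _ (hF.lie_map h _), hQZF, map_zero, LinearMap.zero_apply, ← hqdef]
    have e4 : q * q⁻¹ = 1 := mul_inv_cancel₀ hq.ne'
    linear_combination (1 / 4) * e1 - (Q Z y * Q Z z) * hξ + x₀ ^ 2 / 4 * q⁻¹ * Q Z y * Q Z z * e4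
  have hfinal (y z : 𝔤) : ricciForm (IsEquivariantSymm.product Z Φ) y z
      - 1 / m * (IsEquivariantSymm.metric Z Q Φ (ξ • Z) y * IsEquivariantSymm.metric Z Q Φ (ξ • Z) z)
      = t * IsEquivariantSymm.metric Z Q Φ y z := by
    have hadd1 (y y' z : 𝔤) : ricciForm (IsEquivariantSymm.product Z Φ) (y + y') z =
        ricciForm (IsEquivariantSymm.product Z Φ) y z +
        ricciForm (IsEquivariantSymm.product Z Φ) y' z := by
      rw [hric, hric, hric, map_add, add_mul, map_add, neg_add]
    have hadd2 (y z z' : 𝔤) : ricciForm (IsEquivariantSymm.product Z Φ) y (z + z') =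
        ricciForm (IsEquivariantSymm.product Z Φ) y z +
        ricciForm (IsEquivariantSymm.product Z Φ) y z' := by
      rw [hric, hric, hric, map_add, mul_add, map_add, neg_add]
    rw [← projK_add_projP_apply Z y, ← projK_add_projP_apply Z z]
    have hy1 := h.lie_projK y
    have hy2 := h.lie_lie_projP y
    have hz1 := h.lie_projK z
    have hz2 := h.lie_lie_projP z
    generalize projK Z y = y1 at *
    generalize projP Z y = y2 at *
    generalize projK Z z = z1 at *
    generalize projP Z z = z2 at *
    simp only [hadd1, hadd2, hpp hy2 hz2, hkk hy1 hz1,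
      (hΦ.ricciForm_mixed h hnd hy1 hz2).1, (hΦ.ricciForm_mixed h hnd hz1 hy2).2, hbv, map_add,
      LinearMap.add_apply, hbk hy1 hz2, hsymm y2 z1, hbk hz1 hy2, hQZP hy2, hQZP hz2]
    ring
  refine ⟨IsEquivariantSymm.metric Z Q Φ, ξ • Z,
    ⟨hsymm, hnd, ⟨Z, ?_, fun w hw ↦ ?_⟩, ?_, fun y z ↦ ?_, _, hLC, hfinal, fun c' ↦ ?_⟩,
    fun y hy z ↦ hbp hy z, fun y hy ↦ ?_⟩
  · rw [hbZ]
    exact mul_neg_of_neg_of_pos hx₀neg hq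
  · rw [hbZ] at hw
    exact hbpos w ((mul_eq_zero.1 hw).resolve_left hx₀neg.ne)
  · refine smul_ne_zero hξpos.ne' fun h0 ↦ ?_
    rw [h0] at hqdef
    simp [hqdef] at hq
  · have hc (x : 𝔤) : F ⁅Z, x⁆ = ⁅Z, F x⁆ := hF.map_lie (lie_self Z) x
    have e1 : Q Z ⁅Z, y⁆ = 0 := hQZP (h.cube y)
    have e2 : Q Z ⁅Z, z⁆ = 0 := hQZP (h.cube z)
    have e3 : Q ⁅Z, y⁆ z = -Q (projP Z y) ⁅Z, z⁆ := by
      rw [← h.invariant, h.lie_projP]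
    have e4 : projP Z ⁅Z, y⁆ = ⁅Z, y⁆ := projP_of_mem (h.cube y)
    simp only [smul_lie, map_smul, LinearMap.smul_apply, hb, hc, e1, e2, e4, h.invariant Z (F y),
      e3, smul_eq_mul]
    ring
  · by_contra! hcon
    have e1 := hpp hy₀ hy₀
    rw [hcon, hbp hy₀] at e1
    have e2 : c' = t := mul_right_cancel₀ (neg_ne_zero.2 hQ₀.ne) e1
    have e3 := hkk (lie_self Z) (lie_self Z)
    rw [hcon, e2, ← hqdef] at e3
    have : 0 < 1 / m * ((ξ * (x₀ * q)) * (ξ * (x₀ * q))) := by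
      have : ξ * (x₀ * q) ≠ 0 := mul_ne_zero hξpos.ne' (mul_ne_zero hx₀neg.ne hq.ne')
      exact mul_pos (by positivity) (mul_self_pos.2 this)
    linarith
  · rw [hbv, hQZP hy, mul_zero, mul_zero]

end IsHermitianPair

variable {𝔤 : Type*} [LieRing 𝔤] [LieAlgebra ℝ 𝔤] [FiniteDimensional ℝ 𝔤]

theorem IsHermitianPair.admitsQuasiEinsteinData {Z : 𝔤} {Q : 𝔤 →ₗ[ℝ] 𝔤 →ₗ[ℝ] ℝ}
    (h : IsHermitianPair Z Q) {m : ℝ} (hm : 0 < m) : AdmitsQuasiEinsteinData 𝔤 m := by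
  have h' := h.neg_killingForm
  have hQ (x y : 𝔤) : trace ℝ 𝔤 (ad ℝ 𝔤 x * ad ℝ 𝔤 y) = -(-killingForm ℝ 𝔤) x y := by
    rw [LinearMap.neg_apply, LinearMap.neg_apply, neg_neg]
    rfl
  choose b v hb hp hv using fun n : ℕ ↦
    h'.exists_isQuasiEinsteinData hQ (t := n + 1) hm (by linarith [(n.cast_nonneg : (0 : ℝ) ≤ n)])
  refine ⟨b, fun i j hij c hc ↦ hij ?_, fun i ↦ ⟨v i, _, hb i⟩⟩
  obtain ⟨x, hx⟩ := h'.exists_ne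
  have hy : ⁅Z, ⁅Z, ⁅Z, x⁆⁆⁆ = -⁅Z, x⁆ := h'.cube x
  have hQ0 := (h'.neg _ hy hx).ne
  have h1 := LinearMap.congr_fun₂ hc ⁅Z, x⁆ ⁅Z, x⁆
  rw [LinearMap.smul_apply, LinearMap.smul_apply, hp j _ hy, hp i _ hy, smul_eq_mul] at h1
  have hc1 : c = 1 := mul_right_cancel₀ (neg_ne_zero.2 hQ0) (by linarith)
  rw [hc1, one_smul] at hc
  obtain ⟨N, hN, hNi, -⟩ := (hb i).exists_product
  obtain ⟨N', hN', hNj, -⟩ := (hb j).exists_product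
  rw [hc] at hN'
  obtain rfl := hN.unique (hb i).symm (hb i).nondegenerate hN'
  have e1 := hNi ⁅Z, x⁆ ⁅Z, x⁆
  have e2 := hNj ⁅Z, x⁆ ⁅Z, x⁆
  rw [hv j _ hy, hc] at e2
  rw [hv i _ hy] at e1
  have e3 : (i : ℝ) + 1 = j + 1 := by
    refine mul_right_cancel₀ (b := b i ⁅Z, x⁆ ⁅Z, x⁆) ?_ (by linarith)
    rw [hp i _ hy]
    exact neg_ne_zero.2 hQ0
  exact_mod_cast add_right_cancel e3

end QuasiEinsteinEquation

noncomputable section MaurerCartan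

variable {E : Type*} [NormedAddCommGroup E] [NormedSpace ℝ E]
  {H : Type*} [TopologicalSpace H] (I : ModelWithCorners ℝ E H)
  {G : Type*} [TopologicalSpace G] [ChartedSpace H G] [Group G]

/-- The left Maurer–Cartan form. -/
def maurerCartan (x : G) : TangentSpace I x →L[ℝ] GroupLieAlgebra I G :=
  (mfderiv I I (fun y ↦ x⁻¹ * y) x : TangentSpace I x →L[ℝ] E)

/-- The coefficient function of a vector field in the left-invariant trivialization. -/
def leftCoeff (Y : Π x : G, TangentSpace I x) (x : G) : E := maurerCartan I x (Y x)

variable {I}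

variable [LieGroup I ∞ G]

omit [LieGroup I ∞ G] in
theorem maurerCartan_mulInvariantVectorField [LieGroup I 1 G] (v : GroupLieAlgebra I G) (x : G) :
    maurerCartan I x (mulInvariantVectorField v x) = v := by
  have h : (fun y : G ↦ x⁻¹ * y) ∘ (fun y : G ↦ x * y) = id := by ext; simp
  have h1 := mfderiv_comp_apply (I' := I) (1 : G) (g := fun y : G ↦ x⁻¹ * y)
    (f := fun y : G ↦ x * y)
    ((contMDiff_mul_left (n := 1) (I := I)).contMDiffAt.mdifferentiableAt one_ne_zero)
    ((contMDiff_mul_left (n := 1) (I := I)).contMDiffAt.mdifferentiableAt one_ne_zero) v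
  rw [h] at h1
  have hx : x * 1 = x := mul_one x
  simp only [mfderiv_id] at h1
  rw [hx] at h1
  exact h1.symm

omit [LieGroup I ∞ G] in
theorem mulInvariantVectorField_maurerCartan [LieGroup I 1 G] (x : G) (w : TangentSpace I x) :
    mulInvariantVectorField (maurerCartan I x w) x = w := by
  have h : (fun y : G ↦ x * y) ∘ (fun y : G ↦ x⁻¹ * y) = id := by ext; simp
  have h1 := mfderiv_comp_apply (I' := I) x (g := fun y : G ↦ x * y)
    (f := fun y : G ↦ x⁻¹ * y)
    ((contMDiff_mul_left (n := 1) (I := I)).contMDiffAt.mdifferentiableAt one_ne_zero)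
    ((contMDiff_mul_left (n := 1) (I := I)).contMDiffAt.mdifferentiableAt one_ne_zero) w
  rw [h] at h1
  have hx : x⁻¹ * x = 1 := inv_mul_cancel x
  simp only [mfderiv_id] at h1
  rw [hx] at h1
  exact h1.symm

theorem contMDiff_mulInvariantVectorField_infty (v : GroupLieAlgebra I G) :
    ContMDiff I I.tangent ∞
      (fun g : G ↦ (⟨g, mulInvariantVectorField v g⟩ : TangentBundle I G)) := by
  let fg : G → TangentBundle I G := fun g ↦ TotalSpace.mk' E g 0
  have sfg : ContMDiff I I.tangent ∞ fg := contMDiff_zeroSection _ _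
  let fv : G → TangentBundle I G := fun _ ↦ TotalSpace.mk' E 1 v
  have sfv : ContMDiff I I.tangent ∞ fv := contMDiff_const
  let F₁ : G → (TangentBundle I G × TangentBundle I G) := fun g ↦ (fg g, fv g)
  have S₁ : ContMDiff I (I.tangent.prod I.tangent) ∞ F₁ := sfg.prodMk sfv
  let F₂ : (TangentBundle I G × TangentBundle I G) → TangentBundle (I.prod I) (G × G) :=
    (equivTangentBundleProd I G I G).symm
  have S₂ : ContMDiff (I.tangent.prod I.tangent) (I.prod I).tangent ∞ F₂ :=
    contMDiff_equivTangentBundleProd_symm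
  let F₃ : TangentBundle (I.prod I) (G × G) → TangentBundle I G :=
    tangentMap (I.prod I) I (fun (p : G × G) ↦ p.1 * p.2)
  have S₃ : ContMDiff (I.prod I).tangent I.tangent ∞ F₃ := by
    apply ContMDiff.contMDiff_tangentMap (n := ∞) _ (m := ∞) le_rfl
    exact contMDiff_mul I ∞
  let S := (S₃.comp S₂).comp S₁
  convert! S with g
  · simp [F₁, F₂, F₃, fg, fv]
  · simp only [Function.comp_apply, tangentMap, F₃, F₂, F₁, fg, fv]
    rw [mfderiv_prod_eq_add_apply ((contMDiff_mul I ∞).mdifferentiableAt (by simp))]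
    exact ((congrArg (· + _) (map_zero (mfderiv I I (fun z : G ↦ z * 1) g))).trans
      (zero_add _)).symm

/-- The Maurer–Cartan form as a map from the tangent bundle to itself is smooth. -/
theorem contMDiff_maurerCartan_tangentBundle :
    ContMDiff I.tangent I.tangent ∞
      (fun p : TangentBundle I G ↦ (⟨1, maurerCartan I p.1 p.2⟩ : TangentBundle I G)) := by
  let fg : TangentBundle I G → TangentBundle I G := fun p ↦ TotalSpace.mk' E p.1⁻¹ 0
  have sfg : ContMDiff I.tangent I.tangent ∞ fg :=
    (contMDiff_zeroSection ℝ (TangentSpace I : G → Type _)).comp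
      ((contMDiff_inv I ∞).comp (contMDiff_proj _))
  let F₁ : TangentBundle I G → (TangentBundle I G × TangentBundle I G) := fun g ↦ (fg g, g)
  have S₁ : ContMDiff I.tangent (I.tangent.prod I.tangent) ∞ F₁ := sfg.prodMk contMDiff_id
  let F₂ : (TangentBundle I G × TangentBundle I G) → TangentBundle (I.prod I) (G × G) :=
    (equivTangentBundleProd I G I G).symm
  have S₂ : ContMDiff (I.tangent.prod I.tangent) (I.prod I).tangent ∞ F₂ :=
    contMDiff_equivTangentBundleProd_symm
  let F₃ : TangentBundle (I.prod I) (G × G) → TangentBundle I G :=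
    tangentMap (I.prod I) I (fun (p : G × G) ↦ p.1 * p.2)
  have S₃ : ContMDiff (I.prod I).tangent I.tangent ∞ F₃ := by
    apply ContMDiff.contMDiff_tangentMap (n := ∞) _ (m := ∞) le_rfl
    exact contMDiff_mul I ∞
  let S := (S₃.comp S₂).comp S₁
  convert! S with p
  · simp [F₁, F₂, F₃, fg]
  · simp only [Function.comp_apply, tangentMap, F₃, F₂, F₁, fg]
    rw [mfderiv_prod_eq_add_apply ((contMDiff_mul I ∞).mdifferentiableAt (by simp))]
    exact ((congrArg (· + _) (map_zero (mfderiv I I (fun z : G ↦ z * p.1) p.1⁻¹))).trans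
      (zero_add _)).symm


/-- The Maurer–Cartan form as a map from the tangent bundle to the model space. -/
def maurerCartanMap (p : TangentBundle I G) : E := maurerCartan I p.1 p.2

theorem contMDiff_maurerCartan :
    ContMDiff I.tangent 𝓘(ℝ, E) ∞ (maurerCartanMap : TangentBundle I G → E) := by
  intro p
  have h := (contMDiff_maurerCartan_tangentBundle (I := I) (G := G) p)
  rw [contMDiffAt_totalSpace] at h
  refine h.2.congr_of_eventuallyEq (Filter.Eventually.of_forall fun q ↦ ?_)
  exact ((tangentBundleCore I G).coordChange_self (achart H 1) 1 (mem_achart_source H 1) _).symm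

variable {Y : Π x : G, TangentSpace I x}

theorem contMDiff_leftCoeff (hY : IsSmoothVectorField Y) :
    ContMDiff I 𝓘(ℝ, E) ∞ (leftCoeff I Y) :=
  contMDiff_maurerCartan.comp hY

theorem mdifferentiableAt_leftCoeff {x : G}
    (hY : MDifferentiableAt I I.tangent (fun y ↦ (⟨y, Y y⟩ : TangentBundle I G)) x) :
    MDifferentiableAt I 𝓘(ℝ, E) (leftCoeff I Y) x :=
  MDifferentiableAt.comp x (contMDiff_maurerCartan.mdifferentiableAt (by simp)) hY

omit [Group G] [LieGroup I ∞ G] in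
theorem ContMDiffAt.bilin_apply (b : E →L[ℝ] E →L[ℝ] ℝ) {f g : G → E} {x : G}
    (hf : ContMDiffAt I 𝓘(ℝ, E) ∞ f x) (hg : ContMDiffAt I 𝓘(ℝ, E) ∞ g x) :
    ContMDiffAt I 𝓘(ℝ, ℝ) ∞ (fun y ↦ b (f y) (g y)) x :=
  ((contMDiffAt_const (c := b)).clm_apply hf).clm_apply hg

variable [FiniteDimensional ℝ E]

instance (x : G) : FiniteDimensional ℝ (TangentSpace I x) := inferInstanceAs (FiniteDimensional ℝ E)

instance (x : G) : T2Space (TangentSpace I x) := inferInstanceAs (T2Space E)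

/-- The left-invariant field of bilinear forms with value `b` at the identity. -/
def leftInvariantForm (b : GroupLieAlgebra I G →ₗ[ℝ] GroupLieAlgebra I G →ₗ[ℝ] ℝ) (x : G) :
    TangentSpace I x →L[ℝ] TangentSpace I x →L[ℝ] ℝ :=
  (b.compl₁₂ (maurerCartan I x).toLinearMap (maurerCartan I x).toLinearMap).toContinuousBilinearMap

omit [LieGroup I ∞ G] in
theorem leftInvariantForm_apply (b : GroupLieAlgebra I G →ₗ[ℝ] GroupLieAlgebra I G →ₗ[ℝ] ℝ) (x : G)
    (v w : TangentSpace I x) :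
    leftInvariantForm b x v w = b (maurerCartan I x v) (maurerCartan I x w) := rfl

theorem contMDiff_leftInvariantForm
    (b : GroupLieAlgebra I G →ₗ[ℝ] GroupLieAlgebra I G →ₗ[ℝ] ℝ) :
    ContMDiff I (I.prod 𝓘(ℝ, E →L[ℝ] E →L[ℝ] ℝ)) ∞
      (fun x : G ↦ TotalSpace.mk' (E →L[ℝ] E →L[ℝ] ℝ)
        (E := fun x : G ↦ TangentSpace I x →L[ℝ] TangentSpace I x →L[ℝ] ℝ)
        x (leftInvariantForm b x)) := by
  intro x₀
  rw [contMDiffAt_hom_bundle]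
  refine ⟨contMDiffAt_id, ?_⟩
  simp only
  let e := Module.finBasis ℝ E
  let b' : E →L[ℝ] E →L[ℝ] ℝ := LinearMap.toContinuousBilinearMap (E := E) (F := E) b
  let T := trivializationAt E (TangentSpace I : G → Type _) x₀
  have hx₀ : x₀ ∈ T.baseSet := mem_baseSet_trivializationAt E _ x₀
  have hF i : ContMDiffAt I 𝓘(ℝ, E) ∞ (leftCoeff I (T.localFrame e i)) x₀ := by
    exact ContMDiffAt.comp x₀ contMDiff_maurerCartan.contMDiffAt
      (contMDiffAt_localFrame_of_mem (I := I) (n := ∞) T e i hx₀)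
  let C (i j : Fin (Module.finrank ℝ E)) : E →L[ℝ] E →L[ℝ] ℝ :=
    LinearMap.toContinuousBilinearMap ((LinearMap.mul ℝ ℝ).compl₁₂ (e.coord i) (e.coord j))
  have key : ContMDiffAt I 𝓘(ℝ, E →L[ℝ] E →L[ℝ] ℝ) ∞
      (fun x ↦ ∑ i, ∑ j, (b' (leftCoeff I (T.localFrame e i) x)
        (leftCoeff I (T.localFrame e j) x)) • C i j) x₀ := by
    refine contMDiffAt_finsetSum fun i _ ↦ contMDiffAt_finsetSum fun j _ ↦ ?_
    exact (ContMDiffAt.bilin_apply b' (hF i) (hF j)).smul contMDiffAt_const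
  refine key.congr_of_eventuallyEq ?_
  filter_upwards [T.open_baseSet.mem_nhds hx₀] with x hx
  ext v w
  have hfr i : T.localFrame e i x = T.symm x (e i) := by
    rw [T.localFrame_apply_of_mem_baseSet e hx]
    simp [Trivialization.basisAt]
  have hs (v : E) : (maurerCartan I x (T.symm x v)) =
      ∑ i, e.repr v i • maurerCartan I x (T.localFrame e i x) := by
    conv_lhs => rw [← e.sum_repr v]
    simp only [hfr]
    rw [← T.symmL_apply (R := ℝ) hx]
    rw [map_sum, map_sum]
    refine Finset.sum_congr rfl fun i _ ↦ ?_
    rw [map_smul, map_smul, T.symmL_apply (R := ℝ) hx]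
  rw [inCoordinates_apply_eq₂ hx hx (Set.mem_univ _)]
  have hr : (∑ i, ∑ j, (b' (leftCoeff I (T.localFrame e i) x)
        (leftCoeff I (T.localFrame e j) x)) • C i j) v w = ∑ i, ∑ j,
        b (maurerCartan I x (T.localFrame e i x)) (maurerCartan I x (T.localFrame e j x)) *
          (e.repr v i * e.repr w j) := by
    simp only [sum_apply, smul_apply]
    rfl
  simp only [Trivial.fiberBundle_trivializationAt', Trivial.linearMapAt_trivialization,
    LinearMap.id_coe, id_eq]
  rw [hr, leftInvariantForm_apply, hs, hs]
  simp only [map_sum, map_smul, LinearMap.sum_apply, LinearMap.smul_apply, smul_eq_mul,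
    Finset.mul_sum]
  rw [Finset.sum_comm]
  exact Finset.sum_congr rfl fun i _ ↦ Finset.sum_congr rfl fun j _ ↦ by ring

end MaurerCartan

noncomputable section LeftInvariantConnection

variable {E : Type*} [NormedAddCommGroup E] [NormedSpace ℝ E]
  {H : Type*} [TopologicalSpace H] {I : ModelWithCorners ℝ E H}
  {G : Type*} [TopologicalSpace G] [ChartedSpace H G] [Group G]

variable (I) in
/-- Left translation of the Lie algebra to the tangent space at `x`. -/
def leftTranslation (x : G) : GroupLieAlgebra I G →L[ℝ] TangentSpace I x :=
  (mfderiv I I (fun y ↦ x * y) 1 : E →L[ℝ] E)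

theorem leftTranslation_apply (x : G) (v : GroupLieAlgebra I G) :
    leftTranslation I x v = mulInvariantVectorField v x := rfl

theorem leftCoeff_add (X Y : Π x : G, TangentSpace I x) :
    leftCoeff I (X + Y) = leftCoeff I X + leftCoeff I Y :=
  funext fun x ↦ map_add (maurerCartan I x) _ _

theorem leftCoeff_smul (f : G → ℝ) (Y : Π x : G, TangentSpace I x) :
    leftCoeff I (f • Y) = f • leftCoeff I Y :=
  funext fun x ↦ map_smul (maurerCartan I x) _ _

variable (I) in
/-- The derivative of a function with values in the Lie algebra. -/
def algDeriv (h : G → E) (x : G) : TangentSpace I x →L[ℝ] GroupLieAlgebra I G :=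
  (mvfderiv I h x : TangentSpace I x →L[ℝ] E)

theorem algDeriv_add {f g : G → E} {x : G} (hf : MDifferentiableAt I 𝓘(ℝ, E) f x)
    (hg : MDifferentiableAt I 𝓘(ℝ, E) g x) :
    algDeriv I (f + g) x = algDeriv I f x + algDeriv I g x :=
  mvfderiv_add hf hg

theorem algDeriv_smul {f : G → ℝ} {g : G → E} {x : G} (hf : MDifferentiableAt I 𝓘(ℝ, ℝ) f x)
    (hg : MDifferentiableAt I 𝓘(ℝ, E) g x) (v : TangentSpace I x) :
    algDeriv I (f • g) x v =
      f x • algDeriv I g x v + mvfderiv I f x v • (show GroupLieAlgebra I G from g x) :=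
  congrArg (fun φ : TangentSpace I x →L[ℝ] E ↦ φ v) (mvfderiv_smul hf hg)

theorem algDeriv_const (c : E) (x : G) : algDeriv I (fun _ : G ↦ c) x = 0 :=
  mvfderiv_const c

variable [LieGroup I ∞ G]

theorem maurerCartan_leftTranslation (x : G) (v : GroupLieAlgebra I G) :
    maurerCartan I x (leftTranslation I x v) = v :=
  have : LieGroup I 1 G := LieGroup.of_le (n := ∞) (by simp)
  maurerCartan_mulInvariantVectorField v x

theorem leftTranslation_maurerCartan (x : G) (v : TangentSpace I x) :
    leftTranslation I x (maurerCartan I x v) = v :=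
  have : LieGroup I 1 G := LieGroup.of_le (n := ∞) (by simp)
  mulInvariantVectorField_maurerCartan x v

theorem maurerCartan_injective (x : G) : Function.Injective (maurerCartan I x) :=
  Function.LeftInverse.injective (leftTranslation_maurerCartan x)

theorem leftCoeff_mulInvariantVectorField (v : GroupLieAlgebra I G) :
    leftCoeff I (mulInvariantVectorField v : Π x : G, TangentSpace I x) = fun _ ↦ (v : E) :=
  funext fun x ↦ maurerCartan_leftTranslation x v

theorem algDeriv_leftCoeff_mulInvariantVectorField (v : GroupLieAlgebra I G) (x : G) :
    algDeriv I (leftCoeff I (mulInvariantVectorField v : Π x : G, TangentSpace I x)) x = 0 :=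
  (congrArg (fun h : G → E ↦ algDeriv I h x) (leftCoeff_mulInvariantVectorField v)).trans
    (algDeriv_const (I := I) (show E from v) x)

theorem isSmoothVectorField_mulInvariantVectorField (v : GroupLieAlgebra I G) :
    IsSmoothVectorField (mulInvariantVectorField v : Π x : G, TangentSpace I x) :=
  contMDiff_mulInvariantVectorField_infty v

variable [FiniteDimensional ℝ E]

/-- The left-invariant connection determined by a bilinear product on the Lie algebra. -/
def leftInvariantConnectionFun
    (N : GroupLieAlgebra I G →ₗ[ℝ] GroupLieAlgebra I G →ₗ[ℝ] GroupLieAlgebra I G)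
    (Y : Π x : G, TangentSpace I x) (x : G) : TangentSpace I x →L[ℝ] TangentSpace I x :=
  (leftTranslation I x).comp (algDeriv I (leftCoeff I Y) x +
    LinearMap.toContinuousLinearMap
      (N.flip (maurerCartan I x (Y x)) ∘ₗ (maurerCartan I x).toLinearMap))

variable (N : GroupLieAlgebra I G →ₗ[ℝ] GroupLieAlgebra I G →ₗ[ℝ] GroupLieAlgebra I G)

theorem maurerCartan_leftInvariantConnectionFun (Y : Π x : G, TangentSpace I x) (x : G)
    (v : TangentSpace I x) :
    maurerCartan I x (leftInvariantConnectionFun N Y x v) =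
      algDeriv I (leftCoeff I Y) x v + N (maurerCartan I x v) (maurerCartan I x (Y x)) :=
  maurerCartan_leftTranslation x _

/-- The left-invariant connection determined by a bilinear product on the Lie algebra. -/
def leftInvariantConnection : CovariantDerivative I E (TangentSpace I : G → Type _) where
  toFun := leftInvariantConnectionFun N
  isCovariantDerivativeOnUniv :=
    { add := fun {X Y x} hX hY _ ↦ by
        ext v
        apply maurerCartan_injective
        rw [maurerCartan_leftInvariantConnectionFun, leftCoeff_add,
          algDeriv_add (mdifferentiableAt_leftCoeff hX) (mdifferentiableAt_leftCoeff hY)]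
        simp only [Pi.add_apply, add_apply, map_add, maurerCartan_leftInvariantConnectionFun]
        abel
      leibniz := fun {X f x} hX hf _ ↦ by
        ext v
        apply maurerCartan_injective
        rw [maurerCartan_leftInvariantConnectionFun, leftCoeff_smul,
          algDeriv_smul hf (mdifferentiableAt_leftCoeff hX)]
        simp only [Pi.smul_apply', add_apply, smul_apply, map_add, map_smul,
          ContinuousLinearMap.smulRight_apply, maurerCartan_leftInvariantConnectionFun, smul_add]
        exact add_right_comm _ _ _ }

theorem maurerCartan_leftInvariantConnection (Y : Π x : G, TangentSpace I x) (x : G)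
    (v : TangentSpace I x) :
    maurerCartan I x (leftInvariantConnection N Y x v) =
      algDeriv I (leftCoeff I Y) x v + N (maurerCartan I x v) (maurerCartan I x (Y x)) :=
  maurerCartan_leftTranslation x _

theorem leftInvariantConnection_mulInvariantVectorField (v w : GroupLieAlgebra I G) (x : G) :
    leftInvariantConnection N (mulInvariantVectorField w) x (mulInvariantVectorField v x) =
      mulInvariantVectorField (N v w) x := by
  apply maurerCartan_injective
  rw [maurerCartan_leftInvariantConnection, algDeriv_leftCoeff_mulInvariantVectorField]
  simp only [← leftTranslation_apply, maurerCartan_leftTranslation]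
  simp

omit [Group G] [LieGroup I ∞ G] [FiniteDimensional ℝ E] in
theorem IsSmoothVectorField.mdifferentiableAt [IsManifold I 1 G] {X : Π x : G, TangentSpace I x}
    (hX : IsSmoothVectorField X) (x : G) :
    MDifferentiableAt I I.tangent (fun y ↦ (⟨y, X y⟩ : TangentBundle I G)) x :=
  (hX x).mdifferentiableAt (by simp)

variable [LieGroup I (minSmoothness ℝ 3) G] [CompleteSpace E] {N}

/-- The bracket of vector fields in the left-invariant trivialization, for a torsion-free product. -/
theorem leftInvariantConnection_torsion_free (hN : ∀ x y : GroupLieAlgebra I G, N x y - N y x = ⁅x, y⁆)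
    {X Y : Π x : G, TangentSpace I x} {x : G}
    (hX : MDifferentiableAt I I.tangent (fun y ↦ (⟨y, X y⟩ : TangentBundle I G)) x)
    (hY : MDifferentiableAt I I.tangent (fun y ↦ (⟨y, Y y⟩ : TangentBundle I G)) x) :
    leftInvariantConnection N Y x (X x) - leftInvariantConnection N X x (Y x) =
      VectorField.mlieBracket I X Y x := by
  have : IsManifold I 2 G := IsManifold.of_le (n := ∞) (by exact WithTop.coe_le_coe.2 le_top)
  have h0 := (leftInvariantConnection N).torsion_apply hX hY
  set v := maurerCartan I x (X x) with hv
  set w := maurerCartan I x (Y x) with hw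
  have h1 := (leftInvariantConnection N).torsion_apply
    ((isSmoothVectorField_mulInvariantVectorField v).mdifferentiableAt x)
    ((isSmoothVectorField_mulInvariantVectorField w).mdifferentiableAt x)
  rw [leftInvariantConnection_mulInvariantVectorField,
    leftInvariantConnection_mulInvariantVectorField, ← mulInvariantVector_mlieBracket,
    ← GroupLieAlgebra.bracket_def, ← hN] at h1
  simp only [← leftTranslation_apply, map_sub, hv, hw, leftTranslation_maurerCartan, sub_self] at h1
  rw [h1] at h0
  exact (sub_eq_zero.mp h0.symm)

end LeftInvariantConnection

noncomputable section Commutator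

variable {E : Type*} [NormedAddCommGroup E] [NormedSpace ℝ E]
  {H : Type*} [TopologicalSpace H] {I : ModelWithCorners ℝ E H}
  {G : Type*} [TopologicalSpace G] [ChartedSpace H G]

theorem mvfderiv_clm_comp {F F' : Type*} [NormedAddCommGroup F] [NormedSpace ℝ F]
    [NormedAddCommGroup F'] [NormedSpace ℝ F'] (l : F →L[ℝ] F') {f : G → F} {x : G}
    (hf : MDifferentiableAt I 𝓘(ℝ, F) f x) (v : TangentSpace I x) :
    mvfderiv I (fun y ↦ l (f y)) x v = l (mvfderiv I f x v) := by
  have h := mfderiv_comp_apply (I' := 𝓘(ℝ, F)) (I'' := 𝓘(ℝ, F')) (g := l) x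
    l.differentiableAt.mdifferentiableAt hf v
  rw [mfderiv_eq_fderiv, l.fderiv] at h
  exact h

theorem ContMDiff.mvfderiv_apply [IsManifold I ∞ G] {F : Type*} [NormedAddCommGroup F] [NormedSpace ℝ F]
    {f : G → F} (hf : ContMDiff I 𝓘(ℝ, F) ∞ f) {V : Π x : G, TangentSpace I x}
    (hV : IsSmoothVectorField V) :
    ContMDiff I 𝓘(ℝ, F) ∞ (fun y ↦ mvfderiv I f y (V y)) := by
  have h := (hf.contMDiff_tangentMap (m := ∞) (n := ∞) le_rfl).comp hV
  intro x
  have h1 := h x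
  rw [contMDiffAt_totalSpace] at h1
  refine h1.2.congr_of_eventuallyEq (Filter.Eventually.of_forall fun y ↦ ?_)
  exact (congrArg Prod.snd (trivializationAt_model_space_apply
    (tangentMap I 𝓘(ℝ, F) f ⟨y, V y⟩) (f x))).symm

variable [Group G]
variable [LieGroup I ∞ G] [LieGroup I (minSmoothness ℝ 3) G] [CompleteSpace E]

/-- The commutator of derivations given by vector fields on a Lie group. -/
theorem mvfderiv_commutator [Nontrivial E] {f : G → ℝ} (hf : ContMDiff I 𝓘(ℝ, ℝ) ∞ f)
    {U V : Π x : G, TangentSpace I x} (hU : IsSmoothVectorField U) (hV : IsSmoothVectorField V)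
    (x : G) :
    mvfderiv I (fun y ↦ mvfderiv I f y (V y)) x (U x)
      - mvfderiv I (fun y ↦ mvfderiv I f y (U y)) x (V x) =
      mvfderiv I f x (VectorField.mlieBracket I U V x) := by
  have : IsManifold I (minSmoothness ℝ 3) G := inferInstance
  obtain ⟨w, hw⟩ := exists_ne (0 : E)
  let w' : GroupLieAlgebra I G := w
  set W : Π x : G, TangentSpace I x := mulInvariantVectorField w'
  have hW : IsSmoothVectorField W := isSmoothVectorField_mulInvariantVectorField w'
  have hWx : W x ≠ 0 := by
    intro h
    have h1 := maurerCartan_leftTranslation (I := I) x w'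
    rw [leftTranslation_apply, show mulInvariantVectorField w' x = 0 from h, map_zero] at h1
    exact hw h1.symm
  have hmd (X : Π x : G, TangentSpace I x) (hX : IsSmoothVectorField X) (y : G) := 
    IsSmoothVectorField.mdifferentiableAt (I := I) hX y
  have hbr {X Y : Π x : G, TangentSpace I x} (hX : IsSmoothVectorField X)
      (hY : IsSmoothVectorField Y) : ContMDiff I I.tangent 1
        (fun y ↦ (⟨y, VectorField.mlieBracket I X Y y⟩ : TangentBundle I G)) := by
    intro y
    have : IsManifold I (((2 : ℕ∞) : ℕ∞ω) + 1) G := IsManifold.of_le (n := ∞) (WithTop.coe_le_coe.2 le_top)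
    refine ContMDiffAt.mlieBracket_vectorField (n := 2) (m := 1)
      ((hX y).of_le (WithTop.coe_le_coe.2 le_top)) ((hY y).of_le (WithTop.coe_le_coe.2 le_top)) ?_
    rw [minSmoothness_of_isRCLikeNormedField]
    norm_cast
  have hsm {g : G → ℝ} (hg : ContMDiff I 𝓘(ℝ, ℝ) ∞ g) {X : Π x : G, TangentSpace I x}
      (hX : IsSmoothVectorField X) : IsSmoothVectorField (g • X) := hg.smul_section hX
  have hle : minSmoothness ℝ 2 ≤ ∞ := by
    rw [minSmoothness_of_isRCLikeNormedField]
    exact WithTop.coe_le_coe.2 le_top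
  have h1 : (1 : ℕ∞ω) ≤ ∞ := WithTop.coe_le_coe.2 le_top
  have hJ := VectorField.leibniz_identity_mlieBracket_apply (I := I) (U := U) (V := V)
    (W := f • W) (x := x) ((hU x).of_le hle) ((hV x).of_le hle) ((hsm hf hW x).of_le hle)
  have hJ' := VectorField.leibniz_identity_mlieBracket_apply (I := I) (U := U) (V := V)
    (W := W) (x := x) ((hU x).of_le hle) ((hV x).of_le hle) ((hW x).of_le hle)
  have hfd (y : G) : MDifferentiableAt I 𝓘(ℝ, ℝ) f y := (hf y).mdifferentiableAt (by simp)
  have e1 (X : Π x : G, TangentSpace I x) : VectorField.mlieBracket I X (f • W) =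
      (fun y ↦ mvfderiv I f y (X y)) • W + f • VectorField.mlieBracket I X W := by
    ext y
    exact VectorField.mlieBracket_smul_right (hfd y) (hmd W hW y)
  have e2 {X Y : Π x : G, TangentSpace I x} (hX : IsSmoothVectorField X)
      (hY : IsSmoothVectorField Y) : VectorField.mlieBracket I Y (VectorField.mlieBracket I X (f • W)) x =
      mvfderiv I (fun y ↦ mvfderiv I f y (X y)) x (Y x) • W x
       + mvfderiv I f x (X x) • VectorField.mlieBracket I Y W x
       + (mvfderiv I f x (Y x) • VectorField.mlieBracket I X W x
        + f x • VectorField.mlieBracket I Y (VectorField.mlieBracket I X W) x) := by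
    have hd := hf.mvfderiv_apply hX
    rw [e1, VectorField.mlieBracket_add_right (hmd _ (hsm hd hW) x) (((hf.of_le h1).smul_section (hbr hX hW)).mdifferentiable one_ne_zero x),
      VectorField.mlieBracket_smul_right ((hd x).mdifferentiableAt (by simp)) (hmd W hW x),
      VectorField.mlieBracket_smul_right (hfd x) ((hbr hX hW).mdifferentiable one_ne_zero x)]
  rw [e2 hV hU, e2 hU hV, e1, hJ'] at hJ
  simp only [Pi.add_apply, Pi.smul_apply'] at hJ
  have h3 : (mvfderiv I (fun y ↦ mvfderiv I f y (V y)) x (U x)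
      - mvfderiv I (fun y ↦ mvfderiv I f y (U y)) x (V x) -
      mvfderiv I f x (VectorField.mlieBracket I U V x)) • W x = 0 := by
    linear_combination (norm := module) hJ
  exact sub_eq_zero.1 ((smul_eq_zero.1 h3).resolve_right hWx)

end Commutator

noncomputable section LeftInvariantMetric

variable {E : Type*} [NormedAddCommGroup E] [NormedSpace ℝ E]
  {H : Type*} [TopologicalSpace H] {I : ModelWithCorners ℝ E H}
  {G : Type*} [TopologicalSpace G] [ChartedSpace H G]

theorem mvfderiv_bilin {F F' : Type*} [NormedAddCommGroup F] [NormedSpace ℝ F]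
    [NormedAddCommGroup F'] [NormedSpace ℝ F'] (b : F →L[ℝ] F →L[ℝ] F') {f g : G → F} {x : G}
    (hf : MDifferentiableAt I 𝓘(ℝ, F) f x) (hg : MDifferentiableAt I 𝓘(ℝ, F) g x)
    (v : TangentSpace I x) :
    mvfderiv I (fun y ↦ b (f y) (g y)) x v =
      b (mvfderiv I f x v) (g x) + b (f x) (mvfderiv I g x v) := by
  have hP := hf.prodMk_space hg
  have hb := b.isBoundedBilinearMap.hasFDerivAt (f x, g x)
  have h := mfderiv_comp_apply (I' := 𝓘(ℝ, F × F)) (I'' := 𝓘(ℝ, F')) 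
    (g := fun p : F × F ↦ b p.1 p.2)
    (f := fun y ↦ (f y, g y)) x hb.differentiableAt.mdifferentiableAt hP v
  have h1 : (mvfderiv I (fun y ↦ (f y, g y)) x v).1 = mvfderiv I f x v :=
    (mvfderiv_clm_comp (ContinuousLinearMap.fst ℝ F F) hP v).symm
  have h2 : (mvfderiv I (fun y ↦ (f y, g y)) x v).2 = mvfderiv I g x v :=
    (mvfderiv_clm_comp (ContinuousLinearMap.snd ℝ F F) hP v).symm
  rw [mfderiv_eq_fderiv, hb.fderiv] at h
  rw [← h1, ← h2, add_comm]
  exact h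

theorem MDifferentiableAt.bilin_apply {F F' : Type*} [NormedAddCommGroup F] [NormedSpace ℝ F]
    [NormedAddCommGroup F'] [NormedSpace ℝ F'] (b : F →L[ℝ] F →L[ℝ] F') {f g : G → F} {x : G}
    (hf : MDifferentiableAt I 𝓘(ℝ, F) f x) (hg : MDifferentiableAt I 𝓘(ℝ, F) g x) :
    MDifferentiableAt I 𝓘(ℝ, F') (fun y ↦ b (f y) (g y)) x :=
  (mdifferentiableAt_const.clm_apply hf).clm_apply hg

variable [Group G] [LieGroup I ∞ G] [FiniteDimensional ℝ E]

/-- The left-invariant metric with value `b` at the identity. -/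
def leftInvariantMetric (b : GroupLieAlgebra I G →ₗ[ℝ] GroupLieAlgebra I G →ₗ[ℝ] ℝ)
    (hs : ∀ v w, b v w = b w v) (hn : ∀ v, (∀ w, b v w = 0) → v = 0) :
    PseudoRiemannianMetric I G where
  val := leftInvariantForm b
  symm x v w := hs _ _
  nondegenerate x v hv := maurerCartan_injective x <| by
    rw [map_zero]
    refine hn _ fun w ↦ ?_
    have := hv (leftTranslation I x w)
    rwa [leftInvariantForm_apply, maurerCartan_leftTranslation] at this
  contMDiff := contMDiff_leftInvariantForm b

variable {b : GroupLieAlgebra I G →ₗ[ℝ] GroupLieAlgebra I G →ₗ[ℝ] ℝ}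
    {hs : ∀ v w, b v w = b w v} {hn : ∀ v, (∀ w, b v w = 0) → v = 0}

theorem leftInvariantMetric_val (x : G) (v w : TangentSpace I x) :
    (leftInvariantMetric b hs hn).val x v w = b (maurerCartan I x v) (maurerCartan I x w) := rfl

theorem isLeftInvariantMetric_leftInvariantMetric :
    IsLeftInvariantMetric (leftInvariantMetric b hs hn) := by
  have key (a x : G) (v : TangentSpace I x) :
      maurerCartan I (a * x) (mfderiv I I (fun y ↦ a * y) x v) = maurerCartan I x v := by
    have h : (fun y : G ↦ (a * x)⁻¹ * y) ∘ (fun y : G ↦ a * y) = fun y ↦ x⁻¹ * y := by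
      ext; simp [mul_assoc]
    have h1 := mfderiv_comp_apply (I' := I) x (g := fun y : G ↦ (a * x)⁻¹ * y)
      (f := fun y : G ↦ a * y)
      ((contMDiff_mul_left (n := ∞) (I := I)).contMDiffAt.mdifferentiableAt (by simp))
      ((contMDiff_mul_left (n := ∞) (I := I)).contMDiffAt.mdifferentiableAt (by simp)) v
    rw [h] at h1
    exact h1.symm
  intro a x v w
  rw [leftInvariantMetric_val, leftInvariantMetric_val, key, key]

theorem isLorentzian_leftInvariantMetric
    (hb : ∃ x, b x x < 0 ∧ ∀ w, b x w = 0 → w ≠ 0 → 0 < b w w) :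
    (leftInvariantMetric b hs hn).IsLorentzian := by
  obtain ⟨v, hv, hv'⟩ := hb
  intro x
  refine ⟨leftTranslation I x v, ?_, fun w hw hw0 ↦ ?_⟩
  · rwa [leftInvariantMetric_val, maurerCartan_leftTranslation]
  · rw [leftInvariantMetric_val, maurerCartan_leftTranslation] at hw
    exact hv' _ hw fun h ↦ hw0 (maurerCartan_injective x (h.trans (map_zero _).symm))

theorem dirDeriv_leftInvariantMetric {X Y Z : Π x : G, TangentSpace I x}
    (hY : IsSmoothVectorField Y) (hZ : IsSmoothVectorField Z) (x : G) :
    dirDeriv X (fun y ↦ (leftInvariantMetric b hs hn).val y (Y y) (Z y)) x =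
      b (algDeriv I (leftCoeff I Y) x (X x)) (maurerCartan I x (Z x)) +
        b (maurerCartan I x (Y x)) (algDeriv I (leftCoeff I Z) x (X x)) :=
  mvfderiv_bilin (LinearMap.toContinuousBilinearMap (E := E) (F := E) b)
    (mdifferentiableAt_leftCoeff (hY.mdifferentiableAt x))
    (mdifferentiableAt_leftCoeff (hZ.mdifferentiableAt x)) (X x)

variable [LieGroup I (minSmoothness ℝ 3) G] [CompleteSpace E]
  {N : GroupLieAlgebra I G →ₗ[ℝ] GroupLieAlgebra I G →ₗ[ℝ] GroupLieAlgebra I G}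

theorem isLeviCivita_leftInvariantConnection (h : IsLeviCivitaProduct b N) :
    IsLeviCivita (leftInvariantMetric b hs hn) (leftInvariantConnection N) := by
  refine ⟨fun X Y hX hY x ↦ leftInvariantConnection_torsion_free h.torsion (hX.mdifferentiableAt x)
    (hY.mdifferentiableAt x), fun X Y Z hX hY hZ x ↦ ?_⟩
  rw [dirDeriv_leftInvariantMetric hY hZ, leftInvariantMetric_val, leftInvariantMetric_val,
    maurerCartan_leftInvariantConnection, maurerCartan_leftInvariantConnection]
  simp only [map_add, LinearMap.add_apply]
  linarith [h.compat (maurerCartan I x (X x)) (maurerCartan I x (Y x)) (maurerCartan I x (Z x))]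

/-- A left-invariant field of Killing vectors annihilates the metric. -/
theorem lieDeriv_leftInvariantMetric (h : IsLeviCivitaProduct b N) {v : GroupLieAlgebra I G}
    (hv : ∀ y z, b ⁅v, y⁆ z + b y ⁅v, z⁆ = 0) {Y Z : Π x : G, TangentSpace I x}
    (hY : IsSmoothVectorField Y) (hZ : IsSmoothVectorField Z) (x : G) :
    (leftInvariantMetric b hs hn).lieDeriv (mulInvariantVectorField v) Y Z x = 0 := by
  have hX := isSmoothVectorField_mulInvariantVectorField (I := I) (G := G) v
  have key {Y : Π x : G, TangentSpace I x} (hY : IsSmoothVectorField Y) :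
      maurerCartan I x (VectorField.mlieBracket I (mulInvariantVectorField v) Y x) =
        algDeriv I (leftCoeff I Y) x (mulInvariantVectorField v x)
          + ⁅v, maurerCartan I x (Y x)⁆ := by
    rw [← leftInvariantConnection_torsion_free h.torsion (hX.mdifferentiableAt x)
      (hY.mdifferentiableAt x), map_sub, maurerCartan_leftInvariantConnection,
      maurerCartan_leftInvariantConnection, algDeriv_leftCoeff_mulInvariantVectorField,
      ← leftTranslation_apply, maurerCartan_leftTranslation, ← h.torsion]
    simp only [zero_apply, zero_add]
    abel
  rw [PseudoRiemannianMetric.lieDeriv, dirDeriv_leftInvariantMetric hY hZ, leftInvariantMetric_val,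
    leftInvariantMetric_val, key hY, key hZ]
  simp only [map_add, LinearMap.add_apply]
  linarith [hv (maurerCartan I x (Y x)) (maurerCartan I x (Z x))]

variable (N) in
/-- The left-invariant curvature tensor with value the curvature of `N` at the identity. -/
def leftInvariantCurvature (x : G) : TangentSpace I x →ₗ[ℝ] TangentSpace I x →ₗ[ℝ]
    TangentSpace I x →ₗ[ℝ] TangentSpace I x :=
  LinearMap.mk₂ ℝ (fun u v ↦ (leftTranslation I x).toLinearMap ∘ₗ
      (N (maurerCartan I x u) ∘ₗ N (maurerCartan I x v)
        - N (maurerCartan I x v) ∘ₗ N (maurerCartan I x u)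
        - N ⁅maurerCartan I x u, maurerCartan I x v⁆) ∘ₗ (maurerCartan I x).toLinearMap)
    (fun u u' v ↦ by ext w; simp; abel)
    (fun c u v ↦ by ext w; simp [smul_sub])
    (fun u v v' ↦ by ext w; simp; abel)
    (fun c u v ↦ by ext w; simp [smul_sub])

omit [LieGroup I ∞ G] [FiniteDimensional ℝ E] in
theorem leftInvariantCurvature_apply (x : G) (u v w : TangentSpace I x) :
    leftInvariantCurvature N x u v w = leftTranslation I x
      (curvatureEnd N (maurerCartan I x v) (maurerCartan I x w) (maurerCartan I x u)) := by
  rw [curvatureEnd_apply]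
  rfl

omit [FiniteDimensional ℝ E] in
theorem trace_leftInvariantCurvature (x : G) (v w : TangentSpace I x) :
    LinearMap.trace ℝ (TangentSpace I x) (((leftInvariantCurvature N x).flip v).flip w) =
      ricciForm N (maurerCartan I x v) (maurerCartan I x w) := by
  let e : GroupLieAlgebra I G ≃ₗ[ℝ] TangentSpace I x :=
    LinearEquiv.ofLinearMap (leftTranslation I x).toLinearMap (maurerCartan I x).toLinearMap
      (LinearMap.ext (leftTranslation_maurerCartan x))
      (LinearMap.ext (maurerCartan_leftTranslation x))
  have h : ((leftInvariantCurvature N x).flip v).flip w =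
      e.conj (curvatureEnd N (maurerCartan I x v) (maurerCartan I x w)) := by
    ext u
    rw [LinearMap.flip_apply, LinearMap.flip_apply, leftInvariantCurvature_apply,
      LinearEquiv.conj_apply_apply]
    rfl
  rw [ricciForm, h, LinearMap.trace_conj']

omit [FiniteDimensional ℝ E] in
theorem algDeriv_commutator {f : G → E} (hf : ContMDiff I 𝓘(ℝ, E) ∞ f)
    {U V : Π x : G, TangentSpace I x} (hU : IsSmoothVectorField U) (hV : IsSmoothVectorField V)
    (x : G) :
    algDeriv I (fun y ↦ mvfderiv I f y (V y)) x (U x)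
      - algDeriv I (fun y ↦ mvfderiv I f y (U y)) x (V x) =
      algDeriv I f x (VectorField.mlieBracket I U V x) := by
  rcases subsingleton_or_nontrivial E with hE | hE
  · exact Subsingleton.elim (α := E) _ _
  refine (SeparatingDual.eq_iff_forall_dual_eq (R := ℝ) (V := E)).2 fun l ↦ ?_
  have h := mvfderiv_commutator (f := fun y ↦ l (f y)) (I := I)
    (l.contMDiff.comp hf) hU hV x
  have h1 (y : G) (v : TangentSpace I y) := 
    mvfderiv_clm_comp l ((hf y).mdifferentiableAt (by simp)) v
  simp only [h1] at h
  rw [mvfderiv_clm_comp l ((hf.mvfderiv_apply hV x).mdifferentiableAt (by simp)),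
    mvfderiv_clm_comp l ((hf.mvfderiv_apply hU x).mdifferentiableAt (by simp))] at h
  refine (map_sub l _ _).trans h

omit [LieGroup I ∞ G] [FiniteDimensional ℝ E] in
theorem mlieBracket_mulInvariantVectorField (v w : GroupLieAlgebra I G) :
    VectorField.mlieBracket I (mulInvariantVectorField v : Π x : G, TangentSpace I x)
      (mulInvariantVectorField w) = mulInvariantVectorField ⁅v, w⁆ :=
  (mulInvariantVector_mlieBracket v w).symm

end LeftInvariantMetric

noncomputable section LeftInvariantRicci

variable {E : Type*} [NormedAddCommGroup E] [NormedSpace ℝ E] [FiniteDimensional ℝ E]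
  {H : Type*} [TopologicalSpace H] {I : ModelWithCorners ℝ E H}
  {G : Type*} [TopologicalSpace G] [ChartedSpace H G] [Group G] [LieGroup I ∞ G]
  [LieGroup I (minSmoothness ℝ 3) G] [CompleteSpace E]
  {N : GroupLieAlgebra I G →ₗ[ℝ] GroupLieAlgebra I G →ₗ[ℝ] GroupLieAlgebra I G}
  {b : GroupLieAlgebra I G →ₗ[ℝ] GroupLieAlgebra I G →ₗ[ℝ] ℝ}
  {hs : ∀ v w, b v w = b w v} {hn : ∀ v, (∀ w, b v w = 0) → v = 0}

theorem isCurvatureTensor_leftInvariantCurvature (h : IsLeviCivitaProduct b N) :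
    IsCurvatureTensor (leftInvariantConnection N : CovariantDerivative I E (TangentSpace I : G → Type _))
      (leftInvariantCurvature N) := by
  intro U V W hU hV hW x
  let N' : E →L[ℝ] E →L[ℝ] E := LinearMap.toContinuousBilinearMap (E := E) (F := E) (G := E) N
  apply maurerCartan_injective
  have hcoeff (V : Π x : G, TangentSpace I x) :
      leftCoeff I (fun y ↦ leftInvariantConnection N W y (V y)) =
      (fun y ↦ mvfderiv I (leftCoeff I W) y (V y)) +
        fun y ↦ N' (leftCoeff I V y) (leftCoeff I W y) :=
    funext fun y ↦ maurerCartan_leftInvariantConnection N W y (V y)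
  have hd {V : Π x : G, TangentSpace I x} (hV : IsSmoothVectorField V) :
      MDifferentiableAt I 𝓘(ℝ, E) (leftCoeff I V) x :=
    mdifferentiableAt_leftCoeff (hV.mdifferentiableAt x)
  have hfd {V : Π x : G, TangentSpace I x} (hV : IsSmoothVectorField V) (u : TangentSpace I x) :
      algDeriv I (leftCoeff I (fun y ↦ leftInvariantConnection N W y (V y))) x u =
        algDeriv I (fun y ↦ mvfderiv I (leftCoeff I W) y (V y)) x u +
          (N (algDeriv I (leftCoeff I V) x u) (maurerCartan I x (W x)) +
           N (maurerCartan I x (V x)) (algDeriv I (leftCoeff I W) x u)) := by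
    rw [hcoeff, algDeriv_add
      (((contMDiff_leftCoeff hW).mvfderiv_apply hV x).mdifferentiableAt (by simp))]
    · exact congrArg (algDeriv I (fun y ↦ mvfderiv I (leftCoeff I W) y (V y)) x u + ·)
        (mvfderiv_bilin N' (hd hV) (hd hW) u)
    · exact (hd hV).bilin_apply N' (hd hW)
  have hc := algDeriv_commutator (contMDiff_leftCoeff hW) hU hV x
  have hb := congrArg (maurerCartan I x) (leftInvariantConnection_torsion_free h.torsion
    (hU.mdifferentiableAt x) (hV.mdifferentiableAt x))
  rw [map_sub, maurerCartan_leftInvariantConnection, maurerCartan_leftInvariantConnection] at hb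
  have hb' : N (maurerCartan I x (VectorField.mlieBracket I U V x)) (maurerCartan I x (W x)) = _ :=
    congrArg (fun z ↦ N z (maurerCartan I x (W x))) hb.symm
  simp only [map_sub, map_add, LinearMap.sub_apply, LinearMap.add_apply] at hb'
  have ht := congrArg (fun z ↦ N z (maurerCartan I x (W x)))
    (h.torsion (maurerCartan I x (U x)) (maurerCartan I x (V x)))
  simp only [map_sub, LinearMap.sub_apply] at ht
  rw [leftInvariantCurvature_apply, maurerCartan_leftTranslation, curvatureEnd_apply, ← ht]
  simp only [map_sub, maurerCartan_leftInvariantConnection, map_add]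
  rw [hfd hU, hfd hV, ← hc, hb']
  abel

/-- A Levi-Civita connection of a left-invariant metric is determined on left-invariant fields. -/
theorem IsLeviCivita.apply_mulInvariantVectorField
    {cov : CovariantDerivative I E (TangentSpace I : G → Type _)} (h : IsLeviCivitaProduct b N)
    (hcov : IsLeviCivita (leftInvariantMetric b hs hn) cov) (v w : GroupLieAlgebra I G) (x : G) :
    cov (mulInvariantVectorField w) x (mulInvariantVectorField v x) =
      mulInvariantVectorField (N v w) x := by
  have hsm := isSmoothVectorField_mulInvariantVectorField (I := I) (G := G)
  have hmd (v : GroupLieAlgebra I G) := (hsm v).mdifferentiableAt x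
  let N' : GroupLieAlgebra I G →ₗ[ℝ] GroupLieAlgebra I G →ₗ[ℝ] GroupLieAlgebra I G :=
    LinearMap.mk₂ ℝ (fun v w ↦ maurerCartan I x
        (cov (mulInvariantVectorField w) x (leftTranslation I x v)))
      (fun v v' w ↦ by simp) (fun c v w ↦ by simp)
      (fun v w w' ↦ by
        rw [mulInvariantVectorField_add, cov.isCovariantDerivativeOnUniv.add (hmd w) (hmd w')]
        simp)
      (fun c v w ↦ by
        rw [mulInvariantVectorField_smul, cov.isCovariantDerivativeOnUniv.smul_const c (hmd w)]
        simp)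
  have hN' (v w : GroupLieAlgebra I G) : N' v w = maurerCartan I x
        (cov (mulInvariantVectorField w) x (mulInvariantVectorField v x)) := rfl
  have hLC : IsLeviCivitaProduct b N' := by
    constructor
    · intro v w
      rw [hN', hN', ← map_sub, hcov.1 _ _ (hsm v) (hsm w), ← mulInvariantVector_mlieBracket,
        ← leftTranslation_apply, maurerCartan_leftTranslation]
      rfl
    · intro u v w
      have := hcov.2 _ _ _ (hsm u) (hsm v) (hsm w) x
      rw [dirDeriv_leftInvariantMetric (hsm v) (hsm w),
        algDeriv_leftCoeff_mulInvariantVectorField, algDeriv_leftCoeff_mulInvariantVectorField,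
        leftInvariantMetric_val, leftInvariantMetric_val, ← hN', ← hN'] at this
      simp only [← leftTranslation_apply, maurerCartan_leftTranslation] at this
      simpa using this.symm
  apply maurerCartan_injective
  rw [← hN', hLC.unique hs hn h, ← leftTranslation_apply, maurerCartan_leftTranslation]

/-- The Ricci tensor of a left-invariant metric. -/
theorem IsRicciTensor.eq_ricciForm {Ric : Π x : G, TangentSpace I x → TangentSpace I x → ℝ}
    (h : IsLeviCivitaProduct b N) (hRic : IsRicciTensor (leftInvariantMetric b hs hn) Ric)
    (x : G) (v w : TangentSpace I x) :
    Ric x v w = ricciForm N (maurerCartan I x v) (maurerCartan I x w) := by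
  obtain ⟨cov, hcov, R, hR, hRic⟩ := hRic
  have hsm := isSmoothVectorField_mulInvariantVectorField (I := I) (G := G)
  rw [hRic, ← trace_leftInvariantCurvature]
  congr 1
  ext u
  rw [LinearMap.flip_apply, LinearMap.flip_apply, LinearMap.flip_apply, LinearMap.flip_apply]
  have h1 := hR _ _ _ (hsm (maurerCartan I x u)) (hsm (maurerCartan I x v))
    (hsm (maurerCartan I x w)) x
  have h2 := isCurvatureTensor_leftInvariantCurvature h _ _ _ (hsm (maurerCartan I x u))
    (hsm (maurerCartan I x v)) (hsm (maurerCartan I x w)) x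
  have h3 := isLeviCivita_leftInvariantConnection (I := I) (hs := hs) (hn := hn) h
  simp only [mlieBracket_mulInvariantVectorField, hcov.apply_mulInvariantVectorField h] at h1
  simp only [mlieBracket_mulInvariantVectorField, h3.apply_mulInvariantVectorField h] at h2
  have h4 := h1.trans h2.symm
  simpa only [← leftTranslation_apply, leftTranslation_maurerCartan] using h4

theorem isRicciTensor_leftInvariantMetric (h : IsLeviCivitaProduct b N) :
    IsRicciTensor (leftInvariantMetric b hs hn) (fun (x : G) v w ↦
      ricciForm N (maurerCartan I x v) (maurerCartan I x w)) :=
  ⟨leftInvariantConnection N, isLeviCivita_leftInvariantConnection h, leftInvariantCurvature N,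
    isCurvatureTensor_leftInvariantCurvature h, fun x v w ↦
      (trace_leftInvariantCurvature x v w).symm⟩

theorem IsQuasiEinsteinData.isQuasiEinstein {m c : ℝ} {v : GroupLieAlgebra I G}
    (h : IsQuasiEinsteinData m b v c) :
    IsQuasiEinstein m (leftInvariantMetric b h.symm h.nondegenerate) (mulInvariantVectorField v) c := by
  obtain ⟨N, hN, hE, -⟩ := h.exists_product
  refine ⟨isSmoothVectorField_mulInvariantVectorField v, _, isRicciTensor_leftInvariantMetric hN,
    fun Y Z hY hZ x ↦ ?_⟩
  rw [lieDeriv_leftInvariantMetric hN h.killing hY hZ]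
  simp only [leftInvariantMetric_val]
  rw [← hE, ← leftTranslation_apply, maurerCartan_leftTranslation]
  ring

theorem IsQuasiEinsteinData.not_isEinstein {m c : ℝ} {v : GroupLieAlgebra I G}
    (h : IsQuasiEinsteinData m b v c) :
    ¬ IsEinstein (leftInvariantMetric b h.symm h.nondegenerate : PseudoRiemannianMetric I G) := by
  obtain ⟨N, hN, -, hE⟩ := h.exists_product
  rintro ⟨Ric, hRic, c', hc'⟩
  obtain ⟨y, z, hyz⟩ := hE c'
  apply hyz
  have := hc' 1 (leftTranslation I 1 y) (leftTranslation I 1 z)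
  rwa [hRic.eq_ricciForm hN, leftInvariantMetric_val, maurerCartan_leftTranslation,
    maurerCartan_leftTranslation] at this

/-- Quasi-Einstein data on the Lie algebra yield left-invariant quasi-Einstein metrics. -/
theorem AdmitsQuasiEinsteinData.exists_metrics {m : ℝ}
    (h : AdmitsQuasiEinsteinData (GroupLieAlgebra I G) m) :
    ∃ S : Set (PseudoRiemannianMetric I G), S.Infinite ∧
      (∀ g ∈ S, ∀ h ∈ S, g ≠ h → ¬ ∃ c : ℝ, ∀ (x : G) (v w : TangentSpace I x),
        h.val x v w = c * g.val x v w) ∧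
      ∀ g ∈ S, IsLeftInvariantMetric g ∧ g.IsLorentzian ∧ ¬ IsEinstein g ∧
        ∃ v : GroupLieAlgebra I G, v ≠ 0 ∧
          ∃ c : ℝ, IsQuasiEinstein m g (mulInvariantVectorField v) c := by
  obtain ⟨b, hb, h⟩ := h
  choose v c h using h
  let g (i : ℕ) : PseudoRiemannianMetric I G :=
    leftInvariantMetric (b i) (h i).symm (h i).nondegenerate
  have hg (i j : ℕ) (hij : i ≠ j) : ¬ ∃ c : ℝ, ∀ (x : G) (v w : TangentSpace I x),
      (g j).val x v w = c * (g i).val x v w := by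
    rintro ⟨c, hc⟩
    refine hb i j hij c (LinearMap.ext₂ fun y z ↦ ?_)
    have := hc 1 (leftTranslation I 1 y) (leftTranslation I 1 z)
    rwa [leftInvariantMetric_val, leftInvariantMetric_val, maurerCartan_leftTranslation,
      maurerCartan_leftTranslation] at this
  have hinj : Function.Injective g := fun i j hij ↦ by
    by_contra hne
    exact hg i j hne ⟨1, fun x v w ↦ by rw [hij, one_mul]⟩
  refine ⟨Set.range g, Set.infinite_range_of_injective hinj, ?_, ?_⟩
  · rintro _ ⟨i, rfl⟩ _ ⟨j, rfl⟩ hij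
    exact hg i j fun h ↦ hij (h ▸ rfl)
  · rintro _ ⟨i, rfl⟩
    exact ⟨isLeftInvariantMetric_leftInvariantMetric, isLorentzian_leftInvariantMetric
      (h i).lorentzian, (h i).not_isEinstein, v i, (h i).ne_zero, c i, (h i).isQuasiEinstein⟩

end LeftInvariantRicci

section Transport

variable {𝔤 L : Type*} [LieRing 𝔤] [LieAlgebra ℝ 𝔤] [LieRing L] [LieAlgebra ℝ L]

theorem IsHermitianPair.of_equiv {Z : L} {Q : L →ₗ[ℝ] L →ₗ[ℝ] ℝ} (h : IsHermitianPair Z Q)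
    (e : 𝔤 ≃ₗ[ℝ] L) (he : ∀ v w : 𝔤, e ⁅v, w⁆ = ⁅e v, e w⁆) :
    IsHermitianPair (e.symm Z) (Q.compl₁₂ e.toLinearMap e.toLinearMap) := by
  have h0 (x : 𝔤) : x = 0 ↔ e x = 0 := (map_eq_zero_iff e e.injective).symm
  have he' (v w : L) : e.symm ⁅v, w⁆ = ⁅e.symm v, e.symm w⁆ := e.injective (by simp [he])
  refine ⟨fun x ↦ e.injective ?_, ?_, fun x y ↦ h.symm _ _, fun x y z ↦ ?_, fun x hx h1 ↦ ?_,
    fun x hx h1 ↦ ?_, fun x hx ↦ ?_, fun T hT ↦ ?_⟩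
  · simpa [he] using h.cube (e x)
  · obtain ⟨x, hx⟩ := h.exists_ne
    exact ⟨e.symm x, by rw [← he']; exact fun h2 ↦ hx (by simpa using h2)⟩
  · simpa [he] using h.invariant (e x) (e y) (e z)
  · exact h.pos _ (by simpa [he] using congrArg e hx) fun h2 ↦ h1 ((h0 x).2 h2)
  · exact h.neg _ (by simpa [he] using congrArg e hx) fun h2 ↦ h1 ((h0 x).2 h2)
  · rw [h0]
    refine h.center _ fun y ↦ ?_
    simpa [he] using congrArg e (hx (e.symm y))
  · obtain ⟨a, b, hab⟩ := h.irreducible (e.toLinearMap ∘ₗ T ∘ₗ e.symm.toLinearMap) fun u hu x ↦ by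
      have := congrArg e (hT (e.symm u) (by rw [← he', hu, map_zero]) (e.symm x))
      simpa [he, he'] using this
    refine ⟨a, b, fun x hx ↦ e.injective ?_⟩
    have := hab (e x) (by simpa [he] using congrArg e hx)
    simpa [he] using this

/-- Real Lie algebras of Hermitian type yield left-invariant quasi-Einstein metrics on their Lie
groups. -/
theorem exists_metrics_of_hasLieAlgebra {E : Type*} [NormedAddCommGroup E] [NormedSpace ℝ E]
    [FiniteDimensional ℝ E] {H : Type*} [TopologicalSpace H] {I : ModelWithCorners ℝ E H}
    {G : Type*} [TopologicalSpace G] [ChartedSpace H G] [Group G] [LieGroup I ∞ G]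
    (hG : HasLieAlgebra I G L) {Z : L} {Q : L →ₗ[ℝ] L →ₗ[ℝ] ℝ} (h : IsHermitianPair Z Q)
    {m : ℝ} (hm : 0 < m) :
    ∃ S : Set (PseudoRiemannianMetric I G), S.Infinite ∧
      (∀ g ∈ S, ∀ h ∈ S, g ≠ h → ¬ ∃ c : ℝ, ∀ (x : G) (v w : TangentSpace I x),
        h.val x v w = c * g.val x v w) ∧
      ∀ g ∈ S, IsLeftInvariantMetric g ∧ g.IsLorentzian ∧ ¬ IsEinstein g ∧
        ∃ v : GroupLieAlgebra I G, v ≠ 0 ∧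
          ∃ c : ℝ, IsQuasiEinstein m g (mulInvariantVectorField v) c := by
  have : CompleteSpace E := FiniteDimensional.complete ℝ E
  have : LieGroup I (minSmoothness ℝ 3) G := LieGroup.of_le (n := ∞) (by
    rw [minSmoothness_of_isRCLikeNormedField]
    exact WithTop.coe_le_coe.2 le_top)
  have : FiniteDimensional ℝ (GroupLieAlgebra I G) := inferInstanceAs (FiniteDimensional ℝ E)
  obtain ⟨e, he⟩ := hG
  exact ((h.of_equiv e he).admitsQuasiEinsteinData hm).exists_metrics

end Transport

section MatrixHermitianPair

/-- The trace form makes a Lie algebra of matrices with compatible adjoint a Hermitian pair. -/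
theorem exists_isHermitianPair_of_matrix {𝕜 n : Type*} [RCLike 𝕜] [Fintype n] [DecidableEq n]
    {L : LieSubalgebra ℝ (Matrix n n 𝕜)} (Z : L)
    (cube : ∀ x : L, ⁅Z, ⁅Z, ⁅Z, x⁆⁆⁆ = -⁅Z, x⁆) (exists_ne : ∃ x : L, ⁅Z, x⁆ ≠ 0)
    (hk : ∀ x : L, ⁅Z, x⁆ = 0 → (x : Matrix n n 𝕜)ᴴ = -x)
    (hp : ∀ x : L, ⁅Z, ⁅Z, x⁆⁆ = -x → (x : Matrix n n 𝕜)ᴴ = x)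
    (center : ∀ x : L, (∀ y : L, ⁅x, y⁆ = 0) → x = 0)
    (irreducible : ∀ T : L →ₗ[ℝ] L, (∀ u : L, ⁅Z, u⁆ = 0 → ∀ x : L, T ⁅u, x⁆ = ⁅u, T x⁆) →
      ∃ a b : ℝ, ∀ x : L, ⁅Z, ⁅Z, x⁆⁆ = -x → T x = a • x + b • ⁅Z, x⁆) :
    ∃ (Z : L) (Q : L →ₗ[ℝ] L →ₗ[ℝ] ℝ), IsHermitianPair Z Q := by
  let Q : L →ₗ[ℝ] L →ₗ[ℝ] ℝ := LinearMap.mk₂ ℝ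
    (fun x y ↦ -RCLike.re (Matrix.trace ((x : Matrix n n 𝕜) * (y : Matrix n n 𝕜))))
    (fun x y z ↦ by simp [add_mul]; ring) (fun c x y ↦ by simp [RCLike.smul_re])
    (fun x y z ↦ by simp [mul_add]; ring) (fun c x y ↦ by simp [RCLike.smul_re])
  have hQ (x y : L) :
      Q x y = -RCLike.re (Matrix.trace ((x : Matrix n n 𝕜) * (y : Matrix n n 𝕜))) := rfl
  have hpos (A : Matrix n n 𝕜) (hA : A ≠ 0) : 0 < RCLike.re (Matrix.trace (Aᴴ * A)) := by
    have h0 : RCLike.re (Matrix.trace (Aᴴ * A)) = ∑ i, ∑ j, ‖A j i‖ ^ 2 := by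
      simp only [Matrix.trace, Matrix.diag, Matrix.mul_apply, Matrix.conjTranspose_apply, map_sum]
      refine Finset.sum_congr rfl fun i _ ↦ Finset.sum_congr rfl fun j _ ↦ ?_
      rw [RCLike.star_def, RCLike.conj_mul]
      norm_cast
    rw [h0]
    obtain ⟨j, i, hij⟩ : ∃ j i, A j i ≠ 0 := by
      by_contra! h
      exact hA (Matrix.ext h)
    refine Finset.sum_pos' (fun i _ ↦ Finset.sum_nonneg fun j _ ↦ by positivity)
      ⟨i, Finset.mem_univ _, Finset.sum_pos' (fun j _ ↦ by positivity)
        ⟨j, Finset.mem_univ _, by positivity⟩⟩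
  refine ⟨Z, Q, cube, exists_ne, fun x y ↦ ?_, fun x y z ↦ ?_, fun x hx h0 ↦ ?_, fun x hx h0 ↦ ?_,
    center, irreducible⟩
  · rw [hQ, hQ, Matrix.trace_mul_comm]
  · simp only [hQ, LieSubalgebra.coe_bracket, LieRing.of_associative_ring_bracket, sub_mul, mul_sub,
      Matrix.trace_sub, map_sub]
    rw [← mul_assoc, ← mul_assoc, Matrix.trace_mul_comm _ (x : Matrix n n 𝕜),
      ← mul_assoc]
    ring
  · have h1 := hpos x (fun h ↦ h0 (Subtype.ext h))
    rw [hk x hx, neg_mul, Matrix.trace_neg, map_neg] at h1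
    exact h1
  · have h1 := hpos x (fun h ↦ h0 (Subtype.ext h))
    rw [hp x hx] at h1
    rw [hQ]
    linarith

/-- A criterion for irreducibility in terms of a complex parametrization of the noncompact part. -/
theorem irreducible_of_parametrization {𝔤 V : Type*} [LieRing 𝔤] [LieAlgebra ℝ 𝔤] {Z : 𝔤}
    [AddCommGroup V] [Module ℂ V] (X : V →ₗ[ℝ] 𝔤) (hX : ∀ v, ⁅Z, X v⁆ = X (Complex.I • v))
    (hsurj : ∀ x : 𝔤, ⁅Z, ⁅Z, x⁆⁆ = -x → ∃ v, X v = x) (v₀ : V)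
    (hstab : ∀ v, (∀ u : 𝔤, ⁅Z, u⁆ = 0 → ⁅u, X v₀⁆ = 0 → ⁅u, X v⁆ = 0) → ∃ c : ℂ, X v = X (c • v₀))
    (hcyc : ∀ W : Submodule ℝ 𝔤, X v₀ ∈ W → (∀ u : 𝔤, ⁅Z, u⁆ = 0 → ∀ x ∈ W, ⁅u, x⁆ ∈ W) →
      ∀ v, X v ∈ W)
    (T : 𝔤 →ₗ[ℝ] 𝔤) (hT : ∀ u : 𝔤, ⁅Z, u⁆ = 0 → ∀ x : 𝔤, T ⁅u, x⁆ = ⁅u, T x⁆) :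
    ∃ a b : ℝ, ∀ x : 𝔤, ⁅Z, ⁅Z, x⁆⁆ = -x → T x = a • x + b • ⁅Z, x⁆ := by
  have hp (v : V) : ⁅Z, ⁅Z, X v⁆⁆ = -X v := by
    rw [hX, hX, smul_smul, Complex.I_mul_I, neg_one_smul, map_neg]
  obtain ⟨v, hv⟩ := hsurj (T (X v₀)) (by
    rw [← hT Z (lie_self Z), ← hT Z (lie_self Z), hp, map_neg])
  obtain ⟨c, hc⟩ := hstab v fun u hu h0 ↦ by rw [hv, ← hT u hu, h0, map_zero]
  let W : Submodule ℝ 𝔤 :=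
    LinearMap.ker (T - (c.re • LinearMap.id + c.im • (LieAlgebra.ad ℝ 𝔤 Z : 𝔤 →ₗ[ℝ] 𝔤)))
  have hW (x : 𝔤) : x ∈ W ↔ T x = c.re • x + c.im • ⁅Z, x⁆ := by
    simp [W, sub_eq_zero]
  have h0 : X v₀ ∈ W := by
    rw [hW, ← hv, hc, hX, ← map_smul, ← map_smul, ← map_add]
    congr 1
    conv_lhs => rw [← Complex.re_add_im c]
    rw [add_smul, mul_smul, Complex.coe_smul, Complex.coe_smul]
  have hWk (u : 𝔤) (hu : ⁅Z, u⁆ = 0) (x : 𝔤) (hx : x ∈ W) : ⁅u, x⁆ ∈ W := by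
    rw [hW] at hx ⊢
    rw [hT u hu, hx, leibniz_lie Z u x, hu, zero_lie, zero_add, lie_add, lie_smul, lie_smul]
  refine ⟨c.re, c.im, fun x hx ↦ ?_⟩
  obtain ⟨w, rfl⟩ := hsurj x hx
  exact (hW _).1 (hcyc W h0 hWk w)

end MatrixHermitianPair

section UnitaryModule

open Matrix

variable {𝔤 : Type*} [LieRing 𝔤] [LieAlgebra ℝ 𝔤]

theorem Matrix.single_mul_apply {l m n R : Type*} [Fintype m] [DecidableEq l] [DecidableEq m]
    [NonUnitalNonAssocSemiring R] (i : l) (j : m) (c : R) (M : Matrix m n R) (a : l) (b : n) :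
    (single i j c * M) a b = if i = a then c * M j b else 0 := by
  split_ifs with h
  · rw [← h, single_mul_apply_same]
  · exact single_mul_apply_of_ne _ _ _ _ _ (Ne.symm h) _

theorem Matrix.mul_single_apply {l m n R : Type*} [Fintype m] [DecidableEq m] [DecidableEq n]
    [NonUnitalNonAssocSemiring R] (i : m) (j : n) (c : R) (M : Matrix l m R) (a : l) (b : n) :
    (M * single i j c) a b = if j = b then M a i * c else 0 := by
  split_ifs with h
  · rw [← h, mul_single_apply_same]
  · exact mul_single_apply_of_ne _ _ _ _ _ (Ne.symm h) _

theorem Matrix.single_mul_single_eq_ite {l m n R : Type*} [Fintype m] [DecidableEq l] [DecidableEq m]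
    [DecidableEq n] [NonUnitalNonAssocSemiring R] (i : l) (j k : m) (p : n) (c d : R) :
    single i j c * single k p d = if j = k then single i p (c * d) else 0 := by
  split_ifs with h
  · rw [h, single_mul_single_same]
  · exact single_mul_single_of_ne _ _ _ _ h _

theorem mem_of_single_mem {m n : Type*} [Fintype m] [Fintype n] [DecidableEq m] [DecidableEq n]
    {X : Matrix m n ℂ →ₗ[ℝ] 𝔤} {W : Submodule ℝ 𝔤}
    (hI : ∀ S, X S ∈ W → X (Complex.I • S) ∈ W) (h : ∀ a b, X (single a b 1) ∈ W)
    (S : Matrix m n ℂ) : X S ∈ W := by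
  rw [matrix_eq_sum_single S, map_sum]
  refine W.sum_mem fun a _ ↦ ?_
  rw [map_sum]
  refine W.sum_mem fun b _ ↦ ?_
  have h1 : single a b (S a b) = (S a b).re • single a b (1 : ℂ)
      + (S a b).im • (Complex.I • single a b (1 : ℂ)) := by
    rw [smul_single, smul_single, smul_single, ← single_add]
    congr 1
    simp
  rw [h1, map_add, map_smul, map_smul]
  exact W.add_mem (W.smul_mem _ (h a b)) (W.smul_mem _ (hI _ (h a b)))

variable {ι : Type*} [Fintype ι] [DecidableEq ι]

/-- A parametrization of the isotropy representation by the action `S ↦ u S + S uᵀ` of the unitary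
Lie algebra on symmetric (`ε = 1`) or skew-symmetric (`ε = -1`) matrices. -/
structure IsUnitaryParametrization (Z : 𝔤) (K X : Matrix ι ι ℂ →ₗ[ℝ] 𝔤) (ε : ℝ) : Prop where
  lie_Z_K : ∀ M, ⁅Z, K M⁆ = 0
  lie_Z_X : ∀ S, ⁅Z, X S⁆ = X (Complex.I • S)
  lie_K_X : ∀ M S, ⁅K M, X S⁆ = X ((M - Mᴴ) * S + S * (M - Mᴴ)ᵀ)
  X_transpose : ∀ S, X Sᵀ = ε • X S
  X_eq_zero : ∀ S, X S = 0 → S + ε • Sᵀ = 0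
  exists_X : ∀ x : 𝔤, ⁅Z, ⁅Z, x⁆⁆ = -x → ∃ S, X S = x
  exists_K : ∀ x : 𝔤, ⁅Z, x⁆ = 0 → ∃ M, K M = x
  K_eq_zero : ∀ M, M - Mᴴ = 0 → K M = 0

namespace IsUnitaryParametrization

variable {Z : 𝔤} {K X : Matrix ι ι ℂ →ₗ[ℝ] 𝔤}

lemma lie_rotation {ε : ℝ} (h : IsUnitaryParametrization Z K X ε) (a c : ι) (S : Matrix ι ι ℂ) :
    ⁅K (single c a 1), X S⁆ = X ((single c a 1 - single a c 1) * S) +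
      X (S * (single a c 1 - single c a 1)) := by
  rw [h.lie_K_X, map_add]
  simp

lemma lie_torus {ε : ℝ} (h : IsUnitaryParametrization Z K X ε) (j : ι) (S : Matrix ι ι ℂ) :
    ⁅K (single j j (Complex.I / 2)), X S⁆ = X (Complex.I • (single j j 1 * S + S * single j j 1)) := by
  have h1 : single j j (Complex.I / 2) - (single j j (Complex.I / 2))ᴴ
      = Complex.I • single j j (1 : ℂ) := by
    ext a b
    by_cases hab : j = a ∧ j = b
    · obtain ⟨rfl, rfl⟩ := hab
      simp
      ring
    · simp [hab]
  rw [h.lie_K_X, h1, transpose_smul, transpose_single, smul_mul, Matrix.mul_smul, smul_add]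

omit [DecidableEq ι] in
lemma X_symmetrize {ε : ℝ} (h : IsUnitaryParametrization Z K X ε) (hε : ε * ε = 1)
    (S : Matrix ι ι ℂ) : X (S + ε • Sᵀ) = (2 : ℝ) • X S := by
  rw [map_add, map_smul, h.X_transpose, smul_smul, hε, one_smul, two_smul]

theorem irreducible_of_symm (h : IsUnitaryParametrization Z K X 1) (i : ι)
    (T : 𝔤 →ₗ[ℝ] 𝔤) (hT : ∀ u : 𝔤, ⁅Z, u⁆ = 0 → ∀ x : 𝔤, T ⁅u, x⁆ = ⁅u, T x⁆) :
    ∃ a b : ℝ, ∀ x : 𝔤, ⁅Z, ⁅Z, x⁆⁆ = -x → T x = a • x + b • ⁅Z, x⁆ := by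
  refine irreducible_of_parametrization X h.lie_Z_X h.exists_X (single i i 1) (fun S hS ↦ ?_)
    (fun W h0 hW ↦ mem_of_single_mem (fun S hS ↦ h.lie_Z_X S ▸ hW Z (lie_self Z) _ hS) ?_) T hT
  · refine ⟨S i i, ?_⟩
    have h1 (j : ι) (hj : j ≠ i) (b : ι) : S j b + S b j = 0 := by
      have h2 := hS _ (h.lie_Z_K (single j j (Complex.I / 2)))
        (by simp [h.lie_torus, hj, hj.symm])
      rw [h.lie_torus] at h2
      have h3 (a b : ι) := congrFun (congrFun (h.X_eq_zero _ h2) a) b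
      have h4 := h3 j b
      have h5 := h3 j j
      simp [mul_single_apply] at h4 h5
      rw [h5, mul_zero, ite_self, add_zero, zero_add, ← mul_add] at h4
      exact (mul_eq_zero.1 h4).resolve_left Complex.I_ne_zero
    have h2 : S + (1 : ℝ) • Sᵀ = (2 : ℝ) • (S i i • single i i (1 : ℂ)) := by
      ext a b
      simp only [one_smul, Matrix.add_apply, transpose_apply, Matrix.smul_apply, single_apply]
      by_cases ha : a = i
      · by_cases hb : b = i
        · simp [ha, hb, two_smul]
        · simpa [Ne.symm hb, add_comm] using h1 b hb a
      · simpa [Ne.symm ha] using h1 a ha b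
    have h3 := h.X_symmetrize (one_mul 1) S
    rw [h2, map_smul] at h3
    exact (smul_right_injective 𝔤 (two_ne_zero (α := ℝ)) h3).symm
  · have hc (a : ι) : X (single a i 1) ∈ W := by
      rcases eq_or_ne a i with rfl | ha
      · exact h0
      have h1 := hW _ (h.lie_Z_K (single a i 1)) _ h0
      rw [h.lie_rotation] at h1
      have h2 : X (single i a 1) = X (single a i 1) := by
        rw [← transpose_single, h.X_transpose, one_smul]
      simp only [sub_mul, mul_sub, single_mul_single_eq_ite, ha, ha.symm, if_true, if_false,
        sub_zero, mul_one, h2, ← two_smul ℝ] at h1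
      exact (W.smul_mem_iff two_ne_zero).1 h1
    intro a b
    rcases eq_or_ne b i with rfl | hb
    · exact hc a
    have h1 := hW _ (h.lie_Z_K (single b i 1)) _ (hc a)
    rw [h.lie_rotation] at h1
    have h2 : (single b i (1 : ℂ) - single i b 1) * single a i 1 =
        (if i = a then single b i 1 else 0) - (if b = a then single i i 1 else 0) := by
      simp [sub_mul, single_mul_single_eq_ite]
    have h3 : single a i (1 : ℂ) * (single i b 1 - single b i 1) = single a b 1 := by
      simp [mul_sub, hb.symm]
    have h4 : X (if i = a then single b i 1 else 0) ∈ W := by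
      split_ifs
      exacts [hc b, by simp]
    have h5 : X (if b = a then single i i 1 else 0) ∈ W := by
      split_ifs
      exacts [h0, by simp]
    rw [h2, h3, map_sub] at h1
    exact (W.add_mem_iff_right (W.sub_mem h4 h5)).1 h1

theorem irreducible_of_skew (h : IsUnitaryParametrization Z K X (-1)) {i i' : ι} (hi : i ≠ i')
    (T : 𝔤 →ₗ[ℝ] 𝔤) (hT : ∀ u : 𝔤, ⁅Z, u⁆ = 0 → ∀ x : 𝔤, T ⁅u, x⁆ = ⁅u, T x⁆) :
    ∃ a b : ℝ, ∀ x : 𝔤, ⁅Z, ⁅Z, x⁆⁆ = -x → T x = a • x + b • ⁅Z, x⁆ := by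
  refine irreducible_of_parametrization X h.lie_Z_X h.exists_X (single i i' 1) (fun S hS ↦ ?_)
    (fun W h0 hW ↦ mem_of_single_mem (fun S hS ↦ h.lie_Z_X S ▸ hW Z (lie_self Z) _ hS) ?_) T hT
  · refine ⟨S i i' - S i' i, ?_⟩
    have h1 (j : ι) (hj : j ≠ i) (hj' : j ≠ i') (b : ι) : S j b = S b j := by
      have h2 := hS _ (h.lie_Z_K (single j j (Complex.I / 2)))
        (by simp [h.lie_torus, hj, hj'.symm])
      rw [h.lie_torus] at h2
      have h3 := congrFun (congrFun (h.X_eq_zero _ h2) j) b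
      simp [mul_single_apply] at h3
      have h4 : Complex.I * (S j b - S b j) = 0 := by linear_combination h3
      exact sub_eq_zero.1 ((mul_eq_zero.1 h4).resolve_left Complex.I_ne_zero)
    have h2 : S + (-1 : ℝ) • Sᵀ = (S i i' - S i' i) • single i i' (1 : ℂ)
        + (-1 : ℝ) • ((S i i' - S i' i) • single i i' (1 : ℂ))ᵀ := by
      ext a b
      simp only [Matrix.add_apply, transpose_apply, Matrix.smul_apply, single_apply]
      by_cases ha : a = i ∨ a = i'
      · by_cases hb : b = i ∨ b = i'
        · rcases ha with rfl | rfl <;> rcases hb with rfl | rfl <;> simp [hi, hi.symm] <;> ring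
        · push Not at hb
          simp [h1 b hb.1 hb.2 a, hb.1.symm, hb.2.symm]
      · push Not at ha
        simp [h1 a ha.1 ha.2 b, ha.1.symm, ha.2.symm]
    have h3 := h.X_symmetrize (by norm_num) S
    rw [h2, h.X_symmetrize (by norm_num)] at h3
    exact (smul_right_injective 𝔤 (two_ne_zero (α := ℝ)) h3).symm
  · have hd (a : ι) : X (single a a 1) ∈ W := by
      have h2 := h.X_transpose (single a a 1)
      rw [transpose_single, neg_one_smul, eq_neg_iff_add_eq_zero, ← two_smul ℝ] at h2
      rw [(smul_eq_zero.1 h2).resolve_left two_ne_zero]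
      exact W.zero_mem
    have hc (l : ι) : X (single i l 1) ∈ W := by
      rcases eq_or_ne l i with rfl | hl
      · exact hd l
      rcases eq_or_ne l i' with rfl | hl'
      · exact h0
      have h1 := hW _ (h.lie_Z_K (single l i' 1)) _ h0
      rw [h.lie_rotation] at h1
      simpa [sub_mul, mul_sub, single_mul_single_eq_ite, hi.symm, hl, hl'.symm] using h1
    intro j l
    rcases eq_or_ne j i with rfl | hj
    · exact hc l
    have h1 := hW _ (h.lie_Z_K (single j i 1)) _ (hc l)
    rw [h.lie_rotation] at h1
    have h2 : single i l (1 : ℂ) * (single i j 1 - single j i 1) =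
        (if l = i then single i j 1 else 0) - (if l = j then single i i 1 else 0) := by
      simp [mul_sub, single_mul_single_eq_ite]
    have h3 : (single j i (1 : ℂ) - single i j 1) * single i l (1 : ℂ) = single j l 1 := by
      simp [sub_mul, hj]
    have h4 : X (if l = i then single i j 1 else 0) ∈ W := by
      split_ifs
      exacts [hc j, by simp]
    have h5 : X (if l = j then single i i 1 else 0) ∈ W := by
      split_ifs
      exacts [hd i, by simp]
    rw [h2, h3, map_sub] at h1
    exact (W.add_mem_iff_left (W.sub_mem h4 h5)).1 h1

omit [DecidableEq ι] in
lemma eq_zero_of_central {ε : ℝ} (h : IsUnitaryParametrization Z K X ε)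
    (hu : ∀ u : Matrix ι ι ℂ, (∀ S, (u * S + S * uᵀ) + ε • (u * S + S * uᵀ)ᵀ = 0) → u = 0)
    (x : 𝔤) (hx : ∀ y : 𝔤, ⁅x, y⁆ = 0) : x = 0 := by
  obtain ⟨M, rfl⟩ := h.exists_K x (by rw [← lie_skew, hx, neg_zero])
  exact h.K_eq_zero M (hu _ fun S ↦ h.X_eq_zero _ (by rw [← h.lie_K_X, hx]))

theorem center_of_symm (h : IsUnitaryParametrization Z K X 1) (x : 𝔤) (hx : ∀ y : 𝔤, ⁅x, y⁆ = 0) :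
    x = 0 := by
  refine h.eq_zero_of_central (fun u hu ↦ ?_) x hx
  ext a b
  have h1 := congrFun (congrFun (hu (single b b 1)) a) b
  simp [single_mul_apply] at h1
  by_cases hab : b = a
  · subst hab
    simpa using h1
  · simp [hab] at h1 ⊢
    linear_combination h1

theorem center_of_skew (h : IsUnitaryParametrization Z K X (-1)) (hι : 3 ≤ Fintype.card ι) (x : 𝔤)
    (hx : ∀ y : 𝔤, ⁅x, y⁆ = 0) : x = 0 := by
  have hex (a b : ι) : ∃ c, c ≠ a ∧ c ≠ b := by
    by_contra! hab
    have h1 : (Finset.univ : Finset ι) ⊆ {a, b} := fun c _ ↦ by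
      by_cases hc : c = a
      · simp [hc]
      · simp [hab c hc]
    have h2 := Finset.card_le_card h1
    have h3 := Finset.card_le_two (a := a) (b := b)
    rw [Finset.card_univ] at h2
    lia
  refine h.eq_zero_of_central (fun u hu ↦ ?_) x hx
  have hd {a b : ι} (hab : a ≠ b) : u a a + u b b = 0 := by
    have h1 := congrFun (congrFun (hu (single a b 1)) a) b
    simp [hab, hab.symm] at h1
    linear_combination h1
  ext c a
  by_cases hca : c = a
  · subst hca
    obtain ⟨b, hb, -⟩ := hex c c
    obtain ⟨d, hd1, hd2⟩ := hex c b
    have h1 := hd hb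
    have h2 := hd hd1
    have h3 := hd hd2
    simp only [Matrix.zero_apply]
    linear_combination (h1 + h2 - h3) / 2
  · obtain ⟨b, hb, hb'⟩ := hex a c
    have h1 := congrFun (congrFun (hu (single a b 1)) c) b
    simpa [mul_single_apply, single_mul_apply, hca, Ne.symm hca, hb, hb', hb.symm, hb'.symm] using h1

end IsUnitaryParametrization

end UnitaryModule

noncomputable section UnitaryBlocks

open Matrix

variable (𝕜 : Type*) [RCLike 𝕜] {ι : Type*}

/-- The real part of a complex matrix, with entries in `𝕜`. -/
def reMat {ι' : Type*} (M : Matrix ι ι' ℂ) : Matrix ι ι' 𝕜 := M.map fun z ↦ ((z.re : ℝ) : 𝕜)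

/-- The imaginary part of a complex matrix, with entries in `𝕜`. -/
def imMat {ι' : Type*} (M : Matrix ι ι' ℂ) : Matrix ι ι' 𝕜 := M.map fun z ↦ ((z.im : ℝ) : 𝕜)

/-- The embedding of complex matrices as matrices commuting with `J`. -/
def commBlock (M : Matrix ι ι ℂ) : Matrix (ι ⊕ ι) (ι ⊕ ι) 𝕜 :=
  fromBlocks (reMat 𝕜 M) (-imMat 𝕜 M) (imMat 𝕜 M) (reMat 𝕜 M)

/-- The embedding of complex matrices as matrices anticommuting with `J`. -/
def antiBlock (M : Matrix ι ι ℂ) : Matrix (ι ⊕ ι) (ι ⊕ ι) 𝕜 :=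
  fromBlocks (reMat 𝕜 M) (imMat 𝕜 M) (imMat 𝕜 M) (-reMat 𝕜 M)

variable {𝕜}

section

variable {ι' : Type*} (M N : Matrix ι ι' ℂ) (r : ℝ)

@[simp] lemma reMat_add : reMat 𝕜 (M + N) = reMat 𝕜 M + reMat 𝕜 N := by ext; simp [reMat]
@[simp] lemma imMat_add : imMat 𝕜 (M + N) = imMat 𝕜 M + imMat 𝕜 N := by ext; simp [imMat]
@[simp] lemma reMat_smul : reMat 𝕜 (r • M) = r • reMat 𝕜 M := by
  ext; simp [reMat, RCLike.real_smul_eq_coe_mul]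
@[simp] lemma imMat_smul : imMat 𝕜 (r • M) = r • imMat 𝕜 M := by
  ext; simp [imMat, RCLike.real_smul_eq_coe_mul]
@[simp] lemma reMat_transpose : reMat 𝕜 Mᵀ = (reMat 𝕜 M)ᵀ := by ext; simp [reMat]
@[simp] lemma imMat_transpose : imMat 𝕜 Mᵀ = (imMat 𝕜 M)ᵀ := by ext; simp [imMat]
@[simp] lemma reMat_conjTranspose : reMat 𝕜 Mᴴ = (reMat 𝕜 M)ᵀ := by ext; simp [reMat]
@[simp] lemma imMat_conjTranspose : imMat 𝕜 Mᴴ = -(imMat 𝕜 M)ᵀ := by ext; simp [imMat]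

end

section

variable [Fintype ι] (M N : Matrix ι ι ℂ) (r : ℝ)

@[simp] lemma reMat_mul : reMat 𝕜 (M * N) = reMat 𝕜 M * reMat 𝕜 N - imMat 𝕜 M * imMat 𝕜 N := by
  ext; simp [reMat, imMat, Matrix.mul_apply]
@[simp] lemma imMat_mul : imMat 𝕜 (M * N) = reMat 𝕜 M * imMat 𝕜 N + imMat 𝕜 M * reMat 𝕜 N := by
  ext; simp [reMat, imMat, Matrix.mul_apply, Finset.sum_add_distrib]

variable {M} in
theorem lie_commBlock_antiBlock (hM : Mᴴ = -M) :
    ⁅commBlock 𝕜 M, antiBlock 𝕜 N⁆ = antiBlock 𝕜 (M * N + N * Mᵀ) := by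
  have h1 : (reMat 𝕜 M)ᵀ = -reMat 𝕜 M := by
    rw [← reMat_conjTranspose, hM]; ext; simp [reMat]
  have h2 : (imMat 𝕜 M)ᵀ = imMat 𝕜 M := by
    rw [← neg_inj, ← imMat_conjTranspose, hM]; ext; simp [imMat]
  rw [Ring.lie_def, commBlock, antiBlock, antiBlock, fromBlocks_multiply, fromBlocks_multiply]
  simp only [reMat_add, imMat_add, reMat_mul, imMat_mul, reMat_transpose, imMat_transpose, h1, h2]
  rw [sub_eq_add_neg, fromBlocks_neg, fromBlocks_add]
  congr 1 <;> noncomm_ring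

end

section

variable (M N : Matrix ι ι ℂ) (r : ℝ)

theorem commBlock_add : commBlock 𝕜 (M + N) = commBlock 𝕜 M + commBlock 𝕜 N := by
  simp [commBlock, fromBlocks_add, add_comm]
theorem commBlock_smul : commBlock 𝕜 (r • M) = r • commBlock 𝕜 M := by
  simp [commBlock, fromBlocks_smul]
theorem antiBlock_add : antiBlock 𝕜 (M + N) = antiBlock 𝕜 M + antiBlock 𝕜 N := by
  simp [antiBlock, fromBlocks_add, add_comm]
theorem antiBlock_smul : antiBlock 𝕜 (r • M) = r • antiBlock 𝕜 M := by
  simp [antiBlock, fromBlocks_smul]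

end

variable [Fintype ι] [DecidableEq ι]

variable (𝕜) in
omit [Fintype ι] in
theorem commBlock_half_I : commBlock 𝕜 ((Complex.I / 2) • (1 : Matrix ι ι ℂ)) =
    (1 / 2 : ℝ) • J ι 𝕜 := by
  rw [commBlock, J, fromBlocks_smul]
  have h1 : reMat 𝕜 ((Complex.I / 2) • (1 : Matrix ι ι ℂ)) = 0 := by
    ext i j
    by_cases h : i = j <;> simp [reMat, h]
  have h2 : imMat 𝕜 ((Complex.I / 2) • (1 : Matrix ι ι ℂ)) = (1 / 2 : ℝ) • 1 := by
    ext i j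
    by_cases h : i = j <;> simp [imMat, h, RCLike.real_smul_eq_coe_mul]
  rw [h1, h2]
  simp

theorem commBlock_comm (M : Matrix ι ι ℂ) : J ι 𝕜 * commBlock 𝕜 M = commBlock 𝕜 M * J ι 𝕜 := by
  simp [commBlock, J, fromBlocks_multiply]

/-- The matrices commuting with `J`. -/
theorem exists_commBlock {x : Matrix (ι ⊕ ι) (ι ⊕ ι) 𝕜} (hJ : J ι 𝕜 * x = x * J ι 𝕜)
    (hre : ∀ i j, star (x i j) = x i j) : ∃ M : Matrix ι ι ℂ, commBlock 𝕜 M = x := by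
  have hre' (i j) : ((RCLike.re (x i j) : ℝ) : 𝕜) = x i j := RCLike.conj_eq_iff_re.1 (hre i j)
  refine ⟨of fun i j ↦ ⟨RCLike.re (x (.inl i) (.inl j)), RCLike.re (x (.inr i) (.inl j))⟩, ?_⟩
  rw [← fromBlocks_toBlocks x, J, fromBlocks_multiply, fromBlocks_multiply, fromBlocks_inj] at hJ
  simp only [zero_mul, mul_zero, one_mul, mul_one, neg_mul, mul_neg, zero_add, add_zero] at hJ
  conv_rhs => rw [← fromBlocks_toBlocks x, ← hJ.2.2.1, ← hJ.1]
  rw [commBlock, fromBlocks_inj]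
  refine ⟨?_, ?_, ?_, ?_⟩ <;> ext <;> simp [reMat, imMat, hre', toBlocks₁₁, toBlocks₂₁]

/-- The matrices anticommuting with `J`. -/
theorem exists_antiBlock {x : Matrix (ι ⊕ ι) (ι ⊕ ι) 𝕜} (hJ : J ι 𝕜 * x = - (x * J ι 𝕜))
    (hre : ∀ i j, star (x i j) = x i j) : ∃ M : Matrix ι ι ℂ, antiBlock 𝕜 M = x := by
  have hre' (i j) : ((RCLike.re (x i j) : ℝ) : 𝕜) = x i j := RCLike.conj_eq_iff_re.1 (hre i j)
  refine ⟨of fun i j ↦ ⟨RCLike.re (x (.inl i) (.inl j)), RCLike.re (x (.inr i) (.inl j))⟩, ?_⟩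
  rw [← fromBlocks_toBlocks x, J, fromBlocks_multiply, fromBlocks_multiply, fromBlocks_neg,
    fromBlocks_inj] at hJ
  simp only [zero_mul, mul_zero, one_mul, mul_one, neg_mul, mul_neg, zero_add, add_zero,
    neg_inj, neg_neg] at hJ
  conv_rhs => rw [← fromBlocks_toBlocks x, ← hJ.1, ← neg_eq_iff_eq_neg.2 hJ.2.2.1]
  rw [antiBlock, fromBlocks_inj]
  refine ⟨?_, ?_, ?_, ?_⟩ <;> ext <;> simp [reMat, imMat, hre', toBlocks₁₁, toBlocks₂₁]

omit [Fintype ι] [DecidableEq ι] in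
theorem commBlock_transpose (M : Matrix ι ι ℂ) : (commBlock 𝕜 M)ᵀ = commBlock 𝕜 Mᴴ := by
  simp [commBlock, fromBlocks_transpose]

omit [Fintype ι] [DecidableEq ι] in
theorem antiBlock_transpose (M : Matrix ι ι ℂ) : (antiBlock 𝕜 M)ᵀ = antiBlock 𝕜 Mᵀ := by
  simp [antiBlock, fromBlocks_transpose]

omit [Fintype ι] [DecidableEq ι] in
theorem antiBlock_injective : Function.Injective (antiBlock 𝕜 : Matrix ι ι ℂ → _) := fun M N h ↦ by
  obtain ⟨h1, -, h2, -⟩ := fromBlocks_inj.1 h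
  ext i j
  have h3 := congrFun (congrFun h1 i) j
  have h4 := congrFun (congrFun h2 i) j
  simp only [reMat, imMat, map_apply, RCLike.ofReal_inj] at h3 h4
  exact Complex.ext h3 h4

omit [Fintype ι] [DecidableEq ι] in
theorem commBlock_injective : Function.Injective (commBlock 𝕜 : Matrix ι ι ℂ → _) := fun M N h ↦ by
  obtain ⟨h1, -, h2, -⟩ := fromBlocks_inj.1 h
  ext i j
  have h3 := congrFun (congrFun h1 i) j
  have h4 := congrFun (congrFun h2 i) j
  simp only [reMat, imMat, map_apply, RCLike.ofReal_inj] at h3 h4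
  exact Complex.ext h3 h4

section HalfJ

variable {R : Type*} [Ring R] [Algebra ℝ R] {j : R}

theorem half_lie_eq_zero_iff (x : R) : ⁅(1 / 2 : ℝ) • j, x⁆ = 0 ↔ j * x = x * j := by
  rw [smul_lie, smul_eq_zero_iff_right (by norm_num), Ring.lie_def, sub_eq_zero]

theorem half_lie_half_lie (hj : j * j = -1) (x : R) :
    ⁅(1 / 2 : ℝ) • j, ⁅(1 / 2 : ℝ) • j, x⁆⁆ = -(1 / 2 : ℝ) • (x + j * x * j) := by
  have h1 : j * (j * x) = -x := by rw [← mul_assoc, hj, neg_one_mul]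
  have h2 : x * j * j = -x := by rw [mul_assoc, hj, mul_neg_one]
  rw [smul_lie, smul_lie, lie_smul, Ring.lie_def, Ring.lie_def, mul_sub, sub_mul, h1, h2, ← mul_assoc j x j]
  module

theorem half_lie_cube (hj : j * j = -1) (x : R) :
    ⁅(1 / 2 : ℝ) • j, ⁅(1 / 2 : ℝ) • j, ⁅(1 / 2 : ℝ) • j, x⁆⁆⁆ = -⁅(1 / 2 : ℝ) • j, x⁆ := by
  have h3 : j * (j * x * j) = -(x * j) := by rw [mul_assoc, ← mul_assoc, hj, neg_one_mul]
  have h4 : j * x * j * j = -(j * x) := by rw [mul_assoc, hj, mul_neg_one]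
  rw [half_lie_half_lie hj x, lie_smul, smul_lie, smul_lie, Ring.lie_def, Ring.lie_def, mul_add,
    add_mul, h3, h4]
  module

theorem half_lie_half_lie_eq_neg (hj : j * j = -1) {x : R}
    (hx : ⁅(1 / 2 : ℝ) • j, ⁅(1 / 2 : ℝ) • j, x⁆⁆ = -x) : j * x = -(x * j) := by
  rw [half_lie_half_lie hj] at hx
  have h1 : j * x * j = x := by
    linear_combination (norm := module) (-2 : ℝ) • hx
  rw [← neg_eq_iff_eq_neg, ← mul_neg_one, ← hj, ← mul_assoc, h1]

end HalfJ

variable {L : LieSubalgebra ℝ (Matrix (ι ⊕ ι) (ι ⊕ ι) 𝕜)} {c : 𝕜} {ε : ℝ}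

theorem exists_isUnitaryParametrization (hc : c ≠ 0) (hε : ε * ε = 1)
    (hK : ∀ M : Matrix ι ι ℂ, Mᴴ = -M → commBlock 𝕜 M ∈ L)
    (hX : ∀ M : Matrix ι ι ℂ, Mᵀ = ε • M → c • antiBlock 𝕜 M ∈ L)
    (hK' : ∀ x ∈ L, J ι 𝕜 * x = x * J ι 𝕜 → ∃ M : Matrix ι ι ℂ, Mᴴ = -M ∧ commBlock 𝕜 M = x)
    (hX' : ∀ x ∈ L, J ι 𝕜 * x = -(x * J ι 𝕜) →
      ∃ M : Matrix ι ι ℂ, Mᵀ = ε • M ∧ c • antiBlock 𝕜 M = x) :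
    ∃ (Z : L) (K X : Matrix ι ι ℂ →ₗ[ℝ] L), (Z : Matrix (ι ⊕ ι) (ι ⊕ ι) 𝕜) = (1 / 2 : ℝ) • J ι 𝕜 ∧
      IsUnitaryParametrization Z K X ε := by
  have hZ := commBlock_half_I (ι := ι) 𝕜
  have hI : ((Complex.I / 2) • (1 : Matrix ι ι ℂ))ᴴ = -((Complex.I / 2) • (1 : Matrix ι ι ℂ)) := by
    simp [conjTranspose_smul, neg_div]
  let Z : L := ⟨commBlock 𝕜 ((Complex.I / 2) • (1 : Matrix ι ι ℂ)), hK _ hI⟩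
  let K : Matrix ι ι ℂ →ₗ[ℝ] L :=
    { toFun M := ⟨commBlock 𝕜 (M - Mᴴ), hK _ (by simp)⟩
      map_add' M N := Subtype.ext <| by
        change commBlock 𝕜 _ = commBlock 𝕜 _ + commBlock 𝕜 _
        rw [← commBlock_add, conjTranspose_add]
        congr 1
        abel
      map_smul' r M := Subtype.ext <| by
        change commBlock 𝕜 _ = r • commBlock 𝕜 _
        rw [← commBlock_smul, conjTranspose_smul, star_trivial, smul_sub] }
  have hS (S : Matrix ι ι ℂ) : (S + ε • Sᵀ)ᵀ = ε • (S + ε • Sᵀ) := by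
    rw [smul_add, smul_smul, hε, one_smul, transpose_add, transpose_smul, transpose_transpose,
      add_comm]
  let X : Matrix ι ι ℂ →ₗ[ℝ] L :=
    { toFun S := ⟨c • antiBlock 𝕜 (S + ε • Sᵀ), hX _ (hS S)⟩
      map_add' M N := Subtype.ext <| by
        change c • antiBlock 𝕜 _ = c • antiBlock 𝕜 _ + c • antiBlock 𝕜 _
        rw [← smul_add, ← antiBlock_add, transpose_add]
        congr 2
        module
      map_smul' r M := Subtype.ext <| by
        change c • antiBlock 𝕜 _ = r • (c • antiBlock 𝕜 _)
        rw [smul_comm r c, ← antiBlock_smul, transpose_smul, smul_add, smul_comm r ε] }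
  have hKX (N S : Matrix ι ι ℂ) (hN : Nᴴ = -N) : ⁅commBlock 𝕜 N, c • antiBlock 𝕜 (S + ε • Sᵀ)⁆ =
      (X (N * S + S * Nᵀ) : Matrix (ι ⊕ ι) (ι ⊕ ι) 𝕜) := by
    change _ = c • antiBlock 𝕜 _
    rw [lie_smul, lie_commBlock_antiBlock _ hN]
    congr 2
    simp only [transpose_add, transpose_mul, transpose_transpose, mul_add, add_mul,
      Matrix.mul_smul, Matrix.smul_mul]
    module
  have hJ2 : J ι 𝕜 * J ι 𝕜 = -1 := J_squared ι 𝕜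
  refine ⟨Z, K, X, hZ, fun M ↦ Subtype.ext ?_, fun S ↦ Subtype.ext ?_,
    fun M S ↦ Subtype.ext (hKX _ S (by simp)), fun S ↦ Subtype.ext ?_, fun S h0 ↦ ?_,
    fun x hx ↦ ?_, fun x hx ↦ ?_, fun M hM ↦ Subtype.ext ?_⟩
  · change ⁅commBlock 𝕜 _, commBlock 𝕜 _⁆ = 0
    rw [hZ, half_lie_eq_zero_iff, commBlock_comm]
  · refine (hKX _ S hI).trans ?_
    rw [transpose_smul, transpose_one, smul_mul, one_mul, Matrix.mul_smul, mul_one, ← add_smul,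
      add_halves]
  · change c • antiBlock 𝕜 _ = ε • (c • antiBlock 𝕜 _)
    rw [smul_comm, ← antiBlock_smul, transpose_transpose, smul_add, smul_smul, hε, one_smul,
      add_comm]
  · have h1 : c • antiBlock 𝕜 (S + ε • Sᵀ) = 0 := congrArg Subtype.val h0
    have h2 : antiBlock 𝕜 (0 : Matrix ι ι ℂ) = 0 := by
      rw [← zero_smul ℝ (0 : Matrix ι ι ℂ), antiBlock_smul, zero_smul]
    exact antiBlock_injective (((smul_eq_zero.1 h1).resolve_left hc).trans h2.symm)
  · have h1 : ⁅commBlock 𝕜 _, ⁅commBlock 𝕜 _, (x : Matrix (ι ⊕ ι) (ι ⊕ ι) 𝕜)⁆⁆ = -x :=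
      congrArg Subtype.val hx
    rw [hZ] at h1
    obtain ⟨M, hM, hMx⟩ := hX' x x.2 (half_lie_half_lie_eq_neg hJ2 h1)
    refine ⟨(1 / 2 : ℝ) • M, Subtype.ext (Eq.trans ?_ hMx)⟩
    change c • antiBlock 𝕜 _ = _
    rw [transpose_smul, hM, smul_comm ε, smul_smul ε, hε, one_smul, ← add_smul, add_halves,
      one_smul]
  · have h1 : ⁅commBlock 𝕜 _, (x : Matrix (ι ⊕ ι) (ι ⊕ ι) 𝕜)⁆ = 0 := congrArg Subtype.val hx
    rw [hZ, half_lie_eq_zero_iff] at h1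
    obtain ⟨M, hM, hMx⟩ := hK' x x.2 h1
    refine ⟨(1 / 2 : ℝ) • M, Subtype.ext (Eq.trans ?_ hMx)⟩
    change commBlock 𝕜 _ = _
    rw [conjTranspose_smul, hM, star_trivial, smul_neg, sub_neg_eq_add, ← add_smul, add_halves,
      one_smul]
  · change commBlock 𝕜 _ = 0
    rw [hM, ← zero_smul ℝ (0 : Matrix ι ι ℂ), commBlock_smul, zero_smul]

end UnitaryBlocks

section SymplecticAndQuaternionic

open Matrix

variable {𝕜 : Type*} [RCLike 𝕜] {ι : Type*} [Fintype ι] [DecidableEq ι]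

/-- The matrices skew for `J` that commute with `J` are skew-Hermitian. -/
theorem conjTranspose_eq_neg_of_commute_J {R : Type*} [CommRing R] {A B : Matrix (ι ⊕ ι) (ι ⊕ ι) R}
    (h : B * J ι R + J ι R * A = 0) (hA : J ι R * A = A * J ι R) : B = -A := by
  rw [hA, ← add_mul] at h
  have h1 := congrArg (· * J ι R) h
  simp only [mul_assoc, J_squared, zero_mul, mul_neg, mul_one, neg_eq_zero] at h1
  exact eq_neg_of_add_eq_zero_left h1

theorem conjTranspose_eq_of_anticommute_J {R : Type*} [CommRing R] {A B : Matrix (ι ⊕ ι) (ι ⊕ ι) R}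
    (h : B * J ι R + J ι R * A = 0) (hA : J ι R * A = -(A * J ι R)) : B = A := by
  rw [hA, ← sub_eq_add_neg, ← sub_mul] at h
  have h1 := congrArg (· * J ι R) h
  simp only [mul_assoc, J_squared, zero_mul, mul_neg, mul_one, neg_eq_zero] at h1
  exact sub_eq_zero.1 h1

theorem antiBlock_anticomm (M : Matrix ι ι ℂ) :
    J ι 𝕜 * antiBlock 𝕜 M = -(antiBlock 𝕜 M * J ι 𝕜) := by
  simp [antiBlock, J, fromBlocks_multiply, fromBlocks_neg]

omit [Fintype ι] [DecidableEq ι] in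
theorem star_commBlock_apply (M : Matrix ι ι ℂ) (i j : ι ⊕ ι) :
    star (commBlock 𝕜 M i j) = commBlock 𝕜 M i j := by
  rcases i with i | i <;> rcases j with j | j <;> simp [commBlock, reMat, imMat]

omit [Fintype ι] [DecidableEq ι] in
theorem star_antiBlock_apply (M : Matrix ι ι ℂ) (i j : ι ⊕ ι) :
    star (antiBlock 𝕜 M i j) = antiBlock 𝕜 M i j := by
  rcases i with i | i <;> rcases j with j | j <;> simp [antiBlock, reMat, imMat]

/-- A Lie algebra of matrices skew for `J` with a unitary parametrization is Hermitian. -/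
theorem exists_isHermitianPair_of_sesqSkew_J {L : LieSubalgebra ℝ (Matrix (ι ⊕ ι) (ι ⊕ ι) 𝕜)}
    (hL : ∀ A ∈ L, Aᴴ * J ι 𝕜 + J ι 𝕜 * A = 0) {Z : L}
    (hZ : (Z : Matrix (ι ⊕ ι) (ι ⊕ ι) 𝕜) = (1 / 2 : ℝ) • J ι 𝕜) (exists_ne : ∃ x : L, ⁅Z, x⁆ ≠ 0)
    (center : ∀ x : L, (∀ y : L, ⁅x, y⁆ = 0) → x = 0)
    (irreducible : ∀ T : L →ₗ[ℝ] L, (∀ u : L, ⁅Z, u⁆ = 0 → ∀ x : L, T ⁅u, x⁆ = ⁅u, T x⁆) →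
      ∃ a b : ℝ, ∀ x : L, ⁅Z, ⁅Z, x⁆⁆ = -x → T x = a • x + b • ⁅Z, x⁆) :
    ∃ (Z : L) (Q : L →ₗ[ℝ] L →ₗ[ℝ] ℝ), IsHermitianPair Z Q := by
  have hJ2 : J ι 𝕜 * J ι 𝕜 = -1 := J_squared ι 𝕜
  refine exists_isHermitianPair_of_matrix Z (fun x ↦ Subtype.ext ?_) exists_ne (fun x hx ↦ ?_)
    (fun x hx ↦ ?_) center irreducible
  · have h1 := half_lie_cube hJ2 (x : Matrix (ι ⊕ ι) (ι ⊕ ι) 𝕜)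
    rwa [← hZ] at h1
  · have h1 : ⁅(Z : Matrix (ι ⊕ ι) (ι ⊕ ι) 𝕜), (x : Matrix (ι ⊕ ι) (ι ⊕ ι) 𝕜)⁆ = 0 :=
      congrArg Subtype.val hx
    rw [hZ, half_lie_eq_zero_iff] at h1
    exact conjTranspose_eq_neg_of_commute_J (hL x x.2) h1
  · have h1 : ⁅(Z : Matrix (ι ⊕ ι) (ι ⊕ ι) 𝕜),
        ⁅(Z : Matrix (ι ⊕ ι) (ι ⊕ ι) 𝕜), (x : Matrix (ι ⊕ ι) (ι ⊕ ι) 𝕜)⁆⁆ = -x :=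
      congrArg Subtype.val hx
    rw [hZ] at h1
    exact conjTranspose_eq_of_anticommute_J (hL x x.2) (half_lie_half_lie_eq_neg hJ2 h1)

omit [DecidableEq ι] in
lemma IsUnitaryParametrization.exists_ne {𝔤 : Type*} [LieRing 𝔤] [LieAlgebra ℝ 𝔤] {Z : 𝔤}
    {K X : Matrix ι ι ℂ →ₗ[ℝ] 𝔤} {ε : ℝ} (h : IsUnitaryParametrization Z K X ε) {S : Matrix ι ι ℂ}
    (hS : S + ε • Sᵀ ≠ 0) : ∃ x : 𝔤, ⁅Z, x⁆ ≠ 0 := by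
  refine ⟨X S, fun h0 ↦ hS ?_⟩
  rw [h.lie_Z_X] at h0
  have h1 := h.X_eq_zero _ h0
  rw [transpose_smul, smul_comm, ← smul_add] at h1
  exact (smul_eq_zero.1 h1).resolve_left Complex.I_ne_zero

theorem mem_sp_iff {A : Matrix (ι ⊕ ι) (ι ⊕ ι) ℝ} :
    A ∈ LieAlgebra.Symplectic.sp ι ℝ ↔ Aᴴ * J ι ℝ + J ι ℝ * A = 0 := by
  rw [conjTranspose_eq_transpose_of_trivial, LieAlgebra.Symplectic.sp,
    mem_skewAdjointMatricesLieSubalgebra, mem_skewAdjointMatricesSubmodule, Matrix.IsSkewAdjoint,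
    Matrix.IsAdjointPair, mul_neg, eq_neg_iff_add_eq_zero]

theorem exists_isHermitianPair_sp {k : ℕ} (hk : 1 ≤ k) :
    ∃ (Z : LieAlgebra.Symplectic.sp (Fin k) ℝ) (Q : LieAlgebra.Symplectic.sp (Fin k) ℝ →ₗ[ℝ]
      LieAlgebra.Symplectic.sp (Fin k) ℝ →ₗ[ℝ] ℝ), IsHermitianPair Z Q := by
  obtain ⟨Z, K, X, hZ, h⟩ := exists_isUnitaryParametrization (𝕜 := ℝ) (ι := Fin k)
    (L := LieAlgebra.Symplectic.sp (Fin k) ℝ) (c := 1) (ε := 1) one_ne_zero (one_mul 1)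
    (fun M hM ↦ by
      rw [mem_sp_iff, conjTranspose_eq_transpose_of_trivial, commBlock_transpose, hM,
        commBlock_comm, ← add_mul, ← commBlock_add, neg_add_cancel, ← zero_smul ℝ M,
        commBlock_smul, zero_smul, zero_mul])
    (fun M hM ↦ by
      rw [mem_sp_iff, one_smul, conjTranspose_eq_transpose_of_trivial, antiBlock_transpose, hM,
        one_smul, antiBlock_anticomm, add_neg_cancel])
    (fun x hx hJ ↦ by
      obtain ⟨M, rfl⟩ := exists_commBlock hJ fun i j ↦ star_trivial _
      have h1 := conjTranspose_eq_neg_of_commute_J (mem_sp_iff.1 hx) hJ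
      rw [conjTranspose_eq_transpose_of_trivial, commBlock_transpose, ← neg_one_smul ℝ,
        ← commBlock_smul, neg_one_smul] at h1
      exact ⟨M, commBlock_injective h1, rfl⟩)
    (fun x hx hJ ↦ by
      obtain ⟨M, rfl⟩ := exists_antiBlock hJ fun i j ↦ star_trivial _
      have h1 := conjTranspose_eq_of_anticommute_J (mem_sp_iff.1 hx) hJ
      rw [conjTranspose_eq_transpose_of_trivial, antiBlock_transpose] at h1
      exact ⟨M, by rw [one_smul, antiBlock_injective h1], one_smul _ _⟩)
  have i : Fin k := ⟨0, hk⟩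
  refine exists_isHermitianPair_of_sesqSkew_J (fun A hA ↦ mem_sp_iff.1 hA) hZ
    (h.exists_ne (S := single i i 1) fun h0 ↦ ?_) h.center_of_symm (h.irreducible_of_symm i)
  simpa using congrFun (congrFun h0 i) i

theorem mem_soStar_iff {k : ℕ} {A : Matrix (Fin k ⊕ Fin k) (Fin k ⊕ Fin k) ℂ} :
    A ∈ soStar k ↔ Aᵀ = -A ∧ Aᴴ * J (Fin k) ℂ + J (Fin k) ℂ * A = 0 :=
  and_congr (LieAlgebra.Orthogonal.mem_so _ _ _) Iff.rfl

theorem exists_isHermitianPair_soStar {k : ℕ} (hk : 3 ≤ k) :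
    ∃ (Z : soStar k) (Q : soStar k →ₗ[ℝ] soStar k →ₗ[ℝ] ℝ), IsHermitianPair Z Q := by
  have hct (A : Matrix (Fin k ⊕ Fin k) (Fin k ⊕ Fin k) ℂ) (hA : ∀ i j, star (A i j) = A i j) :
      Aᴴ = Aᵀ := by
    ext i j
    rw [conjTranspose_apply, hA, transpose_apply]
  obtain ⟨Z, K, X, hZ, h⟩ := exists_isUnitaryParametrization (𝕜 := ℂ) (ι := Fin k)
    (L := soStar k) (c := Complex.I) (ε := -1) Complex.I_ne_zero (by norm_num)
    (fun M hM ↦ by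
      have h1 : commBlock ℂ (-M) = -commBlock ℂ M := by
        rw [← neg_one_smul ℝ, commBlock_smul, neg_one_smul]
      rw [mem_soStar_iff, hct _ (star_commBlock_apply M), commBlock_transpose, hM, h1,
        commBlock_comm, neg_mul, neg_add_cancel]
      exact ⟨rfl, rfl⟩)
    (fun M hM ↦ by
      have h1 : (antiBlock ℂ M)ᵀ = -antiBlock ℂ M := by
        rw [antiBlock_transpose, hM, antiBlock_smul, neg_one_smul]
      rw [mem_soStar_iff, transpose_smul, conjTranspose_smul, hct _ (star_antiBlock_apply M),
        Matrix.mul_smul, antiBlock_anticomm, h1]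
      simp)
    (fun x hx hJ ↦ by
      rw [mem_soStar_iff] at hx
      have h1 := conjTranspose_eq_neg_of_commute_J hx.2 hJ
      obtain ⟨M, rfl⟩ := exists_commBlock hJ fun i j ↦
        congrFun (congrFun (h1.trans hx.1.symm) j) i
      rw [hct _ (star_commBlock_apply M), commBlock_transpose, ← neg_one_smul ℝ,
        ← commBlock_smul, neg_one_smul] at h1
      exact ⟨M, commBlock_injective h1, rfl⟩)
    (fun x hx hJ ↦ by
      rw [mem_soStar_iff] at hx
      have h1 := conjTranspose_eq_of_anticommute_J hx.2 hJ
      have h2 (i j) : star (x i j) = -x i j := by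
        rw [← Matrix.neg_apply, ← hx.1, transpose_apply]
        exact congrFun (congrFun h1 j) i
      obtain ⟨M, hM⟩ := exists_antiBlock (x := -Complex.I • x)
        (by rw [Matrix.mul_smul, Matrix.smul_mul, hJ, smul_neg]) fun i j ↦ by
          rw [Matrix.smul_apply, smul_eq_mul, star_mul', h2]
          simp
      have h3 : x = Complex.I • antiBlock ℂ M := by
        rw [hM, smul_smul]
        simp
      refine ⟨M, antiBlock_injective (𝕜 := ℂ) ?_, h3.symm⟩
      rw [← antiBlock_transpose, hM, transpose_smul, hx.1, antiBlock_smul, hM, neg_one_smul,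
        smul_neg])
  obtain ⟨i, i', hi⟩ : ∃ i i' : Fin k, i ≠ i' := ⟨⟨0, by lia⟩, ⟨1, by lia⟩, by simp⟩
  refine exists_isHermitianPair_of_sesqSkew_J (fun A hA ↦ (mem_soStar_iff.1 hA).2) hZ
    (h.exists_ne (S := single i i' 1) fun h0 ↦ ?_)
    (h.center_of_skew (by simpa using hk)) (h.irreducible_of_skew hi)
  simpa [hi, hi.symm] using congrFun (congrFun h0 i) i'

end SymplecticAndQuaternionic

section IndefiniteUnitaryAndOrthogonal

open Matrix

variable {m n R : Type*} [Fintype m] [Fintype n] [DecidableEq m] [DecidableEq n]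

theorem lie_fromBlocks_diagonal [Ring R] (a A : Matrix m m R) (d D : Matrix n n R)
    (B : Matrix m n R) (C : Matrix n m R) :
    ⁅fromBlocks a 0 0 d, fromBlocks A B C D⁆ =
      fromBlocks ⁅a, A⁆ (a * B - B * d) (d * C - C * a) ⁅d, D⁆ := by
  simp only [Ring.lie_def, fromBlocks_multiply, sub_eq_add_neg, fromBlocks_neg, fromBlocks_add]
  simp

omit [Fintype m] [Fintype n] in
theorem indefiniteDiagonal_eq_fromBlocks [CommRing R] :
    LieAlgebra.Orthogonal.indefiniteDiagonal m n R = fromBlocks 1 0 0 (-1) := by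
  rw [← diagonal_one, ← diagonal_one, diagonal_neg, fromBlocks_diagonal]
  rfl

theorem eq_smul_one_of_mul_eq_mul [CommRing R] [Nonempty m] [Nonempty n] {A : Matrix m m R}
    {D : Matrix n n R} (h : ∀ B : Matrix m n R, A * B = B * D) : ∃ c : R, A = c • 1 ∧ D = c • 1 := by
  have h1 (a a' : m) (b b' : n) :
      (if b = b' then A a' a else 0) = if a = a' then D b b' else 0 := by
    simpa [mul_single_apply, single_mul_apply] using congrFun (congrFun (h (single a b 1)) a') b'
  obtain ⟨i⟩ := ‹Nonempty m›
  obtain ⟨j⟩ := ‹Nonempty n›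
  refine ⟨A i i, ?_, ?_⟩
  · ext a a'
    rcases eq_or_ne a' a with rfl | ha
    · have h2 := h1 i i j j
      have h3 := h1 a' a' j j
      simp_all
    · simpa [ha, ha.symm] using h1 a' a j j
  · ext b b'
    rcases eq_or_ne b b' with rfl | hb
    · simpa using (h1 i i b b).symm
    · simpa [hb] using (h1 i i b b').symm

theorem fromBlocks_conjTranspose_mul_add_mul_eq_zero_iff [CommRing R] [StarRing R]
    {A : Matrix m m R} {B : Matrix m n R} {C : Matrix n m R} {D : Matrix n n R} :
    (fromBlocks A B C D)ᴴ * fromBlocks 1 0 0 (-1) + fromBlocks 1 0 0 (-1) * fromBlocks A B C D = 0 ↔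
      Aᴴ = -A ∧ C = Bᴴ ∧ Dᴴ = -D := by
  rw [fromBlocks_conjTranspose, fromBlocks_multiply, fromBlocks_multiply, fromBlocks_add,
    ← fromBlocks_zero, fromBlocks_inj]
  simp only [Matrix.mul_one, Matrix.mul_zero, add_zero, Matrix.mul_neg, zero_add, Matrix.one_mul,
    Matrix.zero_mul, Matrix.neg_mul]
  constructor
  · rintro ⟨h1, -, h2, h3⟩
    refine ⟨eq_neg_of_add_eq_zero_left h1, (add_neg_eq_zero.1 h2).symm, ?_⟩
    rw [← neg_add, neg_eq_zero] at h3
    exact eq_neg_of_add_eq_zero_left h3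
  · rintro ⟨h1, rfl, h2⟩
    rw [h1, h2]
    simp

theorem mem_suPQ_iff {p q : ℕ} {A : Matrix (Fin p) (Fin p) ℂ} {B : Matrix (Fin p) (Fin q) ℂ}
    {C : Matrix (Fin q) (Fin p) ℂ} {D : Matrix (Fin q) (Fin q) ℂ} :
    fromBlocks A B C D ∈ suPQ p q ↔ trace A + trace D = 0 ∧ Aᴴ = -A ∧ C = Bᴴ ∧ Dᴴ = -D := by
  have htr : trace (fromBlocks A B C D) = trace A + trace D := by
    simp [trace, Fintype.sum_sum_type]
  rw [← fromBlocks_conjTranspose_mul_add_mul_eq_zero_iff, ← htr, ← indefiniteDiagonal_eq_fromBlocks]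
  refine and_congr ?_ Iff.rfl
  change fromBlocks A B C D ∈ LieAlgebra.SpecialLinear.sl (Fin p ⊕ Fin q) ℂ ↔ _
  rw [LieAlgebra.SpecialLinear.sl]
  exact LinearMap.mem_ker

theorem mem_so'_iff {p q : ℕ} {A : Matrix (Fin p) (Fin p) ℝ} {B : Matrix (Fin p) (Fin q) ℝ}
    {C : Matrix (Fin q) (Fin p) ℝ} {D : Matrix (Fin q) (Fin q) ℝ} :
    fromBlocks A B C D ∈ LieAlgebra.Orthogonal.so' (Fin p) (Fin q) ℝ ↔
      Aᴴ = -A ∧ C = Bᴴ ∧ Dᴴ = -D := by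
  rw [← fromBlocks_conjTranspose_mul_add_mul_eq_zero_iff, ← indefiniteDiagonal_eq_fromBlocks,
    LieAlgebra.Orthogonal.so', mem_skewAdjointMatricesLieSubalgebra,
    mem_skewAdjointMatricesSubmodule, Matrix.IsSkewAdjoint, Matrix.IsAdjointPair, mul_neg,
    eq_neg_iff_add_eq_zero, conjTranspose_eq_transpose_of_trivial]

/-- The embedding of rectangular matrices as off-diagonal Hermitian matrices. -/
def offDiag {m n : Type*} {R : Type*} [CommRing R] [StarRing R] (B : Matrix m n R) :
    Matrix (m ⊕ n) (m ⊕ n) R := fromBlocks 0 B Bᴴ 0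

theorem lie_fromBlocks_offDiag [CommRing R] [StarRing R] {a : Matrix m m R} {d : Matrix n n R}
    (ha : aᴴ = -a) (hd : dᴴ = -d) (B : Matrix m n R) :
    ⁅fromBlocks a 0 0 d, offDiag B⁆ = offDiag (a * B - B * d) := by
  rw [offDiag, lie_fromBlocks_diagonal, lie_zero, lie_zero, offDiag, conjTranspose_sub,
    conjTranspose_mul, conjTranspose_mul, ha, hd]
  congr 1
  rw [Matrix.mul_neg, Matrix.neg_mul]
  abel

theorem exists_isHermitianPair_suPQ {p q : ℕ} (hp : 0 < p) (hq : 0 < q) :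
    ∃ (Z : suPQ p q) (Q : suPQ p q →ₗ[ℝ] suPQ p q →ₗ[ℝ] ℝ), IsHermitianPair Z Q := by
  have hpq : ((p : ℂ) + q) ≠ 0 := by exact_mod_cast (by lia : p + q ≠ 0)
  let t (a : Matrix (Fin p) (Fin p) ℂ) (d : Matrix (Fin q) (Fin q) ℂ) : ℂ :=
    (trace a + trace d) / (p + q)
  have ht {a : Matrix (Fin p) (Fin p) ℂ} {d : Matrix (Fin q) (Fin q) ℂ} (ha : aᴴ = -a)
      (hd : dᴴ = -d) : star (t a d) = -t a d := by
    simp only [t, star_div₀, star_add, ← trace_conjTranspose, ha, hd, trace_neg, star_natCast]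
    ring
  let K {a : Matrix (Fin p) (Fin p) ℂ} {d : Matrix (Fin q) (Fin q) ℂ} (ha : aᴴ = -a)
      (hd : dᴴ = -d) : suPQ p q := ⟨fromBlocks (a - t a d • 1) 0 0 (d - t a d • 1), by
    refine mem_suPQ_iff.2 ⟨?_, ?_, by simp, ?_⟩
    · simp only [t, trace_sub, trace_smul, trace_one, Fintype.card_fin, smul_eq_mul]
      field_simp
      try ring
    · rw [conjTranspose_sub, conjTranspose_smul, ha, ht ha hd, conjTranspose_one]
      module
    · rw [conjTranspose_sub, conjTranspose_smul, hd, ht ha hd, conjTranspose_one]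
      module⟩
  let X : Matrix (Fin p) (Fin q) ℂ →ₗ[ℝ] suPQ p q :=
    { toFun B := ⟨offDiag B, mem_suPQ_iff.2 (by simp)⟩
      map_add' B B' := Subtype.ext <| by
        change offDiag _ = offDiag _ + offDiag _
        simp [offDiag, fromBlocks_add]
      map_smul' r B := Subtype.ext <| by
        change offDiag _ = r • offDiag _
        simp [offDiag, fromBlocks_smul] }
  have hX0 {B : Matrix (Fin p) (Fin q) ℂ} (hB : X B = 0) : B = 0 := by
    have h1 : fromBlocks 0 B Bᴴ 0 = 0 := congrArg Subtype.val hB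
    rw [← fromBlocks_zero, fromBlocks_inj] at h1
    exact h1.2.1
  have hKX {a : Matrix (Fin p) (Fin p) ℂ} {d : Matrix (Fin q) (Fin q) ℂ} (ha : aᴴ = -a)
      (hd : dᴴ = -d) (B : Matrix (Fin p) (Fin q) ℂ) : ⁅K ha hd, X B⁆ = X (a * B - B * d) := by
    have h1 := mem_suPQ_iff.1 (K ha hd).2
    refine Subtype.ext ((lie_fromBlocks_offDiag h1.2.1 h1.2.2.2 B).trans ?_)
    change offDiag _ = offDiag _
    congr 1
    simp [Matrix.sub_mul, Matrix.mul_sub]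
  have hI : (Complex.I • (1 : Matrix (Fin p) (Fin p) ℂ))ᴴ = -(Complex.I • 1) := by
    simp [conjTranspose_smul]
  have h0 : (0 : Matrix (Fin q) (Fin q) ℂ)ᴴ = -0 := by simp
  have h0' : (0 : Matrix (Fin p) (Fin p) ℂ)ᴴ = -0 := by simp
  let Z : suPQ p q := K hI h0
  have hZX (B : Matrix (Fin p) (Fin q) ℂ) : ⁅Z, X B⁆ = X (Complex.I • B) := by
    simp [Z, hKX]
  have hZ (A : Matrix (Fin p) (Fin p) ℂ) (B : Matrix (Fin p) (Fin q) ℂ)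
      (C : Matrix (Fin q) (Fin p) ℂ) (D : Matrix (Fin q) (Fin q) ℂ) :
      ⁅(Z : Matrix (Fin p ⊕ Fin q) (Fin p ⊕ Fin q) ℂ), fromBlocks A B C D⁆ =
        fromBlocks 0 (Complex.I • B) (-(Complex.I • C)) 0 := by
    simp only [Z, K]
    rw [lie_fromBlocks_diagonal]
    simp only [Ring.lie_def]
    congr 1 <;> simp [sub_mul, mul_sub, Matrix.sub_mul, Matrix.mul_sub]
    abel
  have hZK {a : Matrix (Fin p) (Fin p) ℂ} {d : Matrix (Fin q) (Fin q) ℂ} (ha : aᴴ = -a)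
      (hd : dᴴ = -d) : ⁅Z, K ha hd⁆ = 0 :=
    Subtype.ext ((hZ _ _ _ _).trans (by simp))
  have hmem (x : suPQ p q) : ∃ A B C D,
      (x : Matrix (Fin p ⊕ Fin q) (Fin p ⊕ Fin q) ℂ) = fromBlocks A B C D ∧
        trace A + trace D = 0 ∧ Aᴴ = -A ∧ C = Bᴴ ∧ Dᴴ = -D := by
    refine ⟨_, _, _, _, (fromBlocks_toBlocks _).symm, mem_suPQ_iff.1 ?_⟩
    rw [fromBlocks_toBlocks]
    exact x.2
  have hk (x : suPQ p q) (hx : ⁅Z, x⁆ = 0) : ∃ A D,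
      (x : Matrix (Fin p ⊕ Fin q) (Fin p ⊕ Fin q) ℂ) = fromBlocks A 0 0 D ∧
        trace A + trace D = 0 ∧ Aᴴ = -A ∧ Dᴴ = -D := by
    obtain ⟨A, B, C, D, h1, h2, h3, rfl, h5⟩ := hmem x
    have h6 := congrArg Subtype.val hx
    rw [LieSubalgebra.coe_bracket, h1, hZ] at h6
    have h7 := (fromBlocks_inj.1 (h6.trans fromBlocks_zero.symm)).2.1
    have h8 := (smul_eq_zero.1 h7).resolve_left Complex.I_ne_zero
    subst h8
    exact ⟨A, D, by rw [h1, conjTranspose_zero], h2, h3, h5⟩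
  have hp' (x : suPQ p q) (hx : ⁅Z, ⁅Z, x⁆⁆ = -x) : ∃ B, X B = x := by
    obtain ⟨A, B, C, D, h1, h2, h3, rfl, h5⟩ := hmem x
    have h6 := congrArg Subtype.val hx
    rw [LieSubalgebra.coe_bracket, LieSubalgebra.coe_bracket, h1, hZ, hZ] at h6
    have h7 := fromBlocks_inj.1 (h6.trans ((congrArg Neg.neg h1).trans (fromBlocks_neg _ _ _ _)))
    rw [zero_eq_neg, zero_eq_neg] at h7
    refine ⟨B, Subtype.ext (Eq.trans ?_ h1.symm)⟩
    rw [h7.1, h7.2.2.2]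
    rfl
  obtain ⟨i⟩ : Nonempty (Fin p) := ⟨⟨0, hp⟩⟩
  obtain ⟨j⟩ : Nonempty (Fin q) := ⟨⟨0, hq⟩⟩
  refine exists_isHermitianPair_of_matrix Z (fun x ↦ Subtype.ext ?_) ⟨X (single i j 1), fun h ↦ ?_⟩
    (fun x hx ↦ ?_) (fun x hx ↦ ?_) (fun x hx ↦ ?_)
    (irreducible_of_parametrization X hZX hp' (single i j 1) (fun v hv ↦ ⟨v i j, ?_⟩)
      (fun W hW0 hW ↦ mem_of_single_mem (fun S hS ↦ hZX S ▸ hW Z (lie_self Z) _ hS) ?_))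
  · obtain ⟨A, B, C, D, h1, -⟩ := hmem x
    change ⁅Z.1, ⁅Z.1, ⁅Z.1, x.1⁆⁆⁆ = -⁅Z.1, x.1⁆
    rw [h1, hZ, hZ, hZ, fromBlocks_neg]
    simp [smul_smul]
  · rw [hZX] at h
    simpa using congrFun (congrFun (hX0 h) i) j
  · obtain ⟨A, D, h1, -, h2, h3⟩ := hk x hx
    rw [h1, fromBlocks_conjTranspose, h2, h3, fromBlocks_neg]
    simp
  · obtain ⟨B, rfl⟩ := hp' x hx
    change (fromBlocks 0 B Bᴴ 0)ᴴ = fromBlocks 0 B Bᴴ 0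
    rw [fromBlocks_conjTranspose]
    simp
  · obtain ⟨A, D, h1, h2, h3, h4⟩ := hk x (by rw [← lie_skew, hx, neg_zero])
    have : Nonempty (Fin p) := ⟨i⟩
    have : Nonempty (Fin q) := ⟨j⟩
    obtain ⟨c, rfl, rfl⟩ := eq_smul_one_of_mul_eq_mul (A := A) (D := D) fun B ↦ by
      have h5 := congrArg Subtype.val (hx (X B))
      rw [LieSubalgebra.coe_bracket, h1] at h5
      have h6 := (lie_fromBlocks_offDiag h3 h4 B).symm.trans h5
      exact sub_eq_zero.1 (fromBlocks_inj.1 (h6.trans fromBlocks_zero.symm)).2.1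
    have h5 : c = 0 := by
      simp only [trace_smul, trace_one, Fintype.card_fin, smul_eq_mul, ← mul_add] at h2
      exact (mul_eq_zero.1 h2).resolve_right hpq
    refine Subtype.ext (h1.trans ?_)
    simp [h5]
  · have h1 : (Complex.I • (1 - single i i 1 : Matrix (Fin p) (Fin p) ℂ))ᴴ =
        -(Complex.I • (1 - single i i 1)) := by simp [conjTranspose_smul]
    have h2 : (Complex.I • (1 - single j j 1 : Matrix (Fin q) (Fin q) ℂ))ᴴ =
        -(Complex.I • (1 - single j j 1)) := by simp [conjTranspose_smul]
    have h3 := hv (K h1 h0) (hZK h1 h0) (by simp [hKX, Matrix.sub_mul])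
    have h4 := hv (K h0' h2) (hZK h0' h2) (by simp [hKX, Matrix.mul_sub])
    rw [hKX h1 h0] at h3
    rw [hKX h0' h2] at h4
    congr 1
    ext a b
    have h5 := congrFun (congrFun (hX0 h3) a) b
    have h6 := congrFun (congrFun (hX0 h4) a) b
    rcases eq_or_ne i a with rfl | ha
    · rcases eq_or_ne j b with rfl | hb
      · simp
      · simpa [hb, Matrix.mul_sub, mul_single_apply] using h6
    · simpa [ha, Matrix.sub_mul, single_mul_apply] using h5
  · have hr (a : Fin p) : X (single a j 1) ∈ W := by
      rcases eq_or_ne i a with rfl | ha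
      · exact hW0
      have h1 : (single a i 1 - single i a 1 : Matrix (Fin p) (Fin p) ℂ)ᴴ =
          -(single a i 1 - single i a 1) := by simp
      have h2 := hW (K h1 h0) (hZK h1 h0) _ hW0
      rw [hKX h1 h0] at h2
      simpa [Matrix.sub_mul, single_mul_single_eq_ite, ha.symm] using h2
    intro a b
    rcases eq_or_ne j b with rfl | hb
    · exact hr a
    have h1 : (single b j 1 - single j b 1 : Matrix (Fin q) (Fin q) ℂ)ᴴ =
        -(single b j 1 - single j b 1) := by simp
    have h2 := hW (K h0' h1) (hZK h0' h1) _ (hr a)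
    rw [hKX h0' h1] at h2
    simpa [Matrix.mul_sub, single_mul_single_eq_ite, hb] using h2

end IndefiniteUnitaryAndOrthogonal

section RealOrthogonal

open Matrix

/-- Rotation by a right angle. -/
def rotationMatrix : Matrix (Fin 2) (Fin 2) ℝ := !![0, -1; 1, 0]

theorem rotationMatrix_conjTranspose : rotationMatrixᴴ = -rotationMatrix := by
  ext i j
  fin_cases i <;> fin_cases j <;> simp [rotationMatrix]

theorem rotationMatrix_mul_self : rotationMatrix * rotationMatrix = -1 := by
  ext i j
  fin_cases i <;> fin_cases j <;> simp [rotationMatrix]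

theorem rotationMatrix_lie_eq_zero {A : Matrix (Fin 2) (Fin 2) ℝ} (hA : Aᴴ = -A) :
    ⁅rotationMatrix, A⁆ = 0 := by
  have h (i j) : A j i = -A i j := congrFun (congrFun hA i) j
  have h0 := h 0 0
  have h1 := h 1 1
  have h2 := h 0 1
  have h3 : A = A 1 0 • rotationMatrix := by
    ext i j
    fin_cases i <;> fin_cases j <;> simp [rotationMatrix] <;> linarith
  rw [h3, lie_smul, lie_self, smul_zero]

/-- Complex vectors as real matrices with two rows. -/
def twoRows {ι : Type*} : (ι → ℂ) →ₗ[ℝ] Matrix (Fin 2) ι ℝ where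
  toFun z := of ![fun i ↦ (z i).re, fun i ↦ (z i).im]
  map_add' z w := by
    ext i j
    fin_cases i <;> simp
  map_smul' r z := by
    ext i j
    fin_cases i <;> simp

theorem twoRows_injective {ι : Type*} : Function.Injective (twoRows (ι := ι)) := fun z w h ↦ by
  ext i
  exact Complex.ext (congrFun (congrFun h 0) i) (congrFun (congrFun h 1) i)

theorem exists_twoRows {ι : Type*} (B : Matrix (Fin 2) ι ℝ) : ∃ z, twoRows z = B := by
  refine ⟨fun i ↦ ⟨B 0 i, B 1 i⟩, ?_⟩
  ext i j
  fin_cases i <;> rfl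

theorem rotationMatrix_mul_twoRows {ι : Type*} (z : ι → ℂ) :
    rotationMatrix * twoRows z = twoRows (Complex.I • z) := by
  ext i j
  fin_cases i <;> simp [rotationMatrix, twoRows, Matrix.mul_apply, Fin.sum_univ_two]

theorem twoRows_mul {ι : Type*} [Fintype ι] (z : ι → ℂ) (D : Matrix ι ι ℝ) :
    twoRows z * D = twoRows (z ᵥ* D.map Complex.ofReal) := by
  ext i j
  fin_cases i <;> simp [twoRows, Matrix.mul_apply, vecMul, dotProduct]

theorem exists_isHermitianPair_so' {k : ℕ} (hk : 3 ≤ k) :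
    ∃ (Z : LieAlgebra.Orthogonal.so' (Fin 2) (Fin k) ℝ)
      (Q : LieAlgebra.Orthogonal.so' (Fin 2) (Fin k) ℝ →ₗ[ℝ]
        LieAlgebra.Orthogonal.so' (Fin 2) (Fin k) ℝ →ₗ[ℝ] ℝ), IsHermitianPair Z Q := by
  let K {d : Matrix (Fin k) (Fin k) ℝ} (hd : dᴴ = -d) :
      LieAlgebra.Orthogonal.so' (Fin 2) (Fin k) ℝ := ⟨fromBlocks 0 0 0 d, by
    exact mem_so'_iff.2 ⟨by simp, by simp, hd⟩⟩
  let Z : LieAlgebra.Orthogonal.so' (Fin 2) (Fin k) ℝ := ⟨fromBlocks rotationMatrix 0 0 0, by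
    exact mem_so'_iff.2 ⟨rotationMatrix_conjTranspose, by simp, by simp⟩⟩
  let X : (Fin k → ℂ) →ₗ[ℝ] LieAlgebra.Orthogonal.so' (Fin 2) (Fin k) ℝ :=
    { toFun z := ⟨offDiag (twoRows z), mem_so'_iff.2 (by simp)⟩
      map_add' z w := Subtype.ext <| by
        change offDiag _ = offDiag _ + offDiag _
        simp [offDiag, fromBlocks_add]
      map_smul' r z := Subtype.ext <| by
        change offDiag _ = r • offDiag _
        simp [offDiag, fromBlocks_smul] }
  have hX0 {z : Fin k → ℂ} (hz : X z = 0) : z = 0 := by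
    have h1 : fromBlocks 0 (twoRows z) _ 0 = 0 := congrArg Subtype.val hz
    rw [← fromBlocks_zero, fromBlocks_inj] at h1
    exact twoRows_injective (h1.2.1.trans (map_zero _).symm)
  have hKX {d : Matrix (Fin k) (Fin k) ℝ} (hd : dᴴ = -d) (z : Fin k → ℂ) :
      ⁅K hd, X z⁆ = -X (z ᵥ* d.map Complex.ofReal) := by
    refine Subtype.ext ((lie_fromBlocks_offDiag (by simp) hd _).trans ?_)
    rw [← map_neg]
    change offDiag _ = offDiag _
    rw [Matrix.zero_mul, zero_sub, twoRows_mul, map_neg]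
  have hZX (z : Fin k → ℂ) : ⁅Z, X z⁆ = X (Complex.I • z) := by
    refine Subtype.ext ((lie_fromBlocks_offDiag rotationMatrix_conjTranspose (by simp) _).trans ?_)
    change offDiag _ = offDiag _
    rw [Matrix.mul_zero, sub_zero, rotationMatrix_mul_twoRows]
  have hZ {A : Matrix (Fin 2) (Fin 2) ℝ} (hA : Aᴴ = -A) (B : Matrix (Fin 2) (Fin k) ℝ)
      (C : Matrix (Fin k) (Fin 2) ℝ) (D : Matrix (Fin k) (Fin k) ℝ) :
      ⁅Z.1, fromBlocks A B C D⁆ =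
        fromBlocks 0 (rotationMatrix * B) (-(C * rotationMatrix)) 0 := by
    simp only [Z]
    rw [lie_fromBlocks_diagonal, rotationMatrix_lie_eq_zero hA]
    simp
  have hZK {d : Matrix (Fin k) (Fin k) ℝ} (hd : dᴴ = -d) : ⁅Z, K hd⁆ = 0 :=
    Subtype.ext ((hZ (by simp) _ _ _).trans (by simp))
  have hJ {n : ℕ} (B : Matrix (Fin 2) (Fin n) ℝ) : rotationMatrix * (rotationMatrix * B) = -B := by
    rw [← Matrix.mul_assoc, rotationMatrix_mul_self, Matrix.neg_mul, Matrix.one_mul]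
  have hJ' (C : Matrix (Fin k) (Fin 2) ℝ) : C * rotationMatrix * rotationMatrix = -C := by
    rw [Matrix.mul_assoc, rotationMatrix_mul_self, Matrix.mul_neg, Matrix.mul_one]
  have hmem (x : LieAlgebra.Orthogonal.so' (Fin 2) (Fin k) ℝ) : ∃ A B C D,
      x.1 = fromBlocks A B C D ∧ Aᴴ = -A ∧ C = Bᴴ ∧ Dᴴ = -D := by
    refine ⟨_, _, _, _, (fromBlocks_toBlocks _).symm, mem_so'_iff.1 ?_⟩
    rw [fromBlocks_toBlocks]
    exact x.2
  have hk' (x : LieAlgebra.Orthogonal.so' (Fin 2) (Fin k) ℝ) (hx : ⁅Z, x⁆ = 0) : ∃ A D,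
      x.1 = fromBlocks A 0 0 D ∧ Aᴴ = -A ∧ Dᴴ = -D := by
    obtain ⟨A, B, C, D, h1, h2, rfl, h4⟩ := hmem x
    have h6 := congrArg Subtype.val hx
    rw [LieSubalgebra.coe_bracket, h1, hZ h2] at h6
    have h7 := (fromBlocks_inj.1 (h6.trans fromBlocks_zero.symm)).2.1
    have h8 := hJ B
    rw [h7, Matrix.mul_zero, zero_eq_neg] at h8
    subst h8
    exact ⟨A, D, by rw [h1, conjTranspose_zero], h2, h4⟩
  have hp' (x : LieAlgebra.Orthogonal.so' (Fin 2) (Fin k) ℝ) (hx : ⁅Z, ⁅Z, x⁆⁆ = -x) :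
      ∃ z, X z = x := by
    obtain ⟨A, B, C, D, h1, h2, rfl, h4⟩ := hmem x
    have h6 := congrArg Subtype.val hx
    rw [LieSubalgebra.coe_bracket, LieSubalgebra.coe_bracket, h1, hZ h2, hZ (by simp)] at h6
    have h7 := fromBlocks_inj.1 (h6.trans ((congrArg Neg.neg h1).trans (fromBlocks_neg _ _ _ _)))
    rw [zero_eq_neg, zero_eq_neg] at h7
    obtain ⟨z, rfl⟩ := exists_twoRows B
    refine ⟨z, Subtype.ext (Eq.trans ?_ h1.symm)⟩
    rw [h7.1, h7.2.2.2]
    rfl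
  have hrot (a b : Fin k) : (single a b 1 - single b a 1 : Matrix (Fin k) (Fin k) ℝ)ᴴ =
      -(single a b 1 - single b a 1) := by simp
  have hrotX (a b : Fin k) (z : Fin k → ℂ) :
      ⁅K (hrot a b), X z⁆ = X (z b • Pi.single a 1) - X (z a • Pi.single b 1) := by
    rw [hKX (hrot a b), ← map_sub, ← map_neg]
    congr 1
    ext c
    have h (i j : Fin k) : (z ᵥ* (single i j (1 : ℝ)).map Complex.ofReal) c =
        z i * (Pi.single j 1 : Fin k → ℂ) c := by
      simp [vecMul, dotProduct, single_apply, Pi.single_apply, ite_and,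
        apply_ite Complex.ofReal, eq_comm]
    rw [Pi.neg_apply, Matrix.map_sub _ (by simp), vecMul_sub, Pi.sub_apply, h, h]
    simp
  have i : Fin k := ⟨0, by lia⟩
  refine exists_isHermitianPair_of_matrix Z (fun x ↦ Subtype.ext ?_) ⟨X (Pi.single i 1), fun h ↦ ?_⟩
    (fun x hx ↦ ?_) (fun x hx ↦ ?_) (fun x hx ↦ ?_)
    (irreducible_of_parametrization X hZX hp' (Pi.single i 1) (fun v hv ↦ ⟨v i, ?_⟩)
      (fun W hW0 hW ↦ ?_))
  · obtain ⟨A, B, C, D, h1, h2, -⟩ := hmem x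
    change ⁅Z.1, ⁅Z.1, ⁅Z.1, x.1⁆⁆⁆ = -⁅Z.1, x.1⁆
    rw [h1, hZ h2, hZ (by simp), hZ (by simp), fromBlocks_neg, hJ]
    simp only [Matrix.neg_mul, hJ']
    simp
  · rw [hZX] at h
    simpa using congrFun (hX0 h) i
  · obtain ⟨A, D, h1, h2, h3⟩ := hk' x hx
    rw [h1, fromBlocks_conjTranspose, h2, h3, fromBlocks_neg]
    simp
  · obtain ⟨B, rfl⟩ := hp' x hx
    change (fromBlocks 0 (twoRows B) _ 0)ᴴ = fromBlocks 0 (twoRows B) _ 0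
    rw [fromBlocks_conjTranspose]
    simp
  · obtain ⟨A, D, h1, h3, h4⟩ := hk' x (by rw [← lie_skew, hx, neg_zero])
    have : Nonempty (Fin k) := ⟨i⟩
    obtain ⟨c, rfl, rfl⟩ := eq_smul_one_of_mul_eq_mul (A := A) (D := D) fun B ↦ by
      obtain ⟨z, rfl⟩ := exists_twoRows B
      have h5 := congrArg Subtype.val (hx (X z))
      rw [LieSubalgebra.coe_bracket, h1] at h5
      have h6 := (lie_fromBlocks_offDiag h3 h4 (twoRows z)).symm.trans h5
      exact sub_eq_zero.1 (fromBlocks_inj.1 (h6.trans fromBlocks_zero.symm)).2.1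
    have h5 : c = 0 := by
      have h6 := congrFun (congrFun h3 0) 0
      simp at h6
      linarith
    refine Subtype.ext (h1.trans ?_)
    simp [h5]
  · congr 1
    ext a
    rcases eq_or_ne a i with rfl | ha
    · simp
    obtain ⟨b, hb, hba⟩ : ∃ b, b ≠ i ∧ b ≠ a := by
      by_contra! h
      have h1 : (Finset.univ : Finset (Fin k)) ⊆ {i, a} := fun c _ ↦ by
        by_cases hc : c = i
        · simp [hc]
        · simp [h c hc]
      have h2 := Finset.card_le_card h1
      have h3 := Finset.card_le_two (a := i) (b := a)
      rw [Finset.card_univ, Fintype.card_fin] at h2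
      lia
    have h1 := hv _ (hZK (hrot b a)) (by simp [hrotX, ha, hb])
    rw [hrotX, ← map_sub] at h1
    simpa [ha, hba] using congrFun (hX0 h1) b
  · have he (a : Fin k) : X (Pi.single a 1) ∈ W := by
      rcases eq_or_ne a i with rfl | ha
      · exact hW0
      · simpa [hrotX, ha] using hW _ (hZK (hrot a i)) _ hW0
    intro z
    have h1 : z = ∑ a, ((z a).re • (Pi.single a 1 : Fin k → ℂ)
        + (z a).im • (Complex.I • Pi.single a 1)) := by
      ext b
      simp [Finset.sum_apply, Pi.single_apply, Finset.sum_add_distrib]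
    rw [h1, map_sum]
    refine W.sum_mem fun a _ ↦ ?_
    rw [map_add, map_smul, map_smul, ← hZX]
    exact W.add_mem (W.smul_mem _ (he a)) (W.smul_mem _ (hW Z (lie_self Z) _ (he a)))

end RealOrthogonal

noncomputable section MinusculeWeights

/-- The quadratic form `-x₀² + x₁² + … + xₙ²`. -/
def lorentz (n : ℕ) (R : Type*) [CommRing R] :
    (Fin (n + 1) → R) →ₗ[R] (Fin (n + 1) → R) →ₗ[R] R :=
  LinearMap.mk₂ R (fun u v ↦ ∑ i : Fin n, u i.succ * v i.succ - u 0 * v 0)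
    (fun u v w ↦ by simp [add_mul, Finset.sum_add_distrib]; ring)
    (fun c u v ↦ by simp [mul_sub, Finset.mul_sum, mul_assoc])
    (fun u v w ↦ by simp [mul_add, Finset.sum_add_distrib]; ring)
    (fun c u v ↦ by simp [mul_sub, Finset.mul_sum, mul_left_comm])

/-- The canonical class. -/
def canonicalClass (n : ℕ) (R : Type*) [CommRing R] : Fin (n + 1) → R := Fin.cons (-3) fun _ ↦ -1

section

variable {n : ℕ} {R : Type*} [CommRing R]

theorem lorentz_apply (u v : Fin (n + 1) → R) :
    lorentz n R u v = ∑ i : Fin n, u i.succ * v i.succ - u 0 * v 0 := rfl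

theorem lorentz_comm (u v : Fin (n + 1) → R) : lorentz n R u v = lorentz n R v u := by
  simp [lorentz_apply, mul_comm]

theorem lorentz_canonicalClass (v : Fin (n + 1) → R) :
    lorentz n R (canonicalClass n R) v = 3 * v 0 - ∑ i : Fin n, v i.succ := by
  simp [lorentz_apply, canonicalClass]
  ring

theorem lorentz_single_succ (v : Fin (n + 1) → R) (i : Fin n) :
    lorentz n R v (Pi.single i.succ 1) = v i.succ := by
  simp [lorentz_apply, Pi.single_apply, (Fin.succ_ne_zero _).symm]

theorem lorentz_single_of_ne_zero (v : Fin (n + 1) → R) {j : Fin (n + 1)} (hj : j ≠ 0) :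
    lorentz n R v (Pi.single j 1) = v j := by
  obtain ⟨i, rfl⟩ := Fin.exists_succ_eq.2 hj
  exact lorentz_single_succ v i

theorem lorentz_intCast (u v : Fin (n + 1) → ℤ) :
    lorentz n R (fun j ↦ (u j : R)) (fun j ↦ (v j : R)) = (lorentz n ℤ u v : R) := by
  simp [lorentz_apply]

theorem canonicalClass_intCast :
    (fun j ↦ ((canonicalClass n ℤ j : ℤ) : R)) = canonicalClass n R := by
  ext j
  refine Fin.cases ?_ (fun i ↦ ?_) j <;> simp [canonicalClass]

end

variable {n : ℕ}

theorem sq_sum_le_mul_sum_sq (v : Fin (n + 1) → ℤ) :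
    (∑ i : Fin n, v i.succ) ^ 2 ≤ n * ∑ i : Fin n, v i.succ ^ 2 := by
  simpa using sq_sum_le_card_mul_sum_sq (s := Finset.univ) (f := fun i : Fin n ↦ v i.succ)

theorem lorentz_self (v : Fin (n + 1) → ℤ) :
    lorentz n ℤ v v = ∑ i : Fin n, v i.succ ^ 2 - v 0 ^ 2 := by
  simp [lorentz_apply, sq]

theorem canonicalClass_inequality (hn : 0 < n) (hn' : n ≤ 9) (v : Fin (n + 1) → ℤ) :
    0 ≤ (9 - n) * lorentz n ℤ v v + lorentz n ℤ (canonicalClass n ℤ) v ^ 2 := by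
  have h1 := sq_sum_le_mul_sum_sq v
  rw [lorentz_canonicalClass, lorentz_self]
  set P := ∑ i : Fin n, v i.succ
  set Q := ∑ i : Fin n, v i.succ ^ 2
  have h2 : (0 : ℤ) < n := by exact_mod_cast hn
  have h3 : (0 : ℤ) ≤ 9 - n := by lia
  refine nonneg_of_mul_nonneg_right (a := (n : ℤ)) ?_ h2
  have h4 := mul_nonneg h3 (sub_nonneg.2 h1)
  nlinarith [sq_nonneg (n * v 0 - 3 * P)]

theorem eq_zero_of_lorentz_self_nonpos (hn : n ≤ 8) {v : Fin (n + 1) → ℤ}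
    (hv : lorentz n ℤ (canonicalClass n ℤ) v = 0) (h : lorentz n ℤ v v ≤ 0) : v = 0 := by
  have h1 := sq_sum_le_mul_sum_sq v
  rw [lorentz_canonicalClass] at hv
  rw [lorentz_self] at h
  have h2 : ∑ i : Fin n, v i.succ = 3 * v 0 := by linarith
  rw [h2] at h1
  have hn' : (n : ℤ) ≤ 8 := by exact_mod_cast hn
  have hQ : 0 ≤ ∑ i : Fin n, v i.succ ^ 2 := Finset.sum_nonneg fun i _ ↦ sq_nonneg _
  have h3 : v 0 ^ 2 ≤ 0 := by nlinarith [mul_le_mul_of_nonneg_right hn' hQ]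
  have h4 : v 0 = 0 := by nlinarith
  have h5 : ∑ i : Fin n, v i.succ ^ 2 = 0 := by
    rw [h4] at h
    linarith
  rw [Finset.sum_eq_zero_iff_of_nonneg fun i _ ↦ sq_nonneg _] at h5
  ext j
  refine Fin.cases h4 (fun i ↦ ?_) j
  simpa using h5 i (Finset.mem_univ _)

/-- The bounds on the coordinates in the definition of `minusculeWeights` are automatic. -/
theorem mem_minusculeWeights_iff (hn : n ≤ 7) {v : Fin (n + 1) → ℤ} :
    v ∈ minusculeWeights n ↔
      lorentz n ℤ v v = 1 ∧ lorentz n ℤ (canonicalClass n ℤ) v = 1 := by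
  rw [minusculeWeights, Finset.mem_filter, Fintype.mem_piFinset, lorentz_canonicalClass,
    lorentz_self]
  refine ⟨fun ⟨_, h1, h2⟩ ↦ ⟨by linarith, h2⟩, fun ⟨h1, h2⟩ ↦ ⟨fun j ↦ ?_, by linarith, h2⟩⟩
  have hn' : (n : ℤ) ≤ 7 := by exact_mod_cast hn
  have hQ : ∑ i : Fin n, v i.succ ^ 2 = v 0 ^ 2 + 1 := by linarith
  have hP : ∑ i : Fin n, v i.succ = 3 * v 0 - 1 := by linarith
  have h3 := sq_sum_le_mul_sum_sq v
  rw [hQ, hP] at h3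
  have h4 : (n : ℤ) * (v 0 ^ 2 + 1) ≤ 7 * (v 0 ^ 2 + 1) :=
    mul_le_mul_of_nonneg_right hn' (by positivity)
  have h5 : 0 ≤ v 0 := by nlinarith
  have h6 : v 0 ≤ 3 := by nlinarith
  rw [Finset.mem_Icc]
  refine Fin.cases ⟨by linarith, h6⟩ (fun i ↦ ?_) j
  rw [← Finset.add_sum_erase _ _ (Finset.mem_univ i)] at hP hQ
  have h7 := sq_sum_le_card_mul_sum_sq (s := Finset.univ.erase i) (f := fun i : Fin n ↦ v i.succ)
  have h8 : 0 ≤ ∑ j ∈ Finset.univ.erase i, v j.succ ^ 2 :=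
    Finset.sum_nonneg fun i _ ↦ sq_nonneg _
  have h9 : ((Finset.univ.erase i).card : ℤ) ≤ 6 := by
    rw [Finset.card_erase_of_mem (Finset.mem_univ i), Finset.card_univ, Fintype.card_fin]
    lia
  have h10 := h7.trans (mul_le_mul_of_nonneg_right h9 h8)
  generalize ∑ j ∈ Finset.univ.erase i, v j.succ ^ 2 = Q at *
  generalize ∑ j ∈ Finset.univ.erase i, v j.succ = P at *
  generalize v i.succ = a at *
  have hQ' : Q = v 0 ^ 2 + 1 - a ^ 2 := by linarith
  have hP' : P = 3 * v 0 - 1 - a := by linarith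
  rw [hQ', hP'] at h10
  constructor
  · by_contra! h
    nlinarith
  · nlinarith

section Roots

variable {α β v : Fin (n + 1) → ℤ}

/-- The classes of square `-2` orthogonal to the canonical class. -/
def IsDelPezzoRoot (α : Fin (n + 1) → ℤ) : Prop :=
  lorentz n ℤ α α = 2 ∧ lorentz n ℤ (canonicalClass n ℤ) α = 0

theorem IsDelPezzoRoot.neg (hα : IsDelPezzoRoot α) : IsDelPezzoRoot (-α) := by
  simpa [IsDelPezzoRoot] using hα

variable (hn : n ≤ 7)
include hn

theorem add_mem_minusculeWeights_iff (hα : IsDelPezzoRoot α) (hv : v ∈ minusculeWeights n) :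
    v + α ∈ minusculeWeights n ↔ lorentz n ℤ v α = -1 := by
  rw [mem_minusculeWeights_iff hn] at hv ⊢
  simp only [map_add, LinearMap.add_apply, hv.1, hv.2, hα.1, hα.2, lorentz_comm α v]
  constructor
  · rintro ⟨h, -⟩
    linarith
  · intro h
    rw [h]
    norm_num

theorem sub_mem_minusculeWeights_iff (hα : IsDelPezzoRoot α) (hv : v ∈ minusculeWeights n) :
    v - α ∈ minusculeWeights n ↔ lorentz n ℤ v α = 1 := by
  rw [sub_eq_add_neg, add_mem_minusculeWeights_iff hn hα.neg hv, map_neg, neg_inj]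

theorem abs_lorentz_le_one (hn0 : 0 < n) (hα : IsDelPezzoRoot α) (hv : v ∈ minusculeWeights n) :
    lorentz n ℤ v α = -1 ∨ lorentz n ℤ v α = 0 ∨ lorentz n ℤ v α = 1 := by
  rw [mem_minusculeWeights_iff hn] at hv
  have h1 := canonicalClass_inequality hn0 (by lia)
    ((2 : ℤ) • v - (lorentz n ℤ v α) • α)
  simp only [map_sub, map_smul, LinearMap.sub_apply, LinearMap.smul_apply, smul_eq_mul, hv.1, hv.2,
    hα.1, hα.2, lorentz_comm α v] at h1
  generalize lorentz n ℤ v α = k at *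
  have hn' : (2 : ℤ) ≤ 9 - n := by lia
  have h2 : k ^ 2 < 4 := by
    by_contra! h
    nlinarith
  have h3 : k < 2 := by nlinarith
  have h4 : -2 < k := by nlinarith
  lia

theorem neg_single_mem_minusculeWeights (i : Fin n) :
    -Pi.single i.succ 1 ∈ minusculeWeights n := by
  rw [mem_minusculeWeights_iff hn]
  simp [map_neg, lorentz_single_succ, canonicalClass]

theorem reflection_mem_minusculeWeights (hn0 : 0 < n) (hα : IsDelPezzoRoot α)
    (hv : v ∈ minusculeWeights n) : v - lorentz n ℤ v α • α ∈ minusculeWeights n := by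
  rcases abs_lorentz_le_one hn hn0 hα hv with h | h | h
  · rw [h, neg_one_smul, sub_neg_eq_add, add_mem_minusculeWeights_iff hn hα hv, h]
  · rwa [h, zero_smul, sub_zero]
  · rw [h, one_smul, sub_mem_minusculeWeights_iff hn hα hv, h]

end Roots

end MinusculeWeights

section TriangularDecomposition

variable {R 𝔤 : Type*} [CommRing R] [LieRing 𝔤] [LieAlgebra R 𝔤]

/-- An element of the Lie algebra generated by `s` lies in any submodule that contains `s` and is
stable under bracketing with `s`. -/
theorem mem_of_mem_lieSpan_of_stable {s : Set 𝔤} {V : Submodule R 𝔤} (hs : s ⊆ V)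
    (h : ∀ a ∈ s, ∀ v ∈ V, ⁅a, v⁆ ∈ V) {x : 𝔤} (hx : x ∈ LieSubalgebra.lieSpan R 𝔤 s) : x ∈ V := by
  suffices x ∈ V ∧ ∀ v ∈ V, ⁅x, v⁆ ∈ V from this.1
  induction hx using LieSubalgebra.lieSpan_induction with
  | mem a ha => exact ⟨hs ha, h a ha⟩
  | zero => exact ⟨V.zero_mem, fun v _ ↦ by simp⟩
  | smul c x _ hx =>
    exact ⟨V.smul_mem c hx.1, fun v hv ↦ by rw [smul_lie]; exact V.smul_mem c (hx.2 v hv)⟩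
  | add x y _ _ hx hy =>
    exact ⟨V.add_mem hx.1 hy.1, fun v hv ↦ by
      rw [add_lie]; exact V.add_mem (hx.2 v hv) (hy.2 v hv)⟩
  | lie x y _ _ hx hy =>
    exact ⟨hx.2 y hy.1, fun v hv ↦ by
      rw [lie_lie]; exact V.sub_mem (hx.2 _ (hy.2 v hv)) (hy.2 _ (hx.2 v hv))⟩

theorem lie_mem_sup_lieSpan {H : Submodule R 𝔤} {s : Set 𝔤}
    (hH : ∀ h ∈ H, ∀ a ∈ s, ⁅h, a⁆ ∈ LieSubalgebra.lieSpan R 𝔤 s) {e : 𝔤}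
    (he : ∀ a ∈ s, ⁅e, a⁆ ∈ H) {y : 𝔤} (hy : y ∈ LieSubalgebra.lieSpan R 𝔤 s) :
    (∀ h ∈ H, ⁅h, y⁆ ∈ LieSubalgebra.lieSpan R 𝔤 s) ∧
      ⁅e, y⁆ ∈ H ⊔ (LieSubalgebra.lieSpan R 𝔤 s).toSubmodule := by
  set N := LieSubalgebra.lieSpan R 𝔤 s with hN
  induction hy using LieSubalgebra.lieSpan_induction with
  | mem a ha => exact ⟨fun h hh ↦ hH h hh a ha, Submodule.mem_sup_left (he a ha)⟩
  | zero => simp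
  | smul c x _ hx =>
    refine ⟨fun h hh ↦ ?_, ?_⟩
    · rw [lie_smul]
      exact N.smul_mem c (hx.1 h hh)
    · rw [lie_smul]
      exact Submodule.smul_mem _ c hx.2
  | add x y _ _ hx hy =>
    refine ⟨fun h hh ↦ ?_, ?_⟩
    · rw [lie_add]
      exact N.add_mem (hx.1 h hh) (hy.1 h hh)
    · rw [lie_add]
      exact Submodule.add_mem _ hx.2 hy.2
  | lie x y hx' hy' hx hy =>
    refine ⟨fun h hh ↦ ?_, ?_⟩
    · rw [leibniz_lie]
      exact N.add_mem (N.lie_mem (hx.1 h hh) hy') (N.lie_mem hx' (hy.1 h hh))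
    · have key {x y : 𝔤} (hx : ⁅e, x⁆ ∈ H ⊔ N.toSubmodule)
          (hy : y ∈ N) (hy' : ∀ h ∈ H, ⁅h, y⁆ ∈ N) : ⁅⁅e, x⁆, y⁆ ∈ N := by
        obtain ⟨h, hh, z, hz, hhz⟩ := Submodule.mem_sup.1 hx
        rw [← hhz, add_lie]
        exact N.add_mem (hy' h hh) (N.lie_mem hz hy)
      rw [leibniz_lie]
      refine Submodule.mem_sup_right (N.add_mem (key hx.2 hy' hy.1) ?_)
      rw [← lie_skew]
      exact N.neg_mem (key hy.2 hx' hx.1)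

theorem lieSpan_union_le {H : Submodule R 𝔤} {s t : Set 𝔤}
    (hs : ∀ h ∈ H, ∀ a ∈ s, ⁅h, a⁆ ∈ LieSubalgebra.lieSpan R 𝔤 s)
    (ht : ∀ h ∈ H, ∀ a ∈ t, ⁅h, a⁆ ∈ LieSubalgebra.lieSpan R 𝔤 t)
    (hst : ∀ a ∈ s, ∀ b ∈ t, ⁅a, b⁆ ∈ H) :
    (LieSubalgebra.lieSpan R 𝔤 (s ∪ t)).toSubmodule ≤
      (LieSubalgebra.lieSpan R 𝔤 s).toSubmodule ⊔ (H ⊔ (LieSubalgebra.lieSpan R 𝔤 t).toSubmodule) := by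
  have hts (b : 𝔤) (hb : b ∈ t) (a : 𝔤) (ha : a ∈ s) : ⁅b, a⁆ ∈ H := by
    rw [← lie_skew]
    exact H.neg_mem (hst a ha b hb)
  intro x hx
  refine mem_of_mem_lieSpan_of_stable ?_ ?_ hx
  · rintro a (ha | ha)
    · exact Submodule.mem_sup_left (LieSubalgebra.subset_lieSpan ha)
    · exact Submodule.mem_sup_right (Submodule.mem_sup_right (LieSubalgebra.subset_lieSpan ha))
  · intro a ha v hv
    obtain ⟨y, hy, w, hw, rfl⟩ := Submodule.mem_sup.1 hv
    obtain ⟨h, hh, z, hz, rfl⟩ := Submodule.mem_sup.1 hw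
    rw [lie_add, lie_add]
    rcases ha with ha | ha
    · have ha' := LieSubalgebra.subset_lieSpan (R := R) ha
      refine Submodule.add_mem _ (Submodule.mem_sup_left (LieSubalgebra.lie_mem _ ha' hy))
        (Submodule.add_mem _ (Submodule.mem_sup_left ?_)
          (Submodule.mem_sup_right (lie_mem_sup_lieSpan ht (hst a ha) hz).2))
      rw [← lie_skew]
      exact Submodule.neg_mem _ (hs h hh a ha)
    · have ha' := LieSubalgebra.subset_lieSpan (R := R) ha
      have h1 := (lie_mem_sup_lieSpan hs (hts a ha) hy).2
      refine Submodule.add_mem _ ?_ (Submodule.add_mem _ (Submodule.mem_sup_right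
        (Submodule.mem_sup_right ?_)) (Submodule.mem_sup_right (Submodule.mem_sup_right
          (LieSubalgebra.lie_mem _ ha' hz))))
      · exact (sup_le (le_sup_left.trans le_sup_right) le_sup_left :
          H ⊔ (LieSubalgebra.lieSpan R 𝔤 s).toSubmodule ≤ _) h1
      · rw [← lie_skew]
        exact Submodule.neg_mem _ (ht h hh a ha)

end TriangularDecomposition

noncomputable section WeightShifts

open Matrix

variable {n : ℕ}

/-- The diagonal matrix of the values of a linear form on the weights. -/
def torus (n : ℕ) : (Fin (n + 1) → ℂ) →ₗ[ℂ] Matrix (minusculeWeights n) (minusculeWeights n) ℂ where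
  toFun γ := diagonal fun u ↦ lorentz n ℂ (fun j ↦ (u.1 j : ℂ)) γ
  map_add' γ δ := by simp [diagonal_add]
  map_smul' c γ := by
    rw [← diagonal_smul]
    congr 1
    ext u
    simp

theorem torus_apply_self (γ : Fin (n + 1) → ℂ) (u : minusculeWeights n) :
    torus n γ u u = lorentz n ℂ (fun j ↦ (u.1 j : ℂ)) γ := diagonal_apply_eq _ _

theorem torus_lie_apply (γ : Fin (n + 1) → ℂ)
    (A : Matrix (minusculeWeights n) (minusculeWeights n) ℂ) (u v : minusculeWeights n) :
    ⁅torus n γ, A⁆ u v = lorentz n ℂ (fun j ↦ ((u.1 j - v.1 j : ℤ) : ℂ)) γ * A u v := by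
  rw [Ring.lie_def, Matrix.sub_apply, torus, LinearMap.coe_mk, AddHom.coe_mk, diagonal_mul,
    mul_diagonal, mul_comm (A u v), ← sub_mul, ← LinearMap.sub_apply, ← map_sub]
  congr 4
  ext j
  simp

/-- The matrices whose entry at `(u, v)` vanishes unless `u - v = β`. -/
def HasDegree (A : Matrix (minusculeWeights n) (minusculeWeights n) ℂ) (β : Fin (n + 1) → ℤ) :
    Prop := ∀ u v, A u v ≠ 0 → u.1 - v.1 = β

theorem hasDegree_weightShift (α : Fin (n + 1) → ℤ) : HasDegree (weightShift n α) α := by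
  intro u v h
  rw [weightShift, of_apply, ne_eq, ite_eq_right_iff, not_forall] at h
  obtain ⟨h, -⟩ := h
  rw [h, add_sub_cancel_left]

theorem HasDegree.torus_lie {A : Matrix (minusculeWeights n) (minusculeWeights n) ℂ}
    {β : Fin (n + 1) → ℤ} (hA : HasDegree A β) (γ : Fin (n + 1) → ℂ) :
    ⁅torus n γ, A⁆ = lorentz n ℂ (fun j ↦ (β j : ℂ)) γ • A := by
  ext u v
  rw [torus_lie_apply, Matrix.smul_apply, smul_eq_mul]
  by_cases h : A u v = 0
  · rw [h, mul_zero, mul_zero]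
  · rw [← hA u v h]
    rfl

variable {α β : Fin (n + 1) → ℤ} (hn : n ≤ 7)
include hn

theorem lie_weightShift_neg (hn0 : 0 < n) (hα : IsDelPezzoRoot α) :
    ⁅weightShift n α, weightShift n (-α)⁆ = torus n fun j ↦ (α j : ℂ) := by
  have key {γ : Fin (n + 1) → ℤ} (u v : minusculeWeights n) :
      (weightShift n γ * weightShift n (-γ)) u v =
        if u = v then (if u.1 - γ ∈ minusculeWeights n then 1 else 0) else 0 := by
    rw [Matrix.mul_apply]
    simp only [weightShift, of_apply, mul_ite, mul_one, mul_zero]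
    split_ifs with h1 h2
    · subst h1
      rw [Finset.sum_eq_single ⟨u.1 - γ, h2⟩]
      · simp [sub_eq_add_neg]
      · intro w _ hw
        rw [if_neg]
        intro h
        exact hw (Subtype.ext (h.trans (sub_eq_add_neg _ _).symm))
      · simp
    · refine Finset.sum_eq_zero fun w _ ↦ ?_
      rw [if_neg]
      intro h
      subst h1
      refine h2 ?_
      rw [sub_eq_add_neg, ← h]
      exact w.2
    · refine Finset.sum_eq_zero fun w _ ↦ ?_
      split_ifs with h3 h4
      · exact absurd (Subtype.ext (by rw [h4, h3]; abel)) h1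
      · rfl
      · rfl
  ext u v
  have h1 := key (γ := α) u v
  have h2 := key (γ := -α) u v
  rw [neg_neg, sub_neg_eq_add] at h2
  rw [Ring.lie_def, Matrix.sub_apply, h1, h2, torus, LinearMap.coe_mk, AddHom.coe_mk,
    diagonal_apply, lorentz_intCast]
  split_ifs with h3 h4 h5 h5
  · rw [sub_mem_minusculeWeights_iff hn hα u.2] at h4
    rw [add_mem_minusculeWeights_iff hn hα u.2] at h5
    lia
  · rw [sub_mem_minusculeWeights_iff hn hα u.2] at h4
    simp [h4]
  · rw [add_mem_minusculeWeights_iff hn hα u.2] at h5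
    simp [h5]
  · rw [sub_mem_minusculeWeights_iff hn hα u.2] at h4
    rw [add_mem_minusculeWeights_iff hn hα u.2] at h5
    simp [((abs_lorentz_le_one hn hn0 hα u.2).resolve_left h5).resolve_right h4]
  · simp

theorem lie_weightShift_neg_of_ne (hn0 : 0 < n) (hα : IsDelPezzoRoot α) (hβ : IsDelPezzoRoot β)
    (h : lorentz n ℤ α β ≤ 0) : ⁅weightShift n α, weightShift n (-β)⁆ = 0 := by
  ext u v
  rw [Ring.lie_def, Matrix.sub_apply, Matrix.mul_apply, Matrix.mul_apply, Matrix.zero_apply]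
  simp only [weightShift, of_apply, mul_ite, mul_one, mul_zero]
  by_cases huv : u.1 = v.1 + α - β
  · have hu := ((mem_minusculeWeights_iff hn).1 u.2).1
    have hv := ((mem_minusculeWeights_iff hn).1 v.2).1
    rw [huv] at hu
    simp only [map_add, map_sub, LinearMap.add_apply, LinearMap.sub_apply, hv, hα.1, hβ.1,
      lorentz_comm α v.1, lorentz_comm β v.1, lorentz_comm β α] at hu
    have h1 := abs_lorentz_le_one hn hn0 hα v.2
    have h2 := abs_lorentz_le_one hn hn0 hβ v.2
    have h3 : v.1 - β ∈ minusculeWeights n := by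
      rw [sub_mem_minusculeWeights_iff hn hβ v.2]
      lia
    have h4 : v.1 + α ∈ minusculeWeights n := by
      rw [add_mem_minusculeWeights_iff hn hα v.2]
      lia
    rw [Finset.sum_eq_single ⟨v.1 - β, h3⟩, Finset.sum_eq_single ⟨v.1 + α, h4⟩]
    · simp [huv, sub_eq_add_neg, add_right_comm]
    · intro w _ hw
      rw [if_neg]
      exact fun h ↦ hw (Subtype.ext h)
    · simp
    · intro w _ hw
      rw [if_neg]
      exact fun h ↦ hw (Subtype.ext (h.trans (sub_eq_add_neg _ _).symm))
    · simp
  · rw [Finset.sum_eq_zero, Finset.sum_eq_zero, sub_zero]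
    · intro w _
      split_ifs with h1 h2
      · exact absurd (by rw [h2, h1, sub_eq_add_neg]) huv
      · rfl
      · rfl
    · intro w _
      split_ifs with h1 h2
      · exact absurd (by rw [h2, h1]; abel) huv
      · rfl
      · rfl

end WeightShifts

noncomputable section SimpleRoots

variable {n : ℕ}

section

variable {R : Type*} [CommRing R]

theorem lorentz_firstRoot (hn : 3 ≤ n) (v : Fin (n + 1) → R) :
    lorentz n R v (fun j ↦ if j.val ≤ 3 then 1 else 0) =
      v ⟨1, by lia⟩ + v ⟨2, by lia⟩ + v ⟨3, by lia⟩ - v 0 := by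
  obtain ⟨m, rfl⟩ := Nat.exists_eq_add_of_le' hn
  rw [lorentz_apply, Fin.sum_univ_succ, Fin.sum_univ_succ, Fin.sum_univ_succ, Finset.sum_eq_zero]
  · simp [add_assoc]
    rfl
  · intro i _
    simp

theorem lorentz_stepRoot (v : Fin (n + 1) → R) {i j : Fin (n + 1)} (hi : 1 ≤ i.val)
    (hj : j.val = i.val + 1) :
    lorentz n R v (Pi.single j 1 - Pi.single i 1) = v j - v i := by
  rw [map_sub, lorentz_single_of_ne_zero, lorentz_single_of_ne_zero]
  · rintro rfl
    simp at hi
  · rintro rfl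
    simp at hj

theorem canonicalClass_of_ne_zero {j : Fin (n + 1)} (hj : j ≠ 0) : canonicalClass n R j = -1 := by
  obtain ⟨i, rfl⟩ := Fin.exists_succ_eq.2 hj
  rfl

end

theorem isDelPezzoRoot_of_mem_simpleRoots (hn : 3 ≤ n) {α : Fin (n + 1) → ℤ}
    (hα : α ∈ simpleRoots n) : IsDelPezzoRoot α := by
  rcases hα with rfl | ⟨i, j, hi, hj, rfl⟩
  · rw [IsDelPezzoRoot, lorentz_firstRoot hn, lorentz_firstRoot hn]
    refine ⟨by simp, ?_⟩
    rw [canonicalClass_of_ne_zero (by simp [Fin.ext_iff]),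
      canonicalClass_of_ne_zero (by simp [Fin.ext_iff]),
      canonicalClass_of_ne_zero (by simp [Fin.ext_iff])]
    simp [canonicalClass]
  · have hi0 : i ≠ 0 := by rintro rfl; simp at hi
    have hj0 : j ≠ 0 := by rintro rfl; simp at hj
    have hij : i ≠ j := by rintro rfl; simp at hj
    rw [IsDelPezzoRoot, lorentz_stepRoot _ hi hj, lorentz_stepRoot _ hi hj,
      canonicalClass_of_ne_zero hi0, canonicalClass_of_ne_zero hj0]
    simp [hij, hij.symm]

theorem lorentz_nonpos_of_ne {α β : Fin (n + 1) → ℤ} (hα : α ∈ simpleRoots n)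
    (hβ : β ∈ simpleRoots n) (h : α ≠ β) : lorentz n ℤ α β ≤ 0 := by
  have key {i j : Fin (n + 1)} (hi : 1 ≤ i.val) (hj : j.val = i.val + 1) :
      lorentz n ℤ (fun j ↦ if j.val ≤ 3 then 1 else 0) (Pi.single j 1 - Pi.single i 1) ≤ 0 := by
    rw [lorentz_stepRoot _ hi hj]
    split_ifs <;> lia
  rcases hα with rfl | ⟨i, j, hi, hj, rfl⟩
  · rcases hβ with rfl | ⟨i', j', hi', hj', rfl⟩
    · exact absurd rfl h
    · exact key hi' hj'
  · rcases hβ with rfl | ⟨i', j', hi', hj', rfl⟩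
    · rw [lorentz_comm]
      exact key hi hj
    · rw [lorentz_stepRoot _ hi' hj']
      have hii : i ≠ i' := by
        rintro rfl
        exact h (by rw [Fin.ext (hj.trans hj'.symm)])
      simp only [Pi.sub_apply, Pi.single_apply, Fin.ext_iff] at hii ⊢
      split_ifs <;> lia

/-- The height function, as the pairing with this vector. -/
def heightVector (n : ℕ) : Fin (n + 1) → ℤ := fun j ↦ if j = 0 then 5 else j.val

theorem lorentz_heightVector_pos (hn : 3 ≤ n) {α : Fin (n + 1) → ℤ} (hα : α ∈ simpleRoots n) :
    0 < lorentz n ℤ (heightVector n) α := by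
  rcases hα with rfl | ⟨i, j, hi, hj, rfl⟩
  · rw [lorentz_firstRoot hn]
    simp [heightVector, Fin.ext_iff]
  · rw [lorentz_stepRoot _ hi hj]
    have h1 : i ≠ 0 := by rintro rfl; simp at hi
    have h2 : j ≠ 0 := by rintro rfl; simp at hj
    simp [heightVector, h1, h2, hj]

theorem firstRoot_intCast :
    (fun j : Fin (n + 1) ↦ (((if j.val ≤ 3 then 1 else 0 : ℤ)) : ℂ)) =
      fun j ↦ if j.val ≤ 3 then 1 else 0 := by
  ext j
  split_ifs <;> simp

theorem stepRoot_intCast (i j : Fin (n + 1)) :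
    (fun k ↦ (((Pi.single j 1 - Pi.single i 1 : Fin (n + 1) → ℤ) k : ℤ) : ℂ)) =
      Pi.single j 1 - Pi.single i 1 := by
  ext k
  simp [Pi.single_apply]

/-- A vector orthogonal to the simple roots and to the canonical class is zero. -/
theorem eq_zero_of_orthogonal_simpleRoots (hn : 3 ≤ n) (hn' : n ≠ 9) {γ : Fin (n + 1) → ℂ}
    (hγ : lorentz n ℂ (canonicalClass n ℂ) γ = 0)
    (h : ∀ α ∈ simpleRoots n, lorentz n ℂ γ (fun j ↦ (α j : ℂ)) = 0) : γ = 0 := by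
  have h1 (k : ℕ) (hk : k + 1 < n + 1) : γ ⟨k + 1, hk⟩ = γ ⟨1, by lia⟩ := by
    induction k with
    | zero => rfl
    | succ k ih =>
      have h2 := h _ (Or.inr ⟨⟨k + 1, by lia⟩, ⟨k + 1 + 1, hk⟩, by simp, rfl, rfl⟩)
      rw [stepRoot_intCast, lorentz_stepRoot _ (by simp) rfl, sub_eq_zero] at h2
      rw [h2, ih]
  have h2 := h _ (Or.inl rfl)
  rw [firstRoot_intCast, lorentz_firstRoot hn, h1 1, h1 2] at h2
  have h3 (i : Fin n) : γ i.succ = γ ⟨1, by lia⟩ := h1 i.val (by lia)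
  rw [lorentz_canonicalClass] at hγ
  simp only [h3, Finset.sum_const, Finset.card_univ, Fintype.card_fin, nsmul_eq_mul] at hγ
  have h4 : ((9 : ℂ) - n) ≠ 0 := by
    rw [sub_ne_zero]
    exact_mod_cast hn'.symm
  have h5 : γ ⟨1, by lia⟩ = 0 := by
    refine (mul_eq_zero.1 (?_ : ((9 : ℂ) - n) * _ = 0)).resolve_left h4
    linear_combination 3 * h2 + hγ
  have h6 : γ 0 = 0 := by
    rw [h5] at h2
    linear_combination -h2
  ext j
  refine Fin.cases h6 (fun i ↦ ?_) j
  rw [h3, h5]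
  rfl

/-- The simple roots span the orthogonal complement of the canonical class. -/
theorem mem_of_simpleRoots_mem (hn : 3 ≤ n) {V : Submodule ℂ (Fin (n + 1) → ℂ)}
    (h : ∀ α ∈ simpleRoots n, (fun j ↦ (α j : ℂ)) ∈ V) {γ : Fin (n + 1) → ℂ}
    (hγ : lorentz n ℂ (canonicalClass n ℂ) γ = 0) : γ ∈ V := by
  set e : Fin (n + 1) → ℂ := Pi.single ⟨1, by lia⟩ 1 with he
  have h1 (k : ℕ) (hk : k + 1 < n + 1) : Pi.single ⟨k + 1, hk⟩ 1 - e ∈ V := by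
    induction k with
    | zero => simp [he]
    | succ k ih =>
      have h2 := h _ (Or.inr ⟨⟨k + 1, by lia⟩, ⟨k + 1 + 1, hk⟩, by simp, rfl, rfl⟩)
      rw [stepRoot_intCast] at h2
      simpa using V.add_mem h2 (ih (by lia))
  have h2 := h _ (Or.inl rfl)
  rw [firstRoot_intCast] at h2
  set α : Fin (n + 1) → ℂ := fun j ↦ if j.val ≤ 3 then 1 else 0 with hα
  let c (i : Fin n) : ℂ := γ i.succ - γ 0 * α i.succ
  have hc : ∑ i, c i = 0 := by
    have h3 : lorentz n ℂ (canonicalClass n ℂ) α = _ := lorentz_firstRoot hn _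
    rw [canonicalClass_of_ne_zero (by simp [Fin.ext_iff]),
      canonicalClass_of_ne_zero (by simp [Fin.ext_iff]),
      canonicalClass_of_ne_zero (by simp [Fin.ext_iff]), lorentz_canonicalClass] at h3
    rw [lorentz_canonicalClass] at hγ
    have h4 : ∑ i : Fin n, α i.succ = 3 := by
      have h5 : α 0 = 1 := by simp [hα]
      have h6 : canonicalClass n ℂ 0 = -3 := rfl
      rw [h5, h6] at h3
      linear_combination -h3
    rw [Finset.sum_sub_distrib, ← Finset.mul_sum, h4]
    linear_combination -hγ
  have h3 : γ = γ 0 • α + ∑ i : Fin n, c i • (Pi.single i.succ 1 - e) := by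
    simp only [smul_sub]
    rw [Finset.sum_sub_distrib, ← Finset.sum_smul, hc, zero_smul, sub_zero]
    ext j
    refine Fin.cases ?_ (fun i ↦ ?_) j
    · simp [hα, (Fin.succ_ne_zero _).symm]
    · simp [c, Pi.single_apply]
  rw [h3]
  exact V.add_mem (V.smul_mem _ h2) (V.sum_mem fun i _ ↦ V.smul_mem _ (h1 i.val (by lia)))

end SimpleRoots

noncomputable section ExceptionalAlgebra

open Matrix

variable {n : ℕ}

/-- The homogeneous component of degree `β` of a matrix. -/
def degreePart (β : Fin (n + 1) → ℤ) :
    Matrix (minusculeWeights n) (minusculeWeights n) ℂ →ₗ[ℂ]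
      Matrix (minusculeWeights n) (minusculeWeights n) ℂ where
  toFun A := of fun u v ↦ if u.1 - v.1 = β then A u v else 0
  map_add' A B := by ext u v; simp only [of_apply, Matrix.add_apply]; split_ifs <;> simp
  map_smul' c A := by ext u v; simp

theorem degreePart_apply (β : Fin (n + 1) → ℤ)
    (A : Matrix (minusculeWeights n) (minusculeWeights n) ℂ) (u v : minusculeWeights n) :
    degreePart β A u v = if u.1 - v.1 = β then A u v else 0 := rfl

theorem hasDegree_degreePart (β : Fin (n + 1) → ℤ)
    (A : Matrix (minusculeWeights n) (minusculeWeights n) ℂ) : HasDegree (degreePart β A) β := by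
  intro u v h
  rw [degreePart_apply, ne_eq, ite_eq_right_iff, not_forall] at h
  exact h.1

namespace HasDegree

variable {A B : Matrix (minusculeWeights n) (minusculeWeights n) ℂ} {β β' : Fin (n + 1) → ℤ}

theorem mul (hA : HasDegree A β) (hB : HasDegree B β') : HasDegree (A * B) (β + β') := by
  intro u v h
  obtain ⟨w, -, hw⟩ := Finset.exists_ne_zero_of_sum_ne_zero h
  rw [← hA u w (left_ne_zero_of_mul hw), ← hB w v (right_ne_zero_of_mul hw)]
  abel

theorem lie (hA : HasDegree A β) (hB : HasDegree B β') : HasDegree ⁅A, B⁆ (β + β') := by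
  intro u v h
  rw [Ring.lie_def, Matrix.sub_apply] at h
  by_cases h1 : (A * B) u v = 0
  · rw [h1, zero_sub, neg_ne_zero] at h
    exact (hB.mul hA u v h).trans (add_comm _ _)
  · exact hA.mul hB u v h1

theorem conjTranspose (hA : HasDegree A β) : HasDegree Aᴴ (-β) := by
  intro u v h
  rw [conjTranspose_apply, star_ne_zero] at h
  rw [← hA v u h, neg_sub]

theorem degreePart_eq (hA : HasDegree A β) (γ : Fin (n + 1) → ℤ) :
    degreePart γ A = if β = γ then A else 0 := by
  ext u v
  rw [degreePart_apply]
  by_cases h : A u v = 0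
  · split_ifs <;> simp [h]
  · rw [hA u v h]
    split_ifs <;> simp

end HasDegree

theorem sum_degreePart (A : Matrix (minusculeWeights n) (minusculeWeights n) ℂ) :
    ∑ β ∈ Finset.image (fun p : minusculeWeights n × minusculeWeights n ↦ p.1.1 - p.2.1)
      Finset.univ, degreePart β A = A := by
  ext u v
  rw [Matrix.sum_apply]
  simp only [degreePart_apply]
  rw [Finset.sum_ite_eq, if_pos]
  exact Finset.mem_image_of_mem _ (Finset.mem_univ (u, v))

theorem mem_complexE_of_degreePart {A : Matrix (minusculeWeights n) (minusculeWeights n) ℂ}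
    {V : Submodule ℂ (Matrix (minusculeWeights n) (minusculeWeights n) ℂ)}
    (h : ∀ β, degreePart β A ∈ V) : A ∈ V := by
  rw [← sum_degreePart A]
  exact V.sum_mem fun β _ ↦ h β

theorem weightShift_mem {α : Fin (n + 1) → ℤ} (hα : α ∈ simpleRoots n) :
    weightShift n α ∈ complexE n := LieSubalgebra.subset_lieSpan ⟨α, hα, Or.inl rfl⟩

theorem weightShift_neg_mem {α : Fin (n + 1) → ℤ} (hα : α ∈ simpleRoots n) :
    weightShift n (-α) ∈ complexE n := LieSubalgebra.subset_lieSpan ⟨α, hα, Or.inr rfl⟩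

theorem degreePart_mem {A : Matrix (minusculeWeights n) (minusculeWeights n) ℂ}
    (hA : A ∈ complexE n) (β : Fin (n + 1) → ℤ) : degreePart β A ∈ complexE n := by
  induction hA using LieSubalgebra.lieSpan_induction generalizing β with
  | mem A hA =>
    obtain ⟨α, hα, rfl | rfl⟩ := hA
    · rw [(hasDegree_weightShift α).degreePart_eq]
      split_ifs
      exacts [weightShift_mem hα, zero_mem _]
    · rw [(hasDegree_weightShift (-α)).degreePart_eq]
      split_ifs
      exacts [weightShift_neg_mem hα, zero_mem _]
  | zero =>
    rw [map_zero]
    exact zero_mem _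
  | smul c A _ hA =>
    rw [map_smul]
    exact (complexE n).smul_mem c (hA β)
  | add A B _ _ hA hB =>
    rw [map_add]
    exact add_mem (hA β) (hB β)
  | lie A B _ _ hA hB =>
    rw [← sum_degreePart A, ← sum_degreePart B, sum_lie, map_sum]
    refine sum_mem fun γ _ ↦ ?_
    rw [lie_sum, map_sum]
    refine sum_mem fun γ' _ ↦ ?_
    rw [((hasDegree_degreePart γ A).lie (hasDegree_degreePart γ' B)).degreePart_eq]
    split_ifs
    exacts [(complexE n).lie_mem (hA γ) (hB γ'), zero_mem _]

theorem weightShift_conjTranspose (α : Fin (n + 1) → ℤ) :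
    (weightShift n α)ᴴ = weightShift n (-α) := by
  ext u v
  rw [conjTranspose_apply, weightShift, weightShift, of_apply, of_apply, apply_ite star, star_one,
    star_zero]
  congr 1
  rw [← sub_eq_add_neg, eq_sub_iff_add_eq]
  exact propext eq_comm

theorem conjTranspose_mem {A : Matrix (minusculeWeights n) (minusculeWeights n) ℂ}
    (hA : A ∈ complexE n) : Aᴴ ∈ complexE n := by
  induction hA using LieSubalgebra.lieSpan_induction with
  | mem A hA =>
    obtain ⟨α, hα, rfl | rfl⟩ := hA
    · rw [weightShift_conjTranspose]
      exact weightShift_neg_mem hα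
    · rw [weightShift_conjTranspose, neg_neg]
      exact weightShift_mem hα
  | zero =>
    rw [conjTranspose_zero]
    exact zero_mem _
  | smul c A _ hA =>
    rw [conjTranspose_smul]
    exact (complexE n).smul_mem _ hA
  | add A B _ _ hA hB =>
    rw [conjTranspose_add]
    exact add_mem hA hB
  | lie A B _ _ hA hB =>
    rw [Ring.lie_def, conjTranspose_sub, conjTranspose_mul, conjTranspose_mul, ← Ring.lie_def]
    exact (complexE n).lie_mem hB hA

/-- The Lie algebra of matrices that strictly raise the pairing with `ρ`. -/
def strictlyRaising (n : ℕ) (ρ : Fin (n + 1) → ℤ) :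
    LieSubalgebra ℂ (Matrix (minusculeWeights n) (minusculeWeights n) ℂ) where
  carrier := {A | ∀ u v, A u v ≠ 0 → 0 < lorentz n ℤ ρ (u.1 - v.1)}
  zero_mem' u v h := absurd rfl h
  add_mem' {A B} hA hB u v h := by
    by_cases h1 : A u v = 0
    · rw [Matrix.add_apply, h1, zero_add] at h
      exact hB u v h
    · exact hA u v h1
  smul_mem' c A hA u v h := hA u v (right_ne_zero_of_mul h)
  lie_mem' {A B} hA hB u v h := by
    have key {A B : Matrix (minusculeWeights n) (minusculeWeights n) ℂ}
        (hA : ∀ u v, A u v ≠ 0 → 0 < lorentz n ℤ ρ (u.1 - v.1))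
        (hB : ∀ u v, B u v ≠ 0 → 0 < lorentz n ℤ ρ (u.1 - v.1)) (h : (A * B) u v ≠ 0) :
        0 < lorentz n ℤ ρ (u.1 - v.1) := by
      obtain ⟨w, -, hw⟩ := Finset.exists_ne_zero_of_sum_ne_zero h
      have h1 := add_pos (hA u w (left_ne_zero_of_mul hw)) (hB w v (right_ne_zero_of_mul hw))
      rwa [← map_add, sub_add_sub_cancel] at h1
    by_cases h1 : (A * B) u v = 0
    · rw [Ring.lie_def, Matrix.sub_apply, h1, zero_sub, neg_ne_zero] at h
      exact key hB hA h
    · exact key hA hB h1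

theorem apply_self_eq_zero_of_mem_strictlyRaising {ρ : Fin (n + 1) → ℤ}
    {A : Matrix (minusculeWeights n) (minusculeWeights n) ℂ} (hA : A ∈ strictlyRaising n ρ)
    (u : minusculeWeights n) : A u u = 0 := by
  by_contra h
  have h1 := hA u u h
  simp at h1

variable (hn : 3 ≤ n) (hn' : n ≤ 7)
include hn

theorem lorentz_canonicalClass_simpleRoot {α : Fin (n + 1) → ℤ} (hα : α ∈ simpleRoots n) :
    lorentz n ℂ (canonicalClass n ℂ) (fun j ↦ (α j : ℂ)) = 0 := by
  rw [← canonicalClass_intCast, lorentz_intCast, (isDelPezzoRoot_of_mem_simpleRoots hn hα).2,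
    Int.cast_zero]

include hn'

theorem torus_mem {γ : Fin (n + 1) → ℂ} (hγ : lorentz n ℂ (canonicalClass n ℂ) γ = 0) :
    torus n γ ∈ complexE n := by
  refine mem_of_simpleRoots_mem (V := (complexE n).toSubmodule.comap (torus n)) hn (fun α hα ↦ ?_) hγ
  change torus n _ ∈ complexE n
  rw [← lie_weightShift_neg hn' (by lia) (isDelPezzoRoot_of_mem_simpleRoots hn hα)]
  exact (complexE n).lie_mem (weightShift_mem hα) (weightShift_neg_mem hα)

/-- The diagonal of an element of the exceptional Lie algebra is given by a linear form. -/
theorem exists_torus_apply_self {A : Matrix (minusculeWeights n) (minusculeWeights n) ℂ}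
    (hA : A ∈ complexE n) : ∃ γ, lorentz n ℂ (canonicalClass n ℂ) γ = 0 ∧
      ∀ u, A u u = torus n γ u u := by
  let s : Set (Matrix (minusculeWeights n) (minusculeWeights n) ℂ) :=
    {A | ∃ α ∈ simpleRoots n, A = weightShift n α}
  let t : Set (Matrix (minusculeWeights n) (minusculeWeights n) ℂ) :=
    {A | ∃ α ∈ simpleRoots n, A = weightShift n (-α)}
  let H : Submodule ℂ (Matrix (minusculeWeights n) (minusculeWeights n) ℂ) :=
    (LinearMap.ker (lorentz n ℂ (canonicalClass n ℂ))).map (torus n)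
  have hst : complexE n = LieSubalgebra.lieSpan ℂ _ (s ∪ t) := by
    rw [complexE]
    congr 1
    ext A
    simp only [s, t, Set.mem_ofPred_eq, Set.mem_union]
    constructor
    · rintro ⟨α, hα, h | h⟩
      exacts [Or.inl ⟨α, hα, h⟩, Or.inr ⟨α, hα, h⟩]
    · rintro (⟨α, hα, h⟩ | ⟨α, hα, h⟩)
      exacts [⟨α, hα, Or.inl h⟩, ⟨α, hα, Or.inr h⟩]
  have hs : LieSubalgebra.lieSpan ℂ _ s ≤ strictlyRaising n (heightVector n) := by
    rw [LieSubalgebra.lieSpan_le]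
    rintro _ ⟨α, hα, rfl⟩ u v huv
    rw [hasDegree_weightShift α u v huv]
    exact lorentz_heightVector_pos hn hα
  have ht : LieSubalgebra.lieSpan ℂ _ t ≤ strictlyRaising n (-heightVector n) := by
    rw [LieSubalgebra.lieSpan_le]
    rintro _ ⟨α, hα, rfl⟩ u v huv
    rw [hasDegree_weightShift (-α) u v huv]
    simpa using lorentz_heightVector_pos hn hα
  rw [hst] at hA
  have h1 := lieSpan_union_le (H := H) (s := s) (t := t) ?_ ?_ ?_ hA
  · obtain ⟨x, hx, w, hw, rfl⟩ := Submodule.mem_sup.1 h1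
    obtain ⟨_, ⟨γ, hγ, rfl⟩, y, hy, rfl⟩ := Submodule.mem_sup.1 hw
    refine ⟨γ, hγ, fun u ↦ ?_⟩
    rw [Matrix.add_apply, Matrix.add_apply, apply_self_eq_zero_of_mem_strictlyRaising (hs hx),
      apply_self_eq_zero_of_mem_strictlyRaising (ht hy), zero_add, add_zero]
  · rintro _ ⟨γ, hγ, rfl⟩ _ ⟨α, hα, rfl⟩
    rw [(hasDegree_weightShift α).torus_lie]
    exact LieSubalgebra.smul_mem _ _ (LieSubalgebra.subset_lieSpan ⟨α, hα, rfl⟩)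
  · rintro _ ⟨γ, hγ, rfl⟩ _ ⟨α, hα, rfl⟩
    rw [(hasDegree_weightShift (-α)).torus_lie]
    exact LieSubalgebra.smul_mem _ _ (LieSubalgebra.subset_lieSpan ⟨α, hα, rfl⟩)
  · rintro _ ⟨α, hα, rfl⟩ _ ⟨β, hβ, rfl⟩
    have hα' := isDelPezzoRoot_of_mem_simpleRoots hn hα
    have hβ' := isDelPezzoRoot_of_mem_simpleRoots hn hβ
    by_cases h : α = β
    · rw [← h, lie_weightShift_neg hn' (by lia) hα']
      exact Submodule.mem_map_of_mem (lorentz_canonicalClass_simpleRoot hn hα)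
    · rw [lie_weightShift_neg_of_ne hn' (by lia) hα' hβ' (lorentz_nonpos_of_ne hα hβ h)]
      exact H.zero_mem

end ExceptionalAlgebra

noncomputable section RootStrings

open Matrix

variable {n : ℕ}

theorem weightShift_apply (α : Fin (n + 1) → ℤ) (u v : minusculeWeights n) :
    weightShift n α u v = if u.1 = v.1 + α then 1 else 0 := rfl

theorem torus_eq_diagonal (γ : Fin (n + 1) → ℂ) :
    torus n γ = diagonal fun u ↦ lorentz n ℂ (fun j ↦ (u.1 j : ℂ)) γ := rfl

/-- The sum of the squares of the values of a root on the weights. -/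
def weightSquareSum (n : ℕ) (α : Fin (n + 1) → ℤ) : ℤ :=
  ∑ u : minusculeWeights n, lorentz n ℤ u.1 α ^ 2

section

variable (hn : 3 < n) (hn' : n ≤ 7)
include hn hn'

/-- Invariance of the weights under the reflection in `α`. -/
theorem two_mul_sum_lorentz_mul_lorentz {α : Fin (n + 1) → ℤ} (hα : IsDelPezzoRoot α)
    (γ : Fin (n + 1) → ℂ) :
    2 * ∑ u : minusculeWeights n, lorentz n ℂ (fun j ↦ (u.1 j : ℂ)) γ * (lorentz n ℤ u.1 α : ℂ) =
      lorentz n ℂ γ (fun j ↦ (α j : ℂ)) * weightSquareSum n α := by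
  let s (u : minusculeWeights n) : minusculeWeights n :=
    ⟨u.1 - lorentz n ℤ u.1 α • α, reflection_mem_minusculeWeights hn' (by lia) hα u.2⟩
  have h1 (u : minusculeWeights n) : lorentz n ℤ (s u).1 α = -lorentz n ℤ u.1 α := by
    simp only [s, map_sub, map_smul, LinearMap.sub_apply, LinearMap.smul_apply, hα.1, smul_eq_mul]
    ring
  have hs : Function.Involutive s := fun u ↦ Subtype.ext <| by
    change (s u).1 - lorentz n ℤ (s u).1 α • α = u.1
    rw [h1]
    simp [s]
  have h2 (u : minusculeWeights n) : lorentz n ℂ (fun j ↦ ((s u).1 j : ℂ)) γ =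
      lorentz n ℂ (fun j ↦ (u.1 j : ℂ)) γ -
        lorentz n ℤ u.1 α * lorentz n ℂ γ (fun j ↦ (α j : ℂ)) := by
    rw [lorentz_comm γ, ← smul_eq_mul, ← LinearMap.smul_apply, ← map_smul, ← LinearMap.sub_apply,
      ← map_sub]
    congr 2
    ext j
    simp [s]
  have h3 := Equiv.sum_comp hs.toPerm fun u : minusculeWeights n ↦
    lorentz n ℂ (fun j ↦ (u.1 j : ℂ)) γ * (lorentz n ℤ u.1 α : ℂ)
  rw [two_mul]
  nth_rw 1 [← h3]
  rw [← Finset.sum_add_distrib, weightSquareSum, Int.cast_sum, Finset.mul_sum]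
  refine Finset.sum_congr rfl fun u _ ↦ ?_
  rw [Function.Involutive.coe_toPerm, h1, h2]
  push_cast
  ring

theorem weightSquareSum_eq_of_adjacent {α β : Fin (n + 1) → ℤ} (hα : IsDelPezzoRoot α)
    (hβ : IsDelPezzoRoot β) (h : lorentz n ℤ α β = -1) :
    weightSquareSum n α = weightSquareSum n β := by
  have h1 := two_mul_sum_lorentz_mul_lorentz hn hn' hα fun j ↦ (β j : ℂ)
  have h2 := two_mul_sum_lorentz_mul_lorentz hn hn' hβ fun j ↦ (α j : ℂ)
  simp only [lorentz_intCast, mul_comm ((lorentz n ℤ _ β : ℤ) : ℂ)] at h1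
  simp only [lorentz_intCast] at h2
  rw [lorentz_comm β, h] at h1
  rw [h] at h2
  have h3 := h1.symm.trans h2
  push_cast at h3
  have h4 : (weightSquareSum n α : ℂ) = weightSquareSum n β := by linear_combination -h3
  exact_mod_cast h4

theorem exists_weightSquareSum_eq : ∃ c : ℤ, 0 < c ∧ ∀ α ∈ simpleRoots n, weightSquareSum n α = c := by
  set α₀ : Fin (n + 1) → ℤ := fun j ↦ if j.val ≤ 3 then 1 else 0 with hα₀
  have hr {α : Fin (n + 1) → ℤ} (hα : α ∈ simpleRoots n) := isDelPezzoRoot_of_mem_simpleRoots hn.le hα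
  have h0 : α₀ ∈ simpleRoots n := Or.inl rfl
  let r (k : ℕ) (hk : k + 2 < n + 1) : Fin (n + 1) → ℤ :=
    Pi.single ⟨k + 2, hk⟩ 1 - Pi.single ⟨k + 1, by lia⟩ 1
  have hs (k : ℕ) (hk : k + 2 < n + 1) : r k hk ∈ simpleRoots n :=
    Or.inr ⟨⟨k + 1, by lia⟩, ⟨k + 2, hk⟩, by simp, rfl, rfl⟩
  have h1 (k : ℕ) (hk : k + 2 < n + 1) : weightSquareSum n (r k hk) =
      weightSquareSum n (r 0 (by lia)) := by
    induction k with
    | zero => rfl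
    | succ k ih =>
      rw [← ih (by lia)]
      refine weightSquareSum_eq_of_adjacent hn hn' (hr (hs _ _)) (hr (hs _ _)) ?_
      simp only [r]
      rw [lorentz_stepRoot _ (by simp) rfl]
      simp
  have h2 : weightSquareSum n α₀ = weightSquareSum n (r 0 (by lia)) := by
    rw [← h1 2 (by lia)]
    refine weightSquareSum_eq_of_adjacent hn hn' (hr h0) (hr (hs _ _)) ?_
    simp only [r]
    rw [lorentz_stepRoot _ (by simp) rfl]
    simp [hα₀]
  refine ⟨weightSquareSum n (r 0 (by lia)), ?_, ?_⟩
  · refine Finset.sum_pos' (fun u _ ↦ sq_nonneg _)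
      ⟨⟨_, neg_single_mem_minusculeWeights hn' ⟨0, by lia⟩⟩, Finset.mem_univ _, ?_⟩
    simp only [r]
    rw [lorentz_stepRoot _ (by simp) rfl]
    simp
  · rintro α (rfl | ⟨i, j, hi, hj, rfl⟩)
    · exact h2
    · obtain ⟨i, hi'⟩ := i
      obtain ⟨j, hj'⟩ := j
      dsimp only at hi hj
      subst hj
      obtain ⟨k, rfl⟩ := Nat.exists_eq_add_of_le' hi
      exact h1 k hj'

/-- The bracket of two root vectors of opposite degrees is a multiple of the coroot. -/
theorem lie_apply_self_of_hasDegree : ∃ c : ℝ, 0 < c ∧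
    ∀ (β : Fin (n + 1) → ℤ) (x y : Matrix (minusculeWeights n) (minusculeWeights n) ℂ),
      lorentz n ℤ (canonicalClass n ℤ) β = 0 → x ∈ complexE n → y ∈ complexE n →
      HasDegree x β → HasDegree y (-β) → ∀ u : minusculeWeights n,
        ⁅x, y⁆ u u = c * trace (x * y) * lorentz n ℤ u.1 β := by
  obtain ⟨c, hc, h⟩ := exists_weightSquareSum_eq hn hn'
  refine ⟨2 / c, by positivity, fun β x y hβ hx hy hxβ hyβ u ↦ ?_⟩
  have hc' : (c : ℂ) ≠ 0 := by exact_mod_cast hc.ne'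
  obtain ⟨γ, hγ, h1⟩ := exists_torus_apply_self hn.le hn' ((complexE n).lie_mem hx hy)
  have h2 (α : Fin (n + 1) → ℤ) (hα : α ∈ simpleRoots n) :
      lorentz n ℂ γ (fun j ↦ (α j : ℂ)) * c = 2 * (lorentz n ℤ β α * trace (x * y)) := by
    rw [← h α hα, ← two_mul_sum_lorentz_mul_lorentz hn hn'
      (isDelPezzoRoot_of_mem_simpleRoots hn.le hα)]
    congr 1
    have h3 : ⁅y, torus n (fun j ↦ (α j : ℂ))⁆ = (lorentz n ℤ β α : ℂ) • y := by
      rw [← lie_skew, hyβ.torus_lie, ← neg_smul, lorentz_intCast]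
      simp
    calc _ = trace (⁅x, y⁆ * torus n (fun j ↦ (α j : ℂ))) := by
          rw [trace, torus_eq_diagonal]
          refine Finset.sum_congr rfl fun u _ ↦ ?_
          rw [diag_apply, mul_diagonal, h1, torus_apply_self, lorentz_intCast]
      _ = trace (x * ⁅y, torus n (fun j ↦ (α j : ℂ))⁆) := by
          rw [Ring.lie_def, Ring.lie_def, sub_mul, mul_sub, trace_sub, trace_sub, mul_assoc,
            mul_assoc y, trace_mul_comm y, mul_assoc]
      _ = _ := by
          rw [h3, Matrix.mul_smul, trace_smul, smul_eq_mul]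
  have h3 : γ - (2 * trace (x * y) / c) • (fun j ↦ (β j : ℂ)) = 0 := by
    refine eq_zero_of_orthogonal_simpleRoots hn.le (by lia) ?_ fun α hα ↦ ?_
    · rw [map_sub, map_smul, hγ, ← canonicalClass_intCast, lorentz_intCast, hβ]
      simp
    · rw [map_sub, map_smul, LinearMap.sub_apply, LinearMap.smul_apply, lorentz_intCast,
        smul_eq_mul, sub_eq_zero, div_mul_eq_mul_div, eq_div_iff hc', h2 α hα]
      ring
  rw [h1, torus_apply_self, sub_eq_zero.1 h3, map_smul, lorentz_intCast]
  push_cast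
  ring

theorem sub_mem_of_hasDegree {β : Fin (n + 1) → ℤ}
    {x : Matrix (minusculeWeights n) (minusculeWeights n) ℂ}
    (hβ : lorentz n ℤ (canonicalClass n ℤ) β = 0) (hx : x ∈ complexE n) (hx0 : x ≠ 0)
    (hxβ : HasDegree x β) {u : Fin (n + 1) → ℤ} (hu : u ∈ minusculeWeights n)
    (h : 0 < lorentz n ℤ u β) : u - β ∈ minusculeWeights n := by
  obtain ⟨c, hc, hcx⟩ := lie_apply_self_of_hasDegree hn hn'
  have h1 := congrArg Complex.re
    (hcx β x xᴴ hβ hx (conjTranspose_mem hx) hxβ hxβ.conjTranspose ⟨u, hu⟩)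
  have h2 (A : Matrix (minusculeWeights n) (minusculeWeights n) ℂ) (u : minusculeWeights n) :
      (A * Aᴴ) u u = ((∑ v, ‖A u v‖ ^ 2 : ℝ) : ℂ) := by
    rw [Matrix.mul_apply]
    push_cast
    exact Finset.sum_congr rfl fun v _ ↦ Complex.mul_conj' _
  have h3 : trace (x * xᴴ) = ((∑ u, ∑ v, ‖x u v‖ ^ 2 : ℝ) : ℂ) := by
    rw [trace, Complex.ofReal_sum]
    exact Finset.sum_congr rfl fun u _ ↦ h2 x u
  have h4 := h2 xᴴ ⟨u, hu⟩
  rw [conjTranspose_conjTranspose] at h4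
  rw [Ring.lie_def, Matrix.sub_apply, h2, h4, h3, ← Complex.ofReal_sub, Complex.ofReal_re,
    ← Complex.ofReal_mul, ← Complex.ofReal_intCast, ← Complex.ofReal_mul, Complex.ofReal_re] at h1
  have h5 : 0 < ∑ u, ∑ v, ‖x u v‖ ^ 2 := by
    obtain ⟨u, v, huv⟩ : ∃ u v, x u v ≠ 0 := by
      by_contra! h0
      exact hx0 (Matrix.ext h0)
    exact Finset.sum_pos' (fun _ _ ↦ Finset.sum_nonneg fun _ _ ↦ by positivity)
      ⟨u, Finset.mem_univ _, Finset.sum_pos' (fun _ _ ↦ by positivity)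
        ⟨v, Finset.mem_univ _, by positivity⟩⟩
  have h6 : (0 : ℝ) < lorentz n ℤ u β := by exact_mod_cast h
  by_contra h7
  have h8 : ∑ v, ‖x ⟨u, hu⟩ v‖ ^ 2 = 0 := by
    refine Finset.sum_eq_zero fun v _ ↦ ?_
    by_contra h8
    have h9 := hxβ ⟨u, hu⟩ v (by simpa using h8)
    refine h7 ?_
    rw [← h9, sub_sub_cancel]
    exact v.2
  have h9 : 0 ≤ ∑ v, ‖xᴴ ⟨u, hu⟩ v‖ ^ 2 := Finset.sum_nonneg fun _ _ ↦ by positivity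
  have h10 := mul_pos (mul_pos hc h5) h6
  linarith

theorem add_mem_of_hasDegree {β : Fin (n + 1) → ℤ}
    {x : Matrix (minusculeWeights n) (minusculeWeights n) ℂ}
    (hβ : lorentz n ℤ (canonicalClass n ℤ) β = 0) (hx : x ∈ complexE n) (hx0 : x ≠ 0)
    (hxβ : HasDegree x β) {u : Fin (n + 1) → ℤ} (hu : u ∈ minusculeWeights n)
    (h : lorentz n ℤ u β < 0) : u + β ∈ minusculeWeights n := by
  rw [← sub_neg_eq_add]
  exact sub_mem_of_hasDegree hn hn' (by rw [map_neg, hβ, neg_zero]) (conjTranspose_mem hx)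
    (by simpa using hx0) hxβ.conjTranspose hu (by rw [map_neg]; lia)

end

/-- A multiple of a sign vector orthogonal to the canonical class and of square twice the
multiple is a sign vector. -/
theorem eq_one_of_lorentz_self (hn : n ≤ 7) {β : Fin (n + 1) → ℤ} {ε : Fin n → ℤ} {s : ℤ}
    (hs : 0 < s) (hβ : lorentz n ℤ (canonicalClass n ℤ) β = 0) (h : lorentz n ℤ β β = 2 * s)
    (hε : ∀ i, ε i = -1 ∨ ε i = 0 ∨ ε i = 1) (hβε : ∀ i : Fin n, β i.succ = s * ε i) : s = 1 := by
  rw [lorentz_canonicalClass] at hβ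
  rw [lorentz_self] at h
  simp only [hβε, mul_pow, ← Finset.mul_sum] at hβ h
  have hN : ∑ i, ε i ^ 2 ≤ 7 := by
    calc ∑ i, ε i ^ 2 ≤ ∑ i : Fin n, (1 : ℤ) := Finset.sum_le_sum fun i _ ↦ by
          rcases hε i with h | h | h <;> simp [h]
      _ ≤ 7 := by
        simp
        lia
  have hS : ∑ i, ε i ≤ ∑ i, ε i ^ 2 := Finset.sum_le_sum fun i _ ↦ by
    rcases hε i with h | h | h <;> simp [h]
  have hS' : -∑ i, ε i ^ 2 ≤ ∑ i, ε i := by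
    rw [← Finset.sum_neg_distrib]
    refine Finset.sum_le_sum fun i _ ↦ ?_
    rcases hε i with h | h | h <;> simp [h]
  have hpar : (2 : ℤ) ∣ ∑ i, ε i ^ 2 - ∑ i, ε i := by
    rw [← Finset.sum_sub_distrib]
    refine Finset.dvd_sum fun i _ ↦ ?_
    rcases hε i with h | h | h <;> simp [h]
  generalize ∑ i, ε i ^ 2 = N at *
  generalize ∑ i, ε i = S at *
  have h1 : s * (s * (9 * N - S ^ 2)) = s * 18 := by
    have h2 : 3 * β 0 = s * S := by linarith
    have h3 : 9 * β 0 ^ 2 = s ^ 2 * S ^ 2 := by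
      rw [← mul_pow, ← h2]
      ring
    linear_combination 9 * h + h3
  have h2 := mul_left_cancel₀ hs.ne' h1
  have h3 : S ^ 2 ≤ N ^ 2 := by nlinarith
  by_contra h4
  have h5 : 2 ≤ s := by lia
  have h6 : 0 ≤ N := by lia
  have h7 : 9 * N - S ^ 2 ≤ 9 := by nlinarith
  have h8 : N ≤ 1 := by nlinarith
  interval_cases N
  · have h9 : S = 0 := by lia
    subst h9
    lia
  · have h9 : S = 1 ∨ S = -1 := by lia
    rcases h9 with rfl | rfl <;> lia

theorem coordinate_bound_of_hasDegree (hn : 3 < n) (hn' : n ≤ 7) {β : Fin (n + 1) → ℤ}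
    {x : Matrix (minusculeWeights n) (minusculeWeights n) ℂ}
    (hβ : lorentz n ℤ (canonicalClass n ℤ) β = 0) (hx : x ∈ complexE n) (hx0 : x ≠ 0)
    (hxβ : HasDegree x β) (i : Fin n) : β i.succ = -1 ∨ β i.succ = 0 ∨ β i.succ = 1 := by
  have key (i : Fin n) :
      β i.succ = 0 ∨ 2 * β i.succ = lorentz n ℤ β β ∨ 2 * β i.succ = -lorentz n ℤ β β := by
    have h1 := neg_single_mem_minusculeWeights hn' i
    have h2 : lorentz n ℤ (-Pi.single i.succ 1) β = -β i.succ := by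
      rw [map_neg, LinearMap.neg_apply, lorentz_comm, lorentz_single_succ]
    have h3 := ((mem_minusculeWeights_iff hn').1 h1).1
    rcases lt_trichotomy (β i.succ) 0 with h | h | h
    · have h4 := sub_mem_of_hasDegree hn hn' hβ hx hx0 hxβ h1 (by lia)
      have h5 := ((mem_minusculeWeights_iff hn').1 h4).1
      simp only [map_sub, LinearMap.sub_apply, h3, h2, lorentz_comm β (-_)] at h5
      lia
    · exact Or.inl h
    · have h4 := add_mem_of_hasDegree hn hn' hβ hx hx0 hxβ h1 (by lia)
      have h5 := ((mem_minusculeWeights_iff hn').1 h4).1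
      simp only [map_add, LinearMap.add_apply, h3, h2, lorentz_comm β (-_)] at h5
      lia
  by_cases h0 : β i.succ = 0
  · exact Or.inr (Or.inl h0)
  have hβ0 : 0 < lorentz n ℤ β β := by
    by_contra! h1
    refine h0 ?_
    rw [eq_zero_of_lorentz_self_nonpos (by lia) hβ h1]
    rfl
  obtain ⟨s, hs⟩ : ∃ s, lorentz n ℤ β β = 2 * s := by
    rcases (key i).resolve_left h0 with h | h
    exacts [⟨_, h.symm⟩, ⟨-β i.succ, by lia⟩]
  rw [hs] at key
  have hε (i : Fin n) : ∃ ε : ℤ, (ε = -1 ∨ ε = 0 ∨ ε = 1) ∧ β i.succ = s * ε := by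
    rcases key i with h | h | h
    exacts [⟨0, by simp, by lia⟩, ⟨1, by simp, by lia⟩, ⟨-1, by simp, by lia⟩]
  choose ε hε hβε using hε
  have h1 := eq_one_of_lorentz_self hn' (by lia) hβ hs hε hβε
  rw [hβε, h1, one_mul]
  exact hε i

theorem lorentz_canonicalClass_sub (hn : n ≤ 7) (u v : minusculeWeights n) :
    lorentz n ℤ (canonicalClass n ℤ) (u.1 - v.1) = 0 := by
  rw [map_sub, ((mem_minusculeWeights_iff hn).1 u.2).2, ((mem_minusculeWeights_iff hn).1 v.2).2,
    sub_self]

/-- The coordinates of roots are at most one in absolute value. -/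
theorem coordinate_bound (hn : 3 < n) (hn' : n ≤ 7)
    {A : Matrix (minusculeWeights n) (minusculeWeights n) ℂ} (hA : A ∈ complexE n)
    {u v : minusculeWeights n} (h : A u v ≠ 0) (i : Fin n) :
    u.1 i.succ - v.1 i.succ = -1 ∨ u.1 i.succ - v.1 i.succ = 0 ∨ u.1 i.succ - v.1 i.succ = 1 := by
  refine coordinate_bound_of_hasDegree hn hn' (lorentz_canonicalClass_sub hn' u v)
    (degreePart_mem hA (u.1 - v.1)) (fun h0 ↦ h ?_) (hasDegree_degreePart _ A) i
  simpa [degreePart_apply] using congrFun (congrFun h0 u) v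

/-- The root spaces of the simple roots are one-dimensional. -/
theorem exists_eq_smul_weightShift (hn : 3 < n) (hn' : n ≤ 7) {α : Fin (n + 1) → ℤ}
    (hα : α ∈ simpleRoots n) {x : Matrix (minusculeWeights n) (minusculeWeights n) ℂ}
    (hx : x ∈ complexE n) (hxα : HasDegree x α) : ∃ t : ℂ, x = t • weightShift n α := by
  obtain ⟨c, -, hc⟩ := lie_apply_self_of_hasDegree hn hn'
  have hα' := isDelPezzoRoot_of_mem_simpleRoots hn.le hα
  have h1 := hc α x _ hα'.2 hx (weightShift_neg_mem hα) hxα (hasDegree_weightShift _)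
  refine ⟨c * trace (x * weightShift n (-α)), ?_⟩
  ext u v
  rw [Matrix.smul_apply, smul_eq_mul, weightShift_apply α]
  split_ifs with huv
  swap
  · rw [mul_zero]
    by_contra h2
    exact huv (by rw [← hxα u v h2, add_sub_cancel])
  have h2 : lorentz n ℤ u.1 α = 1 := by
    rw [← sub_mem_minusculeWeights_iff hn' hα' u.2, huv, add_sub_cancel_right]
    exact v.2
  have h3 : u.1 + α ∉ minusculeWeights n := by
    rw [add_mem_minusculeWeights_iff hn' hα' u.2, h2]
    norm_num
  have h4 := h1 u
  have h5 : (x * weightShift n (-α)) u u = x u v := by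
    rw [Matrix.mul_apply, Finset.sum_eq_single v]
    · simp [weightShift_apply, huv]
    · intro w _ hw
      by_cases h6 : x u w = 0
      · rw [h6, zero_mul]
      · refine absurd (Subtype.ext ?_) hw
        have h7 := hxα u w h6
        rw [huv, sub_eq_iff_eq_add] at h7
        exact (add_right_cancel (h7.trans (add_comm _ _))).symm
    · simp
  have h6 : (weightShift n (-α) * x) u u = 0 := by
    rw [Matrix.mul_apply]
    refine Finset.sum_eq_zero fun w _ ↦ ?_
    rw [weightShift_apply, if_neg, zero_mul]
    intro h7
    refine h3 ?_
    rw [h7, neg_add_cancel_right]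
    exact w.2
  rw [Ring.lie_def, Matrix.sub_apply, h5, h6, h2, sub_zero, Int.cast_one, mul_one] at h4
  rw [h4, mul_one]

end RootStrings

noncomputable section HermitianRealForm

open Matrix

variable {n : ℕ}

/-- The matrices whose entry at `(u, v)` vanishes unless the last coordinate of `u - v` is `k`. -/
def HasLevel (A : Matrix (minusculeWeights n) (minusculeWeights n) ℂ) (k : ℤ) : Prop :=
  ∀ u v, A u v ≠ 0 → u.1 (Fin.last n) - v.1 (Fin.last n) = k

/-- The component of level `k` of a matrix. -/
def levelPart (k : ℤ) : Matrix (minusculeWeights n) (minusculeWeights n) ℂ →ₗ[ℂ]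
    Matrix (minusculeWeights n) (minusculeWeights n) ℂ where
  toFun A := of fun u v ↦ if u.1 (Fin.last n) - v.1 (Fin.last n) = k then A u v else 0
  map_add' A B := by ext u v; simp only [of_apply, Matrix.add_apply]; split_ifs <;> simp
  map_smul' c A := by ext u v; simp

theorem levelPart_apply (k : ℤ) (A : Matrix (minusculeWeights n) (minusculeWeights n) ℂ)
    (u v : minusculeWeights n) : levelPart k A u v =
      if u.1 (Fin.last n) - v.1 (Fin.last n) = k then A u v else 0 := rfl

theorem hasLevel_levelPart (k : ℤ) (A : Matrix (minusculeWeights n) (minusculeWeights n) ℂ) :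
    HasLevel (levelPart k A) k := by
  intro u v h
  rw [levelPart_apply, ne_eq, ite_eq_right_iff, not_forall] at h
  exact h.1

theorem HasDegree.hasLevel {A : Matrix (minusculeWeights n) (minusculeWeights n) ℂ}
    {β : Fin (n + 1) → ℤ} (hA : HasDegree A β) : HasLevel A (β (Fin.last n)) := by
  intro u v h
  rw [← hA u v h]
  rfl

namespace HasLevel

variable {A B : Matrix (minusculeWeights n) (minusculeWeights n) ℂ} {k l : ℤ}

theorem zero : HasLevel (0 : Matrix (minusculeWeights n) (minusculeWeights n) ℂ) k :=
  fun _ _ h ↦ absurd rfl h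

theorem add (hA : HasLevel A k) (hB : HasLevel B k) : HasLevel (A + B) k := by
  intro u v h
  by_cases h1 : A u v = 0
  · rw [Matrix.add_apply, h1, zero_add] at h
    exact hB u v h
  · exact hA u v h1

theorem smul (hA : HasLevel A k) (c : ℂ) : HasLevel (c • A) k :=
  fun u v h ↦ hA u v (right_ne_zero_of_mul h)

theorem conjTranspose (hA : HasLevel A k) : HasLevel Aᴴ (-k) := by
  intro u v h
  rw [conjTranspose_apply, star_ne_zero] at h
  rw [← hA v u h, neg_sub]

theorem levelPart_eq (hA : HasLevel A k) (l : ℤ) : levelPart l A = if k = l then A else 0 := by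
  ext u v
  rw [levelPart_apply]
  by_cases h : A u v = 0
  · split_ifs <;> simp [h]
  · rw [hA u v h]
    split_ifs <;> simp

theorem levelPart_lie (hA : HasLevel A k) (l : ℤ)
    (B : Matrix (minusculeWeights n) (minusculeWeights n) ℂ) :
    levelPart l ⁅A, B⁆ = ⁅A, levelPart (l - k) B⁆ := by
  ext u v
  rw [levelPart_apply, Ring.lie_def, Ring.lie_def, Matrix.sub_apply, Matrix.sub_apply,
    Matrix.mul_apply, Matrix.mul_apply, Matrix.mul_apply, Matrix.mul_apply]
  have h1 (w : minusculeWeights n) : A u w * levelPart (l - k) B w v =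
      if u.1 (Fin.last n) - v.1 (Fin.last n) = l then A u w * B w v else 0 := by
    by_cases h : A u w = 0
    · simp [h]
    · have h2 := hA u w h
      rw [levelPart_apply, mul_ite, mul_zero]
      congr 1
      exact propext ⟨fun h ↦ by lia, fun h ↦ by lia⟩
  have h2 (w : minusculeWeights n) : levelPart (l - k) B u w * A w v =
      if u.1 (Fin.last n) - v.1 (Fin.last n) = l then B u w * A w v else 0 := by
    by_cases h : A w v = 0
    · simp [h]
    · have h2 := hA w v h
      rw [levelPart_apply, ite_mul, zero_mul]
      congr 1
      exact propext ⟨fun h ↦ by lia, fun h ↦ by lia⟩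
  simp only [h1, h2]
  split_ifs <;> simp

theorem lie (hA : HasLevel A k) (hB : HasLevel B l) : HasLevel ⁅A, B⁆ (k + l) := by
  have h1 := hA.levelPart_lie (k + l) B
  rw [add_sub_cancel_left, hB.levelPart_eq, if_pos rfl] at h1
  rw [← h1]
  exact hasLevel_levelPart _ _

end HasLevel

theorem levelPart_mem {A : Matrix (minusculeWeights n) (minusculeWeights n) ℂ}
    (hA : A ∈ complexE n) (k : ℤ) : levelPart k A ∈ complexE n := by
  refine mem_complexE_of_degreePart (V := (complexE n).toSubmodule) fun β ↦ ?_
  have h1 : degreePart β (levelPart k A) = if β (Fin.last n) = k then degreePart β A else 0 := by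
    ext u v
    rw [degreePart_apply, levelPart_apply]
    split_ifs with h1 h2 h3 h3
    · rw [degreePart_apply, if_pos h1]
    · exact absurd (by rw [← h1]; exact h2) h3
    · exact absurd (by rw [← h3, ← h1]; rfl) h2
    · rfl
    · rw [degreePart_apply, if_neg h1]
    · rfl
  rw [h1]
  split_ifs
  exacts [degreePart_mem hA β, zero_mem _]

theorem mem_hermitianE_iff {A : Matrix (minusculeWeights n) (minusculeWeights n) ℂ} :
    A ∈ hermitianE n ↔ A ∈ complexE n ∧ ∀ u v : minusculeWeights n,
      star (A v u) * (if Even (v.1 (Fin.last n)) then 1 else -1) +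
        (if Even (u.1 (Fin.last n)) then 1 else -1) * A u v = 0 := by
  refine and_congr Iff.rfl ?_
  change Aᴴ * weightSign n + weightSign n * A = 0 ↔ _
  rw [← Matrix.ext_iff]
  simp [weightSign]

theorem mem_hermitianE_of_level_zero {A : Matrix (minusculeWeights n) (minusculeWeights n) ℂ}
    (hA : A ∈ complexE n) (hA' : Aᴴ = -A) (h : HasLevel A 0) : A ∈ hermitianE n := by
  refine mem_hermitianE_iff.2 ⟨hA, fun u v ↦ ?_⟩
  have h1 : star (A v u) = -A u v := congrFun (congrFun hA' u) v
  rw [h1]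
  by_cases h2 : A u v = 0
  · simp [h2]
  · rw [sub_eq_zero.1 (h u v h2)]
    ring

theorem add_conjTranspose_mem_hermitianE
    {A : Matrix (minusculeWeights n) (minusculeWeights n) ℂ}
    (hA : A ∈ complexE n) (h : HasLevel A 1) : A + Aᴴ ∈ hermitianE n := by
  refine mem_hermitianE_iff.2 ⟨add_mem hA (conjTranspose_mem hA), fun u v ↦ ?_⟩
  rw [Matrix.add_apply, Matrix.add_apply, conjTranspose_apply, conjTranspose_apply, star_add,
    star_star, add_comm (star _)]
  by_cases h2 : A u v + star (A v u) = 0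
  · rw [h2, zero_mul, mul_zero, add_zero]
  · have h3 : Even (u.1 (Fin.last n)) ↔ ¬ Even (v.1 (Fin.last n)) := by
      by_cases h4 : A u v = 0
      · rw [h4, zero_add, star_eq_zero] at h2
        have h5 := h v u h2
        rw [(by lia : v.1 (Fin.last n) = u.1 (Fin.last n) + 1), Int.even_add_one, not_not]
      · have h5 := h u v h4
        rw [(by lia : u.1 (Fin.last n) = v.1 (Fin.last n) + 1), Int.even_add_one]
    by_cases h4 : Even (v.1 (Fin.last n))
    · have h5 : ¬ Even (u.1 (Fin.last n)) := fun h5 ↦ h3.1 h5 h4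
      simp only [h4, h5, if_true, if_false]
      ring
    · have h5 := h3.2 h4
      simp only [h4, h5, if_true, if_false]
      ring

/-- The simple root `E_(n-1) - E_n`. -/
def lastRoot (n : ℕ) : Fin (n + 1) → ℤ :=
  Pi.single (Fin.last n) 1 - Pi.single ⟨n - 1, by lia⟩ 1

variable (hn : 3 < n) (hn' : n ≤ 7)
include hn

theorem lastRoot_mem : lastRoot n ∈ simpleRoots n :=
  Or.inr ⟨⟨n - 1, by lia⟩, Fin.last n, by simp; lia, by simp; lia, rfl⟩

theorem lastRoot_last : lastRoot n (Fin.last n) = 1 := by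
  have h : Fin.last n ≠ ⟨n - 1, by lia⟩ := by
    simp [Fin.ext_iff]
    lia
  simp [lastRoot, h]

theorem simpleRoot_last {α : Fin (n + 1) → ℤ} (hα : α ∈ simpleRoots n) (h : α ≠ lastRoot n) :
    α (Fin.last n) = 0 := by
  rcases hα with rfl | ⟨i, j, hi, hj, rfl⟩
  · simp
    lia
  · have h1 : j ≠ Fin.last n := by
      rintro rfl
      refine h ?_
      rw [lastRoot]
      congr 2
      ext
      simp at hj ⊢
      lia
    have h2 : i ≠ Fin.last n := by
      rintro rfl
      simp at hj
      lia
    simp [h1.symm, h2.symm]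

include hn'

theorem level_bound {A : Matrix (minusculeWeights n) (minusculeWeights n) ℂ} (hA : A ∈ complexE n)
    {u v : minusculeWeights n} (h : A u v ≠ 0) :
    u.1 (Fin.last n) - v.1 (Fin.last n) = -1 ∨ u.1 (Fin.last n) - v.1 (Fin.last n) = 0 ∨
      u.1 (Fin.last n) - v.1 (Fin.last n) = 1 := by
  have h1 := coordinate_bound hn hn' hA h ⟨n - 1, by lia⟩
  have h2 : (⟨n - 1, by lia⟩ : Fin n).succ = Fin.last n := by
    ext
    simp
    lia
  rwa [h2] at h1

theorem exists_weight_of_simpleRoot {α : Fin (n + 1) → ℤ} (hα : α ∈ simpleRoots n) :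
    ∃ u v : minusculeWeights n, u.1 = v.1 + α := by
  have hα' := isDelPezzoRoot_of_mem_simpleRoots hn.le hα
  suffices ∃ v ∈ minusculeWeights n, lorentz n ℤ v α = -1 by
    obtain ⟨v, hv, h⟩ := this
    exact ⟨⟨v + α, (add_mem_minusculeWeights_iff hn' hα' hv).2 h⟩, ⟨v, hv⟩, rfl⟩
  rcases hα with rfl | ⟨i, j, hi, hj, rfl⟩
  · refine ⟨_, neg_single_mem_minusculeWeights hn' ⟨0, by lia⟩, ?_⟩
    rw [lorentz_firstRoot hn.le]
    simp [Fin.ext_iff]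
  · have h0 : j ≠ 0 := by rintro rfl; simp at hj
    have hij : i ≠ j := by rintro rfl; simp at hj
    obtain ⟨k, rfl⟩ := Fin.exists_succ_eq.2 h0
    refine ⟨_, neg_single_mem_minusculeWeights hn' k, ?_⟩
    rw [lorentz_stepRoot _ hi hj]
    simp [hij]

/-- An imaginary element of the torus. -/
theorem I_smul_torus_mem {γ : Fin (n + 1) → ℂ} (hγ : lorentz n ℂ (canonicalClass n ℂ) γ = 0)
    (hre : ∀ j, star (γ j) = γ j) : Complex.I • torus n γ ∈ hermitianE n := by
  have h1 : (torus n γ)ᴴ = torus n γ := by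
    rw [torus_eq_diagonal, diagonal_conjTranspose]
    congr 1
    ext u
    have h2 (j : Fin (n + 1)) : (starRingEnd ℂ) (γ j) = γ j := hre j
    simp [lorentz_apply, h2]
  refine mem_hermitianE_of_level_zero ((complexE n).smul_mem _ (torus_mem hn.le hn' hγ)) ?_ ?_
  · rw [conjTranspose_smul, h1]
    simp
  · intro u v h
    by_cases huv : u = v
    · rw [huv, sub_self]
    · simp [torus_eq_diagonal, huv] at h

end HermitianRealForm

noncomputable section HermitianRealForm

open Matrix

variable {n : ℕ}

/-- The subspace of the exceptional Lie algebra of level one. -/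
def levelOne (n : ℕ) : Submodule ℂ (Matrix (minusculeWeights n) (minusculeWeights n) ℂ) where
  carrier := {A | A ∈ complexE n ∧ HasLevel A 1}
  zero_mem' := ⟨zero_mem _, HasLevel.zero⟩
  add_mem' hA hB := ⟨add_mem hA.1 hB.1, hA.2.add hB.2⟩
  smul_mem' c _ hA := ⟨(complexE n).smul_mem c hA.1, hA.2.smul c⟩

theorem weightShift_lastRoot_mem_levelOne (hn : 3 < n) :
    weightShift n (lastRoot n) ∈ levelOne n := by
  refine ⟨weightShift_mem (lastRoot_mem hn), ?_⟩
  have h := (hasDegree_weightShift (lastRoot n)).hasLevel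
  rwa [lastRoot_last hn] at h

/-- The elements of level one are generated from the last simple root by the elements of level
zero. -/
theorem mem_of_mem_levelOne (hn : 3 < n) (hn' : n ≤ 7)
    {W : Submodule ℂ (Matrix (minusculeWeights n) (minusculeWeights n) ℂ)}
    (h0 : weightShift n (lastRoot n) ∈ W)
    (hW : ∀ y ∈ complexE n, HasLevel y 0 → ∀ x ∈ W, x ∈ levelOne n → ⁅y, x⁆ ∈ W)
    {A : Matrix (minusculeWeights n) (minusculeWeights n) ℂ} (hA : A ∈ levelOne n) : A ∈ W := by
  let V : Submodule ℂ (Matrix (minusculeWeights n) (minusculeWeights n) ℂ) :=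
    (complexE n).toSubmodule ⊓ W.comap (levelPart 1)
  have hgen {A : Matrix (minusculeWeights n) (minusculeWeights n) ℂ}
      (h : ∃ α ∈ simpleRoots n, A = weightShift n α ∨ A = weightShift n (-α)) :
      A ∈ complexE n ∧ (HasLevel A 0 ∨ A = weightShift n (lastRoot n) ∨ HasLevel A (-1)) := by
    obtain ⟨α, hα, h⟩ := h
    refine ⟨LieSubalgebra.subset_lieSpan ⟨α, hα, h⟩, ?_⟩
    by_cases h1 : α = lastRoot n
    · rcases h with rfl | rfl
      · exact Or.inr (Or.inl (by rw [h1]))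
      · have h2 := (hasDegree_weightShift (-α)).hasLevel
        rw [Pi.neg_apply, h1, lastRoot_last hn] at h2
        exact Or.inr (Or.inr (by rw [h1]; exact h2))
    · refine Or.inl ?_
      have h2 := simpleRoot_last hn hα h1
      rcases h with rfl | rfl
      · rw [← h2]
        exact (hasDegree_weightShift α).hasLevel
      · have h3 := (hasDegree_weightShift (-α)).hasLevel
        rwa [Pi.neg_apply, h2, neg_zero] at h3
  have h1 : A ∈ V := by
    refine mem_of_mem_lieSpan_of_stable ?_ ?_ hA.1
    · intro A h
      refine ⟨(hgen h).1, ?_⟩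
      change levelPart 1 A ∈ W
      rcases (hgen h).2 with h1 | rfl | h1
      · rw [h1.levelPart_eq]
        simp
      · rwa [(weightShift_lastRoot_mem_levelOne hn).2.levelPart_eq, if_pos rfl]
      · rw [h1.levelPart_eq]
        simp
    · rintro a h B ⟨hB, hB'⟩
      obtain ⟨ha, ha'⟩ := hgen h
      refine ⟨(complexE n).lie_mem ha hB, ?_⟩
      change levelPart 1 ⁅a, B⁆ ∈ W
      have hBL (k : ℤ) := levelPart_mem hB k
      rcases ha' with h1 | rfl | h1
      · rw [h1.levelPart_lie]
        exact hW a ha h1 _ hB' ⟨hBL 1, hasLevel_levelPart _ _⟩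
      · rw [(weightShift_lastRoot_mem_levelOne hn).2.levelPart_lie, sub_self, ← lie_skew]
        exact W.neg_mem (hW _ (hBL 0) (hasLevel_levelPart _ _) _ h0
          (weightShift_lastRoot_mem_levelOne hn))
      · have h2 : levelPart 2 B = 0 := by
          ext u v
          by_contra h3
          have h4 := hasLevel_levelPart 2 B u v h3
          have h5 := level_bound hn hn' (hBL 2) h3
          lia
        rw [h1.levelPart_lie, (by norm_num : (1 : ℤ) - -1 = 2), h2, lie_zero]
        exact W.zero_mem
  have h2 : levelPart 1 A ∈ W := h1.2
  rwa [hA.2.levelPart_eq, if_pos rfl] at h2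

/-- The generator of the center of the maximal compact subalgebra. -/
def centralVector (n : ℕ) : Fin (n + 1) → ℂ :=
  Pi.single (Fin.last n) 1 - (1 / (9 - n) : ℂ) • canonicalClass n ℂ

theorem lorentz_centralVector (hn : 3 < n) (hn' : n ≤ 7) :
    lorentz n ℂ (canonicalClass n ℂ) (centralVector n) = 0 := by
  have h0 : Fin.last n ≠ 0 := by
    simp [Fin.ext_iff]
    lia
  have h1 : (9 - n : ℂ) ≠ 0 := by
    rw [sub_ne_zero]
    exact_mod_cast (by lia : 9 ≠ n)
  rw [centralVector, map_sub, map_smul, lorentz_single_of_ne_zero _ h0, lorentz_canonicalClass,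
    canonicalClass_of_ne_zero h0, smul_eq_mul]
  simp only [canonicalClass, Fin.cons_zero, Fin.cons_succ, Finset.sum_const, Finset.card_univ,
    Fintype.card_fin, nsmul_eq_mul]
  field_simp
  ring

theorem lie_I_smul_centralVector (hn : 3 < n) (hn' : n ≤ 7)
    (A : Matrix (minusculeWeights n) (minusculeWeights n) ℂ) (u v : minusculeWeights n) :
    ⁅Complex.I • torus n (centralVector n), A⁆ u v =
      Complex.I * ((u.1 (Fin.last n) - v.1 (Fin.last n) : ℤ) : ℂ) * A u v := by
  have h0 : Fin.last n ≠ 0 := by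
    simp [Fin.ext_iff]
    lia
  have h1 : lorentz n ℂ (fun j ↦ ((u.1 j - v.1 j : ℤ) : ℂ)) (canonicalClass n ℂ) = 0 := by
    rw [lorentz_comm, ← canonicalClass_intCast]
    refine (lorentz_intCast _ (u.1 - v.1)).trans ?_
    rw [lorentz_canonicalClass_sub hn', Int.cast_zero]
  rw [smul_lie, Matrix.smul_apply, torus_lie_apply, centralVector, map_sub, map_smul,
    lorentz_single_of_ne_zero _ h0, h1, smul_zero, sub_zero, smul_eq_mul, mul_assoc]

/-- A matrix annihilated by the part of the torus orthogonal to the last simple root is a multiple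
of the root vector, if it has level one. -/
theorem exists_eq_smul_of_torus_lie (hn : 3 < n) (hn' : n ≤ 7)
    {x : Matrix (minusculeWeights n) (minusculeWeights n) ℂ} (hx : x ∈ levelOne n)
    (h : ∀ w : Fin (n + 1) → ℤ, lorentz n ℤ (canonicalClass n ℤ) w = 0 →
      lorentz n ℤ (lastRoot n) w = 0 → ∀ u v, x u v ≠ 0 → lorentz n ℤ (u.1 - v.1) w = 0) :
    ∃ t : ℂ, x = t • weightShift n (lastRoot n) := by
  refine exists_eq_smul_weightShift hn hn' (lastRoot_mem hn) hx.1 fun u v huv ↦ ?_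
  have hα := isDelPezzoRoot_of_mem_simpleRoots hn.le (lastRoot_mem hn)
  have hαl : lastRoot n (Fin.last n) = 1 := lastRoot_last hn
  set α := lastRoot n
  have hβ := lorentz_canonicalClass_sub hn' u v
  have hl : (u.1 - v.1) (Fin.last n) = 1 := hx.2 u v huv
  set w : Fin (n + 1) → ℤ := (2 : ℤ) • (u.1 - v.1) - lorentz n ℤ α (u.1 - v.1) • α with hw
  have h1 : lorentz n ℤ (canonicalClass n ℤ) w = 0 := by
    rw [hw, map_sub, map_smul, map_smul, hβ, hα.2]
    simp
  have h2 : lorentz n ℤ α w = 0 := by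
    rw [hw, map_sub, map_smul, map_smul, hα.1]
    simp only [smul_eq_mul]
    ring
  have h3 := h w h1 h2 u v huv
  have h4 : lorentz n ℤ w w = 0 := by
    nth_rw 1 [hw]
    simp only [map_sub, map_smul, LinearMap.sub_apply, LinearMap.smul_apply] at h3 ⊢
    rw [h2, h3]
    simp
  have h5 : w = 0 := eq_zero_of_lorentz_self_nonpos (by lia) h1 h4.le
  have h6 := congrFun h5 (Fin.last n)
  rw [hw, Pi.sub_apply, Pi.smul_apply, Pi.smul_apply, hl, hαl] at h6
  simp only [smul_eq_mul, mul_one, Pi.zero_apply] at h6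
  rw [hw, ← sub_eq_zero.1 h6, ← smul_sub] at h5
  exact sub_eq_zero.1 ((smul_eq_zero.1 h5).resolve_left two_ne_zero)

theorem conjTranspose_of_level_zero {A : Matrix (minusculeWeights n) (minusculeWeights n) ℂ}
    (hA : A ∈ hermitianE n) (h : HasLevel A 0) : Aᴴ = -A := by
  ext u v
  have h1 := (mem_hermitianE_iff.1 hA).2 u v
  rw [conjTranspose_apply, Matrix.neg_apply]
  by_cases h2 : A u v = 0
  · rw [h2, mul_zero, add_zero, mul_eq_zero] at h1
    rw [h2, neg_zero]
    exact h1.resolve_right (by split_ifs <;> norm_num)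
  · rw [sub_eq_zero.1 (h u v h2)] at h1
    split_ifs at h1
    · linear_combination h1
    · linear_combination -h1

theorem conjTranspose_of_level_one {A : Matrix (minusculeWeights n) (minusculeWeights n) ℂ}
    (hA : A ∈ hermitianE n) (h : ∀ u v, A u v ≠ 0 → u.1 (Fin.last n) - v.1 (Fin.last n) = -1 ∨
      u.1 (Fin.last n) - v.1 (Fin.last n) = 1) : Aᴴ = A := by
  ext u v
  have h1 := (mem_hermitianE_iff.1 hA).2 u v
  rw [conjTranspose_apply]
  by_cases h2 : A u v = 0
  · rw [h2, mul_zero, add_zero, mul_eq_zero] at h1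
    rw [h2]
    exact h1.resolve_right (by split_ifs <;> norm_num)
  · have h3 : Even (u.1 (Fin.last n)) ↔ ¬ Even (v.1 (Fin.last n)) := by
      rcases h u v h2 with h3 | h3
      · rw [(by lia : v.1 (Fin.last n) = u.1 (Fin.last n) + 1), Int.even_add_one, not_not]
      · rw [(by lia : u.1 (Fin.last n) = v.1 (Fin.last n) + 1), Int.even_add_one]
    by_cases h4 : Even (v.1 (Fin.last n))
    · have h5 : ¬ Even (u.1 (Fin.last n)) := fun h5 ↦ h3.1 h5 h4
      simp only [h4, h5, if_true, if_false] at h1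
      linear_combination h1
    · have h5 := h3.2 h4
      simp only [h4, h5, if_true, if_false] at h1
      linear_combination -h1

theorem lie_conjTranspose {A x : Matrix (minusculeWeights n) (minusculeWeights n) ℂ}
    (hA : Aᴴ = -A) : ⁅A, x⁆ᴴ = ⁅A, xᴴ⁆ := by
  simp only [LieRing.of_associative_ring_bracket, conjTranspose_sub, conjTranspose_mul, hA]
  noncomm_ring

/-- The `J`-linear parametrization of the noncompact part by the elements of level one. -/
def hermitianOfLevelOne (n : ℕ) : levelOne n →ₗ[ℝ] hermitianE n where
  toFun x := ⟨x.1 + x.1ᴴ, add_conjTranspose_mem_hermitianE x.2.1 x.2.2⟩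
  map_add' x y := Subtype.ext <| by
    change (x.1 + y.1) + (x.1 + y.1)ᴴ = (x.1 + x.1ᴴ) + (y.1 + y.1ᴴ)
    rw [conjTranspose_add]
    abel
  map_smul' r x := Subtype.ext <| by
    change (r : ℂ) • x.1 + ((r : ℂ) • x.1)ᴴ = r • (x.1 + x.1ᴴ)
    rw [conjTranspose_smul, Complex.star_def, Complex.conj_ofReal, Complex.coe_smul,
      Complex.coe_smul, smul_add]

theorem hermitianOfLevelOne_coe (x : levelOne n) : (hermitianOfLevelOne n x : Matrix _ _ ℂ) =
    x.1 + x.1ᴴ := rfl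

theorem star_centralVector (j : Fin (n + 1)) : star (centralVector n j) = centralVector n j := by
  refine Fin.cases ?_ (fun i ↦ ?_) j <;>
    simp [centralVector, canonicalClass, Pi.single_apply, apply_ite (starRingEnd ℂ)]

theorem hasLevel_torus (c : ℂ) (γ : Fin (n + 1) → ℂ) : HasLevel (c • torus n γ) 0 := by
  intro u v h
  by_cases huv : u = v
  · rw [huv, sub_self]
  · simp [torus_eq_diagonal, huv] at h

theorem smul_add_conjTranspose_smul (c : ℂ)
    (x : Matrix (minusculeWeights n) (minusculeWeights n) ℂ) : c • x + (c • x)ᴴ =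
      c.re • (x + xᴴ) + c.im • (Complex.I • x + (Complex.I • x)ᴴ) := by
  ext u v
  simp only [Matrix.add_apply, Matrix.smul_apply, conjTranspose_apply, smul_eq_mul,
    Complex.real_smul, star_mul', Complex.star_def, Complex.conj_I]
  nth_rw 1 2 [← Complex.re_add_im c]
  simp only [map_add, map_mul, Complex.conj_I, Complex.conj_ofReal]
  ring

theorem eq_add_I_smul (y : Matrix (minusculeWeights n) (minusculeWeights n) ℂ) :
    y = (1 / 2 : ℂ) • (y + (-1 : ℂ) • yᴴ) +
      Complex.I • ((-Complex.I / 2) • (y + (1 : ℂ) • yᴴ)) := by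
  rw [smul_smul, (by linear_combination (-1 / 2 : ℂ) * Complex.I_mul_I :
    Complex.I * (-Complex.I / 2) = 1 / 2), ← smul_add]
  ext u v
  simp only [Matrix.smul_apply, Matrix.add_apply, conjTranspose_apply, smul_eq_mul]
  ring

section

variable (hn : 3 < n) (hn' : n ≤ 7)
include hn hn'

theorem lie_centralVector_of_hasLevel {A : Matrix (minusculeWeights n) (minusculeWeights n) ℂ}
    {k : ℤ} (hA : HasLevel A k) :
    ⁅Complex.I • torus n (centralVector n), A⁆ = (Complex.I * (k : ℂ)) • A := by
  ext u v
  rw [lie_I_smul_centralVector hn hn', Matrix.smul_apply, smul_eq_mul]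
  by_cases h : A u v = 0
  · rw [h, mul_zero, mul_zero]
  · rw [hA u v h]

theorem lie_centralVector_add_conjTranspose
    {A : Matrix (minusculeWeights n) (minusculeWeights n) ℂ} (hA : HasLevel A 1) :
    ⁅Complex.I • torus n (centralVector n), A + Aᴴ⁆ = Complex.I • A + (Complex.I • A)ᴴ := by
  rw [lie_add, lie_centralVector_of_hasLevel hn hn' hA,
    lie_centralVector_of_hasLevel hn hn' hA.conjTranspose, conjTranspose_smul]
  simp

theorem I_smul_torus_intCast_mem {w : Fin (n + 1) → ℤ}
    (hw : lorentz n ℤ (canonicalClass n ℤ) w = 0) :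
    Complex.I • torus n (fun j ↦ (w j : ℂ)) ∈ hermitianE n := by
  refine I_smul_torus_mem hn hn' ?_ fun j ↦ by simp
  rw [← canonicalClass_intCast, lorentz_intCast, hw, Int.cast_zero]

theorem exists_eq_smul_of_lie {x : Matrix (minusculeWeights n) (minusculeWeights n) ℂ}
    (hx : x ∈ levelOne n)
    (h : ∀ u ∈ hermitianE n, HasLevel u 0 →
      ⁅u, weightShift n (lastRoot n) + (weightShift n (lastRoot n))ᴴ⁆ = 0 → ⁅u, x + xᴴ⁆ = 0) :
    ∃ t : ℂ, x = t • weightShift n (lastRoot n) := by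
  refine exists_eq_smul_of_torus_lie hn hn' hx fun w hw hw' p q hpq ↦ ?_
  have h1 := h _ (I_smul_torus_intCast_mem hn hn' hw) (hasLevel_torus _ _) (by
    rw [weightShift_conjTranspose, smul_lie, lie_add, (hasDegree_weightShift _).torus_lie,
      (hasDegree_weightShift _).torus_lie, lorentz_intCast, lorentz_intCast, map_neg,
      LinearMap.neg_apply, hw']
    simp)
  have h2 : x q p = 0 := by
    by_contra h2
    have h3 := hx.2 q p h2
    have h4 := hx.2 p q hpq
    lia
  have h3 := congrFun (congrFun h1 p) q
  rw [smul_lie, Matrix.smul_apply, torus_lie_apply, Matrix.add_apply, conjTranspose_apply, h2,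
    star_zero, add_zero, Matrix.zero_apply, smul_eq_mul, mul_eq_zero, mul_eq_zero] at h3
  have h4 := (h3.resolve_left Complex.I_ne_zero).resolve_right hpq
  have h5 := (lorentz_intCast (R := ℂ) (p.1 - q.1) w).symm.trans h4
  exact_mod_cast h5

theorem add_conjTranspose_mem_of_stable
    {W : Submodule ℝ (Matrix (minusculeWeights n) (minusculeWeights n) ℂ)}
    (h0 : weightShift n (lastRoot n) + (weightShift n (lastRoot n))ᴴ ∈ W)
    (hW : ∀ u ∈ hermitianE n, HasLevel u 0 → ∀ x ∈ W, ⁅u, x⁆ ∈ W)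
    {x : Matrix (minusculeWeights n) (minusculeWeights n) ℂ} (hx : x ∈ levelOne n) :
    x + xᴴ ∈ W := by
  have hI {x : Matrix (minusculeWeights n) (minusculeWeights n) ℂ} (hx : x ∈ levelOne n)
      (hxW : x + xᴴ ∈ W) : Complex.I • x + (Complex.I • x)ᴴ ∈ W := by
    rw [← lie_centralVector_add_conjTranspose hn hn' hx.2]
    exact hW _ (I_smul_torus_mem hn hn' (lorentz_centralVector hn hn') star_centralVector)
      (hasLevel_torus _ _) _ hxW
  obtain ⟨V, hV⟩ : ∃ V : Submodule ℂ (Matrix (minusculeWeights n) (minusculeWeights n) ℂ),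
      ∀ x, x ∈ V ↔ x ∈ levelOne n ∧ x + xᴴ ∈ W := by
    refine ⟨⟨⟨⟨{x | x ∈ levelOne n ∧ x + xᴴ ∈ W}, ?_⟩, ?_⟩, ?_⟩, fun x ↦ Iff.rfl⟩
    · rintro x y ⟨hx, hx'⟩ ⟨hy, hy'⟩
      refine ⟨add_mem hx hy, ?_⟩
      rw [conjTranspose_add, add_add_add_comm]
      exact add_mem hx' hy'
    · refine ⟨zero_mem _, ?_⟩
      rw [conjTranspose_zero, add_zero]
      exact zero_mem _
    · rintro c x ⟨hx, hx'⟩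
      refine ⟨(levelOne n).smul_mem c hx, ?_⟩
      rw [smul_add_conjTranspose_smul]
      exact add_mem (W.smul_mem _ hx') (W.smul_mem _ (hI hx hx'))
  have hVa {a x : Matrix (minusculeWeights n) (minusculeWeights n) ℂ} (ha : a ∈ complexE n)
      (ha' : aᴴ = -a) (hal : HasLevel a 0) (hx : x ∈ V) : ⁅a, x⁆ ∈ V := by
    rw [hV] at hx ⊢
    have h1 := hal.lie hx.1.2
    rw [zero_add] at h1
    refine ⟨⟨(complexE n).lie_mem ha hx.1.1, h1⟩, ?_⟩
    rw [lie_conjTranspose ha', ← lie_add]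
    exact hW _ (mem_hermitianE_of_level_zero ha ha' hal) hal _ hx.2
  refine ((hV x).1 (mem_of_mem_levelOne hn hn' (W := V)
    ((hV _).2 ⟨weightShift_lastRoot_mem_levelOne hn, h0⟩) (fun y hy hyl x hxV _ ↦ ?_) hx)).2
  have hyH := conjTranspose_mem hy
  have hyl' := hyl.conjTranspose
  rw [neg_zero] at hyl'
  have h2 {s t : ℂ} : s • (y + t • yᴴ) ∈ complexE n :=
    (complexE n).smul_mem _ (add_mem hy ((complexE n).smul_mem _ hyH))
  have h3 {s t : ℂ} : HasLevel (s • (y + t • yᴴ)) 0 := (hyl.add (hyl'.smul t)).smul s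
  rw [eq_add_I_smul y, add_lie, smul_lie Complex.I]
  refine V.add_mem (hVa h2 ?_ h3 hxV) (V.smul_mem _ (hVa h2 ?_ h3 hxV))
  · ext u v
    simp
  · ext u v
    simp
    ring

theorem eq_zero_of_lie_eq_zero {x : Matrix (minusculeWeights n) (minusculeWeights n) ℂ}
    (hx : x ∈ complexE n) (h : ∀ y ∈ hermitianE n, ⁅x, y⁆ = 0) : x = 0 := by
  have hdiag (u v : minusculeWeights n) (huv : x u v ≠ 0) : u = v := by
    have h1 := lorentz_canonicalClass_sub hn' u v
    have h2 := h _ (I_smul_torus_intCast_mem hn hn' h1)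
    rw [← lie_skew, neg_eq_zero, smul_lie] at h2
    have h3 := congrFun (congrFun h2 u) v
    rw [Matrix.smul_apply, torus_lie_apply, Matrix.zero_apply, smul_eq_mul, mul_eq_zero,
      mul_eq_zero] at h3
    have h4 := (h3.resolve_left Complex.I_ne_zero).resolve_right huv
    have h5 := (lorentz_intCast (R := ℂ) (u.1 - v.1) (u.1 - v.1)).symm.trans h4
    have h6 : lorentz n ℤ (u.1 - v.1) (u.1 - v.1) = 0 := by exact_mod_cast h5
    exact Subtype.ext (sub_eq_zero.1 (eq_zero_of_lorentz_self_nonpos (by lia) h1 h6.le))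
  obtain ⟨γ, hγ, hxγ⟩ := exists_torus_apply_self hn.le hn' hx
  have hxt : x = torus n γ := by
    ext u v
    by_cases huv : u = v
    · rw [huv, hxγ]
    · rw [torus_eq_diagonal, diagonal_apply_ne _ huv]
      by_contra h1
      exact huv (hdiag u v h1)
  suffices γ = 0 by rw [hxt, this, map_zero]
  refine eq_zero_of_orthogonal_simpleRoots hn.le (by lia) hγ fun α hα ↦ ?_
  obtain ⟨u, v, huv⟩ := exists_weight_of_simpleRoot hn hn' hα
  have hα0 : α ≠ 0 := by
    rintro rfl
    have h1 := (isDelPezzoRoot_of_mem_simpleRoots hn.le hα).1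
    simp at h1
  have h1 : weightShift n α u v = 1 := by rw [weightShift_apply, if_pos huv]
  have h2 : weightShift n α v u = 0 := by
    rw [weightShift_apply, if_neg]
    intro h2
    rw [huv, add_assoc, left_eq_add, ← two_nsmul, smul_eq_zero] at h2
    exact hα0 (h2.resolve_left two_ne_zero)
  have h3 : ∃ y ∈ hermitianE n, y u v = 1 := by
    by_cases h3 : α = lastRoot n
    · refine ⟨weightShift n α + (weightShift n α)ᴴ, ?_, ?_⟩
      · have h4 := weightShift_lastRoot_mem_levelOne hn
        rw [h3]
        exact add_conjTranspose_mem_hermitianE h4.1 h4.2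
      · rw [Matrix.add_apply, conjTranspose_apply, h1, h2, star_zero, add_zero]
    · refine ⟨weightShift n α - (weightShift n α)ᴴ, ?_, ?_⟩
      · have h4 := (hasDegree_weightShift α).hasLevel
        have h5 := (hasDegree_weightShift (-α)).hasLevel
        rw [Pi.neg_apply] at h5
        rw [simpleRoot_last hn hα h3] at h4 h5
        refine mem_hermitianE_of_level_zero (sub_mem (weightShift_mem hα)
          (conjTranspose_mem (weightShift_mem hα))) ?_ ?_
        · rw [conjTranspose_sub, conjTranspose_conjTranspose, neg_sub]
        · rw [weightShift_conjTranspose, sub_eq_add_neg, ← neg_one_smul ℂ]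
          exact h4.add (h5.smul _)
      · rw [Matrix.sub_apply, conjTranspose_apply, h1, h2, star_zero, sub_zero]
  obtain ⟨y, hy, hyuv⟩ := h3
  have h4 := congrFun (congrFun (h y hy) u) v
  rw [hxt, torus_lie_apply, hyuv, mul_one, Matrix.zero_apply] at h4
  rw [lorentz_comm, ← h4]
  congr 2
  ext j
  rw [huv, Pi.add_apply, add_sub_cancel_left]

end

/-- The real forms `𝔢₆^{-14}` and `𝔢₇^{-25}` are of Hermitian type. -/
theorem exists_isHermitianPair_hermitianE {n : ℕ} (hn : n = 6 ∨ n = 7) :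
    ∃ (Z : hermitianE n) (Q : hermitianE n →ₗ[ℝ] hermitianE n →ₗ[ℝ] ℝ), IsHermitianPair Z Q := by
  obtain ⟨hn, hn'⟩ : 3 < n ∧ n ≤ 7 := by lia
  let Z : hermitianE n := ⟨Complex.I • torus n (centralVector n),
    I_smul_torus_mem hn hn' (lorentz_centralVector hn hn') star_centralVector⟩
  have hZ (x : hermitianE n) (u v) : (⁅Z, x⁆ : hermitianE n).1 u v =
      Complex.I * ((u.1 (Fin.last n) - v.1 (Fin.last n) : ℤ) : ℂ) * x.1 u v :=
    lie_I_smul_centralVector hn hn' x.1 u v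
  have hL (x : hermitianE n) : x.1 ∈ complexE n := (mem_hermitianE_iff.1 x.2).1
  have hk (x : hermitianE n) (hx : ⁅Z, x⁆ = 0) : HasLevel x.1 0 := by
    intro u v huv
    have h1 := hZ x u v
    rw [hx, ZeroMemClass.coe_zero, Matrix.zero_apply, eq_comm, mul_eq_zero, mul_eq_zero] at h1
    exact_mod_cast (h1.resolve_right huv).resolve_left Complex.I_ne_zero
  have hk' (x : hermitianE n) (hx : HasLevel x.1 0) : ⁅Z, x⁆ = 0 :=
    Subtype.ext ((lie_centralVector_of_hasLevel hn hn' hx).trans (by simp))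
  have hp (x : hermitianE n) (hx : ⁅Z, ⁅Z, x⁆⁆ = -x) (u v) (huv : x.1 u v ≠ 0) :
      u.1 (Fin.last n) - v.1 (Fin.last n) = -1 ∨ u.1 (Fin.last n) - v.1 (Fin.last n) = 1 := by
    rcases level_bound hn hn' (hL x) huv with h2 | h2 | h2
    · exact Or.inl h2
    · have h1 := hZ ⁅Z, x⁆ u v
      rw [hx, h2, NegMemClass.coe_neg, Matrix.neg_apply] at h1
      exact absurd (by simpa using h1) huv
    · exact Or.inr h2
  have hpH (x : hermitianE n) (hx : ⁅Z, ⁅Z, x⁆⁆ = -x) : x.1ᴴ = x.1 :=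
    conjTranspose_of_level_one x.2 (hp x hx)
  have hX (x : levelOne n) :
      ⁅Z, hermitianOfLevelOne n x⁆ = hermitianOfLevelOne n (Complex.I • x) :=
    Subtype.ext (lie_centralVector_add_conjTranspose hn hn' x.2.2)
  have hsurj (x : hermitianE n) (hx : ⁅Z, ⁅Z, x⁆⁆ = -x) : ∃ v, hermitianOfLevelOne n v = x := by
    refine ⟨⟨levelPart 1 x.1, levelPart_mem (hL x) 1, hasLevel_levelPart _ _⟩, Subtype.ext ?_⟩
    rw [hermitianOfLevelOne_coe]
    ext u v
    have h1 : star (x.1 v u) = x.1 u v := congrFun (congrFun (hpH x hx) u) v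
    change levelPart 1 x.1 u v + star (levelPart 1 x.1 v u) = x.1 u v
    rw [levelPart_apply, levelPart_apply, apply_ite star, h1, star_zero]
    by_cases h2 : x.1 u v = 0
    · simp [h2]
    · rcases hp x hx u v h2 with h3 | h3
      · rw [if_neg (by lia), if_pos (by lia), zero_add]
      · rw [if_pos (by lia), if_neg (by lia), add_zero]
  refine exists_isHermitianPair_of_matrix Z (fun x ↦ Subtype.ext ?_) ?_
    (fun x hx ↦ conjTranspose_of_level_zero x.2 (hk x hx)) hpH
    (fun x hx ↦ Subtype.ext (eq_zero_of_lie_eq_zero hn hn' (hL x) fun y hy ↦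
      congrArg Subtype.val (hx ⟨y, hy⟩)))
    (irreducible_of_parametrization (hermitianOfLevelOne n) hX hsurj
      ⟨weightShift n (lastRoot n), weightShift_lastRoot_mem_levelOne hn⟩ (fun x hx ↦ ?_)
      (fun W h0 hW x ↦ ?_))
  · ext u v
    rw [hZ, hZ, NegMemClass.coe_neg, Matrix.neg_apply, hZ]
    by_cases h1 : x.1 u v = 0
    · simp [h1]
    · rcases level_bound hn hn' (hL x) h1 with h2 | h2 | h2 <;> rw [h2] <;> push_cast
      · linear_combination (-Complex.I * x.1 u v) * Complex.I_mul_I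
      · ring
      · linear_combination (Complex.I * x.1 u v) * Complex.I_mul_I
  · obtain ⟨u, v, huv⟩ := exists_weight_of_simpleRoot hn hn' (lastRoot_mem hn)
    refine ⟨hermitianOfLevelOne n
      ⟨weightShift n (lastRoot n), weightShift_lastRoot_mem_levelOne hn⟩, fun h ↦ ?_⟩
    have h1 := congrFun (congrFun (congrArg Subtype.val h) u) v
    have h2 : u.1 (Fin.last n) - v.1 (Fin.last n) = 1 := by
      rw [huv, Pi.add_apply, lastRoot_last hn]
      ring
    have h3 : weightShift n (lastRoot n) v u = 0 := by
      by_contra h3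
      have h4 := (weightShift_lastRoot_mem_levelOne hn).2 v u h3
      lia
    rw [hZ, h2] at h1
    change _ * (weightShift n (lastRoot n) u v + star (weightShift n (lastRoot n) v u)) = 0 at h1
    rw [h3, weightShift_apply, if_pos huv] at h1
    simp at h1
  · obtain ⟨c, hc⟩ := exists_eq_smul_of_lie hn hn' x.2 fun u hu hul h ↦
      congrArg Subtype.val (hx ⟨u, hu⟩ (hk' _ hul) (Subtype.ext h))
    exact ⟨c, congrArg _ (Subtype.ext hc)⟩
  · obtain ⟨y, hy, hyx⟩ := add_conjTranspose_mem_of_stable hn hn'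
      (W := W.map (hermitianE n).toSubmodule.subtype) ⟨_, h0, rfl⟩
      (by
        rintro u hu hul _ ⟨y, hy, rfl⟩
        exact ⟨⁅⟨u, hu⟩, y⁆, hW _ (hk' _ hul) y hy, rfl⟩) x.2
    rwa [← (Subtype.ext hyx : y = hermitianOfLevelOne n x)]

end HermitianRealForm

theorem theorem1p4
    {E : Type*} [NormedAddCommGroup E] [NormedSpace ℝ E] [FiniteDimensional ℝ E]
    {G : Type*} [TopologicalSpace G] [ChartedSpace E G] [Group G] [LieGroup 𝓘(ℝ, E) ∞ G]
    (hG :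
      (∃ k : ℕ, 3 ≤ k ∧ HasLieAlgebra 𝓘(ℝ, E) G (soStar k)) ∨
      (∃ k : ℕ, 2 ≤ k ∧ HasLieAlgebra 𝓘(ℝ, E) G (LieAlgebra.Symplectic.sp (Fin k) ℝ)) ∨
      (∃ k : ℕ, 3 ≤ k ∧ HasLieAlgebra 𝓘(ℝ, E) G (LieAlgebra.Orthogonal.so' (Fin 2) (Fin k) ℝ)) ∨
      (∃ k : ℕ, 3 ≤ k ∧ HasLieAlgebra 𝓘(ℝ, E) G (suPQ 1 k)) ∨
      (∃ k₁ k₂ : ℕ, 2 ≤ k₁ ∧ 2 ≤ k₂ ∧ HasLieAlgebra 𝓘(ℝ, E) G (suPQ k₁ k₂)) ∨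
      HasLieAlgebra 𝓘(ℝ, E) G e6m14 ∨
      HasLieAlgebra 𝓘(ℝ, E) G e7m25)
    (m : ℝ) (hm : 0 < m) :
    ∃ S : Set (PseudoRiemannianMetric 𝓘(ℝ, E) G), S.Infinite ∧
      (∀ g ∈ S, ∀ h ∈ S, g ≠ h → ¬ ∃ c : ℝ, ∀ (x : G) (v w : TangentSpace 𝓘(ℝ, E) x),
        h.val x v w = c * g.val x v w) ∧
      ∀ g ∈ S, IsLeftInvariantMetric g ∧ g.IsLorentzian ∧ ¬ IsEinstein g ∧
        ∃ v : GroupLieAlgebra 𝓘(ℝ, E) G, v ≠ 0 ∧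
          ∃ c : ℝ, IsQuasiEinstein m g (mulInvariantVectorField v) c := by
  rcases hG with ⟨k, hk, hG⟩ | ⟨k, hk, hG⟩ | ⟨k, hk, hG⟩ | ⟨k, hk, hG⟩ | ⟨k, l, hk, hl, hG⟩ | hG | hG
  · obtain ⟨Z, Q, h⟩ := exists_isHermitianPair_soStar (k := k) (by lia)
    exact exists_metrics_of_hasLieAlgebra hG h hm
  · obtain ⟨Z, Q, h⟩ := exists_isHermitianPair_sp (k := k) (by lia)
    exact exists_metrics_of_hasLieAlgebra hG h hm
  · obtain ⟨Z, Q, h⟩ := exists_isHermitianPair_so' (k := k) hk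
    exact exists_metrics_of_hasLieAlgebra hG h hm
  · obtain ⟨Z, Q, h⟩ := exists_isHermitianPair_suPQ (p := 1) (q := k) one_pos (by lia)
    exact exists_metrics_of_hasLieAlgebra hG h hm
  · obtain ⟨Z, Q, h⟩ := exists_isHermitianPair_suPQ (p := k) (q := l) (by lia) (by lia)
    exact exists_metrics_of_hasLieAlgebra hG h hm
  · obtain ⟨Z, Q, h⟩ := exists_isHermitianPair_hermitianE (n := 6) (Or.inl rfl)
    exact exists_metrics_of_hasLieAlgebra hG h hm
  · obtain ⟨Z, Q, h⟩ := exists_isHermitianPair_hermitianE (n := 7) (Or.inr rfl)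
    exact exists_metrics_of_hasLieAlgebra hG h hm
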